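/- Let $A=(a_{i,j})$ be an $s\times n$ matrix with entries in $\mathbb N\cup\{-\infty\}$. For a set $Y$ of $s$ columns, let $\mathcal O_{Y,A}$ be the maximum, over all bijections $\sigma$ from the rows to $Y$, of $\sum_{i}a_{i,\sigma(i)}$ (so $0$ if $s=0$). The saddle Jacobi number $\hat{\mathcal O}_A$ is the minimum of $\mathcal O_{Y,A}$ over the sets $Y$ of $s$ columns with $\mathcal O_{Y,A}\neq-\infty$, and $-\infty$ if there is no such $Y$ (in particular if $s>n$). Zeros of a matrix are *transversal* if they lie in mutually different rows and columns. For a matrix $B$ with entries in $\{0,-\infty\}$, let $r$ be its maximum number of transversal zeros. A call $\mathrm{HK}(B)$ returns $(R_0,C_0,Y_1)$, where $(R_0,C_0)$ is the pair of a set of rows and a set of columns with $\sharp R_0+\sharp C_0=r$ that together contain all the zeros of $B$, such that $R_0$ is the largest and $C_0$ the smallest possible for inclusion, and $Y_1$ is the set of those columns of some family of $r$ transversal zeros of $B$ that do not belong to $C_0$. The recursive algorithm **Ō-test** is, on input $A$: if $A$ has no row, return $\emptyset$; if $A$ has more rows than columns, or some row of $A$ contains no $0$, return "failed"; suppress from $A$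 all columns whose entries are all $-\infty$; let $B$ be the submatrix of the columns of $A$ that contain only $0$ or $-\infty$; let $(R_0,C_0,Y_1):=\mathrm{HK}(B)$; if $R_0=\emptyset$, return "failed"; let $Y_2$ be the result of Ō-test on $A$ without the rows in $R_0$; if $Y_2$ is "failed", return "failed"; otherwise return $Y_2\cup Y_1$. For a run of the algorithm, let $p$ be the number of calls of Ō-test (the initial one included), and let $d$ be the largest of $1$ and of the maximum numbers of transversal zeros of the matrices $B$ on which HK is called. Elementary operations are those of a programming language with integer variables and integer arrays indexed by pairs of integers, at unit cost each: use of a constant, reading or writing a variable or an array cell, addition, subtraction, comparison, logical combination of tests, and control steps; the input is $s$, $n$ and the array of the $a_{i,j}$, with $-\infty$ represented by $-1$. An implementation of Ō-test is a program, the same for all $s$, $n$ and $A$, that always stops with the result of a run of Ō-test on $A$ and the list of the triples $(R_0,C_0,Y_1)$ obtained in that run. Then: i) The algorithm can always be run to its end from each of its calls. Whatever $Y_1$ are chosen by HK, it returns "failed" if $\hat{\mathcal O}_A\neq0$, and otherwise it returns a set $Y$ of $s$ columns with $\mathcal O_{Y,A}=\hat{\mathcal O}_A=0$. ii) There are an implementation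 of Ō-test and a constant $K$ such that, for all $s,n\ge0$ and all $A$, it uses at most $K\,(d^{1/2}\,p\,s\,n+1)$ elementary operations; that is, $O(d^{1/2}psn)$. iii) There are an implementation of Ō-test and a constant $K$ such that, for all $s,n\ge0$ and all $A$ for which $C_0=\emptyset$ at each call of HK, it uses at most $K\,\bigl((d^{1/2}+\ln s)\,s\,n+1\bigr)$ elementary operations (the term $(d^{1/2}+\ln s)sn$ being $0$ when $s=0$); that is, $O((d^{1/2}+\ln s)sn)$. -/

import Mathlib

/-! ### Jacobi numbers

Matrices have entries in `WithBot ℕ`, that is `ℕ ∪ {-∞}` with `⊥ = -∞`. -/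

/-- The Jacobi number `O_A`: the maximum over all injections `σ` from rows to columns of
`∑ i, A i (σ i)`; it is `⊥` when there is no injection. For a square matrix it is the tropical
determinant. -/
noncomputable def jacobiNumber {ι κ : Type*} [Fintype ι] [Fintype κ] [DecidableEq ι] [DecidableEq κ]
    (A : Matrix ι κ (WithBot ℕ)) : WithBot ℕ :=
  (Finset.univ : Finset (ι ↪ κ)).sup fun σ => ∑ i, A i (σ i)

/-- `O_{Y,A}`: the Jacobi number of the submatrix of `A` formed of the columns in `Y`. -/
noncomputable def jacobiNumberOn {s n : ℕ} (A : Matrix (Fin s) (Fin n) (WithBot ℕ)) (Y : Finset (Fin n)) :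
    WithBot ℕ :=
  jacobiNumber (A.submatrix id (Subtype.val : {j // j ∈ Y} → Fin n))

/-- The sets `Y` of `s` columns with `O_{Y,A} ≠ -∞`. -/
noncomputable def finiteColumnSets {s n : ℕ} (A : Matrix (Fin s) (Fin n) (WithBot ℕ)) :
    Finset (Finset (Fin n)) :=
  (Finset.univ.powersetCard s).filter fun Y => jacobiNumberOn A Y ≠ ⊥

/-- The saddle Jacobi number: the minimum of `O_{Y,A}` over the sets `Y` of `s` columns with
`O_{Y,A} ≠ -∞`, and `-∞` if there is no such `Y` (in particular if `s > n`). -/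
noncomputable def saddleJacobiNumber {s n : ℕ} (A : Matrix (Fin s) (Fin n) (WithBot ℕ)) : WithBot ℕ :=
  if h : (finiteColumnSets A).Nonempty then (finiteColumnSets A).inf' h (jacobiNumberOn A) else ⊥

/-! ### Transversal zeros and the subroutine HK -/

/-- `M` is a set of positions of transversal zeros (in mutually different rows and columns) of the
submatrix of `A` with rows `R` and columns `B`. -/
def IsTransversalZeros {s n : ℕ} (A : Matrix (Fin s) (Fin n) (WithBot ℕ))
    (R : Finset (Fin s)) (B : Finset (Fin n)) (M : Finset (Fin s × Fin n)) : Prop :=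
  (∀ x ∈ M, x.1 ∈ R ∧ x.2 ∈ B ∧ A x.1 x.2 = 0) ∧
    (∀ x ∈ M, ∀ y ∈ M, x.1 = y.1 → x = y) ∧ (∀ x ∈ M, ∀ y ∈ M, x.2 = y.2 → x = y)

open Classical in
/-- The maximum number of transversal zeros of the submatrix of `A` with rows `R` and
columns `B`. -/
noncomputable def maxTransversalZeros {s n : ℕ} (A : Matrix (Fin s) (Fin n) (WithBot ℕ))
    (R : Finset (Fin s)) (B : Finset (Fin n)) : ℕ :=
  ((Finset.univ : Finset (Finset (Fin s × Fin n))).filter (IsTransversalZeros A R B)).sup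
    Finset.card

/-- The rows `R'` and columns `C'` of the submatrix of `A` with rows `R` and columns `B` contain
all its zeros, and their total number is the maximum number of transversal zeros. -/
def IsMinZeroCover {s n : ℕ} (A : Matrix (Fin s) (Fin n) (WithBot ℕ))
    (R : Finset (Fin s)) (B : Finset (Fin n)) (R' : Finset (Fin s)) (C' : Finset (Fin n)) : Prop :=
  R' ⊆ R ∧ C' ⊆ B ∧ (∀ i ∈ R, ∀ j ∈ B, A i j = 0 → i ∈ R' ∨ j ∈ C') ∧
    R'.card + C'.card = maxTransversalZeros A R B

/-- `(R₀, C₀, Y₁)` is a correct output of the subroutine HK on the submatrix of `A` with rows `R`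
and columns `B`: among the minimal covers of the zeros, `(R₀, C₀)` is the one with the largest set
of rows and the smallest set of columns, and `Y₁` is the set of the columns not in `C₀` of some
maximum family of transversal zeros. -/
def IsHKOutput {s n : ℕ} (A : Matrix (Fin s) (Fin n) (WithBot ℕ))
    (R : Finset (Fin s)) (B : Finset (Fin n))
    (R₀ : Finset (Fin s)) (C₀ Y₁ : Finset (Fin n)) : Prop :=
  IsMinZeroCover A R B R₀ C₀ ∧
    (∀ R' C', IsMinZeroCover A R B R' C' → R' ⊆ R₀ ∧ C₀ ⊆ C') ∧
    ∃ M, IsTransversalZeros A R B M ∧ M.card = maxTransversalZeros A R B ∧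
      Y₁ = M.image Prod.snd \ C₀

/-! ### The algorithm Ō-test -/

/-- The columns in `C` that are not entirely `-∞` on the rows `R`. -/
def liveColumns {s n : ℕ} (A : Matrix (Fin s) (Fin n) (WithBot ℕ))
    (R : Finset (Fin s)) (C : Finset (Fin n)) : Finset (Fin n) :=
  C.filter fun j => ∃ i ∈ R, A i j ≠ ⊥

/-- The columns in `C` that contain only `-∞` or `0` on the rows `R`. -/
def flatColumns {s n : ℕ} (A : Matrix (Fin s) (Fin n) (WithBot ℕ))
    (R : Finset (Fin s)) (C : Finset (Fin n)) : Finset (Fin n) :=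
  C.filter fun j => ∀ i ∈ R, A i j = ⊥ ∨ A i j = 0

/-- The test at the beginning of the algorithm, on the submatrix with rows `R` and columns `C`:
there are more rows than columns, or some row contains no `0`. -/
def ObviousFailure {s n : ℕ} (A : Matrix (Fin s) (Fin n) (WithBot ℕ))
    (R : Finset (Fin s)) (C : Finset (Fin n)) : Prop :=
  C.card < R.card ∨ ∃ i ∈ R, ∀ j ∈ C, A i j ≠ 0

/-- The record of one call of HK: the rows and columns of the matrix `B` it is called on, and the
triple `(R₀, C₀, Y₁)` it returns. -/
structure HKCall (s n : ℕ) where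
  rows : Finset (Fin s)
  cols : Finset (Fin n)
  R₀ : Finset (Fin s)
  C₀ : Finset (Fin n)
  Y₁ : Finset (Fin n)

/-- `OTestRun A R C p tr res`: the algorithm Ō-test, applied to the submatrix of `A` with rows `R`
and columns `C`, can run with a total of `p` calls of Ō-test (the initial one included) and the
successive calls of HK recorded in `tr`, and return `res`, where `none` stands for "failed".
The only freedom left to a run is the choice of `Y₁` by HK. -/
inductive OTestRun {s n : ℕ} (A : Matrix (Fin s) (Fin n) (WithBot ℕ)) :
    Finset (Fin s) → Finset (Fin n) → ℕ → List (HKCall s n) → Option (Finset (Fin n)) → Prop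
  | empty (C : Finset (Fin n)) : OTestRun A ∅ C 1 [] (some ∅)
  | obvious (R : Finset (Fin s)) (C : Finset (Fin n)) (hR : R.Nonempty)
      (hf : ObviousFailure A R C) : OTestRun A R C 1 [] none
  | stuck (R : Finset (Fin s)) (C C' B C₀ Y₁ : Finset (Fin n)) (hR : R.Nonempty)
      (hf : ¬ ObviousFailure A R C) (hC' : C' = liveColumns A R C) (hB : B = flatColumns A R C')
      (hHK : IsHKOutput A R B ∅ C₀ Y₁) :
      OTestRun A R C 1 [⟨R, B, ∅, C₀, Y₁⟩] none
  | step (R : Finset (Fin s)) (C C' B : Finset (Fin n)) (R₀ : Finset (Fin s))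
      (C₀ Y₁ : Finset (Fin n)) (p : ℕ) (tr : List (HKCall s n)) (res : Option (Finset (Fin n)))
      (hR : R.Nonempty) (hf : ¬ ObviousFailure A R C)
      (hC' : C' = liveColumns A R C) (hB : B = flatColumns A R C')
      (hHK : IsHKOutput A R B R₀ C₀ Y₁) (hR₀ : R₀.Nonempty)
      (hrec : OTestRun A (R \ R₀) C' p tr res) :
      OTestRun A R C (p + 1) (⟨R, B, R₀, C₀, Y₁⟩ :: tr) (res.map fun Y₂ => Y₂ ∪ Y₁)

/-- The number `d`: the largest of the maximum numbers of transversal zeros of the matrices `B`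
on which HK is called (`0` if HK is never called). -/
noncomputable def maxHKRank {s n : ℕ} (A : Matrix (Fin s) (Fin n) (WithBot ℕ))
    (tr : List (HKCall s n)) : ℕ :=
  (tr.map fun c => maxTransversalZeros A c.rows c.cols).foldr max 0

/-! ### Programs and their number of elementary operations

A program uses finitely many integer variables `x₀, x₁, …` and arrays `a₀, a₁, …` indexed by pairs
of integers. The elementary operations are: using a constant, reading or writing a variable or an
array cell, adding or subtracting two integers, comparing two integers, and the control steps. -/

/-- The memory of a program. -/
structure Mem where
  var : ℕ → ℤ
  arr : ℕ → ℤ → ℤ → ℤ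

/-- Integer expressions. -/
inductive IntExp
  | const (z : ℤ)
  | var (x : ℕ)
  | arr (a : ℕ) (i j : IntExp)
  | add (e f : IntExp)
  | sub (e f : IntExp)

namespace IntExp

/-- The value of an expression. -/
def eval (m : Mem) : IntExp → ℤ
  | const z => z
  | var x => m.var x
  | arr a i j => m.arr a (eval m i) (eval m j)
  | add e f => eval m e + eval m f
  | sub e f => eval m e - eval m f

/-- The number of elementary operations in the evaluation of an expression. -/
def cost : IntExp → ℕ
  | const _ => 1
  | var _ => 1
  | arr _ i j => cost i + cost j + 1
  | add e f => cost e + cost f + 1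
  | sub e f => cost e + cost f + 1

end IntExp

/-- Tests. -/
inductive Test
  | le (e f : IntExp)
  | eq (e f : IntExp)
  | not (t : Test)
  | and (t u : Test)

namespace Test

/-- The truth value of a test. -/
def Holds (m : Mem) : Test → Prop
  | le e f => e.eval m ≤ f.eval m
  | eq e f => e.eval m = f.eval m
  | not t => ¬ Holds m t
  | and t u => Holds m t ∧ Holds m u

/-- The number of elementary operations in the evaluation of a test. -/
def cost : Test → ℕ
  | le e f => e.cost + f.cost + 1
  | eq e f => e.cost + f.cost + 1
  | not t => cost t + 1
  | and t u => cost t + cost u + 1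

end Test

/-- Programs. -/
inductive Prog
  | skip
  | assign (x : ℕ) (e : IntExp)
  | store (a : ℕ) (i j e : IntExp)
  | seq (P Q : Prog)
  | ite (t : Test) (P Q : Prog)
  | loop (t : Test) (P : Prog)

/-- Writing the value `v` in the variable `x`. -/
def Mem.setVar (m : Mem) (x : ℕ) (v : ℤ) : Mem :=
  { m with var := fun y => if y = x then v else m.var y }

/-- Writing the value `v` in the cell `(i, j)` of the array `a`. -/
def Mem.setArr (m : Mem) (a : ℕ) (i j : ℤ) (v : ℤ) : Mem :=
  { m with arr := fun b k l => if b = a ∧ k = i ∧ l = j then v else m.arr b k l }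

/-- `Exec P m t m'`: the program `P`, started with memory `m`, stops after exactly `t` elementary
operations with memory `m'`. -/
inductive Exec : Prog → Mem → ℕ → Mem → Prop
  | skip (m : Mem) : Exec Prog.skip m 1 m
  | assign (x : ℕ) (e : IntExp) (m : Mem) :
      Exec (Prog.assign x e) m (e.cost + 1) (m.setVar x (e.eval m))
  | store (a : ℕ) (i j e : IntExp) (m : Mem) :
      Exec (Prog.store a i j e) m (i.cost + j.cost + e.cost + 1)
        (m.setArr a (i.eval m) (j.eval m) (e.eval m))
  | seq (P Q : Prog) (m m' m'' : Mem) (t t' : ℕ) (hP : Exec P m t m') (hQ : Exec Q m' t' m'') :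
      Exec (Prog.seq P Q) m (t + t') m''
  | ite_true (b : Test) (P Q : Prog) (m m' : Mem) (t : ℕ) (hb : b.Holds m) (hP : Exec P m t m') :
      Exec (Prog.ite b P Q) m (b.cost + t + 1) m'
  | ite_false (b : Test) (P Q : Prog) (m m' : Mem) (t : ℕ) (hb : ¬ b.Holds m)
      (hQ : Exec Q m t m') : Exec (Prog.ite b P Q) m (b.cost + t + 1) m'
  | loop_true (b : Test) (P : Prog) (m m' m'' : Mem) (t t' : ℕ) (hb : b.Holds m)
      (hP : Exec P m t m') (hW : Exec (Prog.loop b P) m' t' m'') :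
      Exec (Prog.loop b P) m (b.cost + t + t' + 1) m''
  | loop_false (b : Test) (P : Prog) (m : Mem) (hb : ¬ b.Holds m) :
      Exec (Prog.loop b P) m (b.cost + 1) m

/-- The integer that represents a matrix entry in memory: `-∞` is represented by `-1`. -/
def encodeEntry : WithBot ℕ → ℤ
  | ⊥ => -1
  | (k : ℕ) => k

/-- The initial memory on input `A`: `x₀ = s`, `x₁ = n`, the array `a₀` holds the matrix, and all
other variables and cells are `0`. -/
def inputMem {s n : ℕ} (A : Matrix (Fin s) (Fin n) (WithBot ℕ)) : Mem where
  var x := if x = 0 then s else if x = 1 then n else 0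
  arr a i j :=
    if h : a = 0 ∧ (0 ≤ i ∧ i < s) ∧ (0 ≤ j ∧ j < n) then
      encodeEntry (A ⟨i.toNat, by omega⟩ ⟨j.toNat, by omega⟩)
    else 0

/-- Row `k` of the array `a` is the characteristic vector of `S`. -/
def HoldsSet {r : ℕ} (m : Mem) (a k : ℕ) (S : Finset (Fin r)) : Prop :=
  ∀ i : Fin r, m.arr a (k : ℤ) ((i : ℕ) : ℤ) = if i ∈ S then 1 else 0

/-- The memory contains the result `res` of the algorithm and the transcript of its run:
`x₀` is `0` for "failed" and `1` otherwise; in the latter case row `0` of `a₄` is the set `Y`;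
`x₁` is the number of calls of HK, and the rows `k` of `a₁`, `a₂`, `a₃` are the sets
`R₀`, `C₀`, `Y₁` returned by the call number `k` of HK. -/
def HoldsRun {s n : ℕ} (m : Mem) (tr : List (HKCall s n)) (res : Option (Finset (Fin n))) : Prop :=
  m.var 0 = (if res.isSome then 1 else 0) ∧
    (∀ Y, res = some Y → HoldsSet m 4 0 Y) ∧
    m.var 1 = tr.length ∧
    ∀ (k : ℕ) (c : HKCall s n), tr[k]? = some c →
      HoldsSet m 1 k c.R₀ ∧ HoldsSet m 2 k c.C₀ ∧ HoldsSet m 3 k c.Y₁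

/-- The program `P` implements Ō-test on the input `A`: it stops after `t` elementary operations
with, in memory, the result and the transcript of a run of the algorithm with `p` calls of Ō-test
and the calls of HK recorded in `tr`. -/
def ImplementsOTest {s n : ℕ} (P : Prog) (A : Matrix (Fin s) (Fin n) (WithBot ℕ))
    (t p : ℕ) (tr : List (HKCall s n)) : Prop :=
  ∃ (m : Mem) (res : Option (Finset (Fin n))),
    Exec P (inputMem A) t m ∧ OTestRun A Finset.univ Finset.univ p tr res ∧ HoldsRun m tr res

/-! ### A program logic with running times -/

-- Correctness rests on zero blocks: a set of rows `R` and equally many columns `Y` with a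
-- transversal of zeros, such that every finite transversal consists of zeros. Finite entries are
-- nonnegative, so the saddle Jacobi number is `0` exactly when the set of all rows has a zero block
-- (`saddleJacobiNumber_eq_zero_iff`). A step of the algorithm preserves the existence of blocks in
-- both directions. Suppressing rows leaves a block (`IsZeroBlock.sdiff`). Conversely `Y₁` can be
-- added to a block of the remaining rows (`IsZeroBlock.union`): its columns contain only `0` and
-- `-∞`, their zeros are all in `R₀`, and there are as many columns in `Y₁` as rows in `R₀`, so
-- every finite transversal matches `R₀` with `Y₁`. Finally `R₀ = ∅` excludes a block with at least
-- one row (`IsZeroBlock.nonempty_of_isHKOutput`). Indeed, in the digraph of finite entries relative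
-- to a transversal of zeros, a minimal nonempty set of rows closed under predecessors has only
-- zeros as finite entries in its columns; otherwise Hall's theorem gives a finite transversal
-- through a positive entry, or else a smaller closed set. Its columns are then in `B`, and its rows
-- can be added to `R₀`.
--
-- The running time depends on maximum matchings. HK is implemented by an auction followed by single
-- augmentations. With prices up to `L`, an auction on `s` rows and `b` columns costs `O(s b L)`,
-- and the size `μ₁` of its matching satisfies `L μ ≤ (L + 1) μ₁`, where `μ` is the maximum size
-- (`IsPricedMatching.mul_card_le`). At most `μ₁ / L` augmentations of cost `O(s b)` remain, and `L`
-- of order `√μ` balances the two costs. As `μ` is unknown, a first auction with `L = 1` estimates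
-- it within a factor `2`. The last, unsuccessful search yields the columns reachable by alternating
-- paths from the unmatched rows; by König's argument they form the smallest `C₀`
-- (`isHKOutput_of_reachable`).
--
-- Counters of the finite and of the positive entries of each column give the columns of `B` in
-- `O(n)` per call of HK. They are updated in `O(n)` per suppressed row, hence in `O(s n)`
-- altogether. A call of HK thus costs `O(n + √d s |B|)`, apart from these updates, and there are at
-- most `s` such calls. Bounding each `|B|` by `n` gives ii). When `C₀ = ∅` at each call, all the
-- zeros of `B` are in suppressed rows, so its columns disappear: the sets `B` are disjoint, the sum
-- of the `|B|` is at most `n`, and iii) follows, even without the logarithm.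

infixr:40 " ;; " => Prog.seq

/-- `Runs P m Q`: started with memory `m`, the program `P` stops, after some number `t` of
elementary operations and with some memory `m'`, such that `Q t m'`. -/
def Runs (P : Prog) (m : Mem) (Q : ℕ → Mem → Prop) : Prop :=
  ∃ t m', Exec P m t m' ∧ Q t m'

namespace Prog

/-- `P.writesVar x`: the variable `x` occurs on the left of an assignment in `P`. -/
def writesVar : Prog → ℕ → Bool
  | skip, _ => false
  | assign y _, x => x == y
  | store _ _ _ _, _ => false
  | seq P Q, x => P.writesVar x || Q.writesVar x
  | ite _ P Q, x => P.writesVar x || Q.writesVar x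
  | loop _ P, x => P.writesVar x

/-- `P.writesArr a`: some cell of the array `a` is written in `P`. -/
def writesArr : Prog → ℕ → Bool
  | skip, _ => false
  | assign _ _, _ => false
  | store b _ _ _, a => a == b
  | seq P Q, a => P.writesArr a || Q.writesArr a
  | ite _ P Q, a => P.writesArr a || Q.writesArr a
  | loop _ P, a => P.writesArr a

/-- The memories `m` and `m'` agree on all that `P` does not write. -/
def Frame (P : Prog) (m m' : Mem) : Prop :=
  (∀ x, P.writesVar x = false → m'.var x = m.var x) ∧
    ∀ a, P.writesArr a = false → m'.arr a = m.arr a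

/-- `for x := 0, …, y - 1 do P`. -/
def forTo (x y : ℕ) (P : Prog) : Prog :=
  assign x (IntExp.const 0) ;;
    loop (Test.not (Test.le (IntExp.var y) (IntExp.var x)))
      (P ;; assign x (IntExp.add (IntExp.var x) (IntExp.const 1)))

end Prog

theorem Mem.setVar_var (m : Mem) (x : ℕ) (v : ℤ) (y : ℕ) :
    (m.setVar x v).var y = if y = x then v else m.var y := rfl

theorem Mem.setVar_arr (m : Mem) (x : ℕ) (v : ℤ) : (m.setVar x v).arr = m.arr := rfl

theorem Mem.setArr_var (m : Mem) (a : ℕ) (i j v : ℤ) : (m.setArr a i j v).var = m.var := rfl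

theorem Mem.setArr_arr (m : Mem) (a : ℕ) (i j v : ℤ) (b : ℕ) (k l : ℤ) :
    (m.setArr a i j v).arr b k l = if b = a ∧ k = i ∧ l = j then v else m.arr b k l := rfl

theorem Mem.setArr_arr_of_ne (m : Mem) (a : ℕ) (i j v : ℤ) (b : ℕ) (h : b ≠ a) :
    (m.setArr a i j v).arr b = m.arr b := by
  funext k l
  simp [Mem.setArr_arr, h]

/-- As `writesVar` and `writesArr` compute on the syntax, the side conditions of this frame rule are
later discharged by `rfl`, and specifications only need to mention what a program modifies. -/
theorem Exec.frame {P : Prog} {m m' : Mem} {t : ℕ} (h : Exec P m t m') : P.Frame m m' := by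
  induction h with
  | skip m => exact ⟨fun _ _ => rfl, fun _ _ => rfl⟩
  | assign x e m =>
    refine ⟨fun y hy => ?_, fun _ _ => rfl⟩
    have : y ≠ x := by simpa [Prog.writesVar] using hy
    simp [Mem.setVar_var, this]
  | store a i j e m =>
    refine ⟨fun _ _ => rfl, fun b hb => ?_⟩
    exact Mem.setArr_arr_of_ne _ _ _ _ _ _ (by simpa [Prog.writesArr] using hb)
  | seq P Q m m' m'' t t' hP hQ ihP ihQ =>
    refine ⟨fun x hx => ?_, fun a ha => ?_⟩
    · simp only [Prog.writesVar, Bool.or_eq_false_iff] at hx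
      rw [ihQ.1 x hx.2, ihP.1 x hx.1]
    · simp only [Prog.writesArr, Bool.or_eq_false_iff] at ha
      rw [ihQ.2 a ha.2, ihP.2 a ha.1]
  | ite_true b P Q m m' t hb hP ih =>
    refine ⟨fun x hx => ?_, fun a ha => ?_⟩
    · simp only [Prog.writesVar, Bool.or_eq_false_iff] at hx
      exact ih.1 x hx.1
    · simp only [Prog.writesArr, Bool.or_eq_false_iff] at ha
      exact ih.2 a ha.1
  | ite_false b P Q m m' t hb hP ih =>
    refine ⟨fun x hx => ?_, fun a ha => ?_⟩
    · simp only [Prog.writesVar, Bool.or_eq_false_iff] at hx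
      exact ih.1 x hx.2
    · simp only [Prog.writesArr, Bool.or_eq_false_iff] at ha
      exact ih.2 a ha.2
  | loop_true b P m m' m'' t t' hb hP hW ihP ihW =>
    exact ⟨fun x hx => (ihW.1 x hx).trans (ihP.1 x hx),
      fun a ha => (ihW.2 a ha).trans (ihP.2 a ha)⟩
  | loop_false b P m hb => exact ⟨fun _ _ => rfl, fun _ _ => rfl⟩

namespace Runs

variable {P P' : Prog} {m : Mem} {Q Q' : ℕ → Mem → Prop}

theorem mono (h : Runs P m Q) (hQ : ∀ t m', Q t m' → Q' t m') : Runs P m Q' := by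
  obtain ⟨t, m', he, hq⟩ := h
  exact ⟨t, m', he, hQ _ _ hq⟩

/-- What a program does not write is unchanged. -/
theorem mono_frame (h : Runs P m Q) (hQ : ∀ t m', P.Frame m m' → Q t m' → Q' t m') :
    Runs P m Q' := by
  obtain ⟨t, m', he, hq⟩ := h
  exact ⟨t, m', he, hQ _ _ he.frame hq⟩

theorem skip_iff : Runs Prog.skip m Q ↔ Q 1 m := by
  constructor
  · rintro ⟨t, m', he, hq⟩
    cases he
    exact hq
  · exact fun h => ⟨_, _, Exec.skip m, h⟩

theorem assign_iff {x : ℕ} {e : IntExp} :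
    Runs (Prog.assign x e) m Q ↔ Q (e.cost + 1) (m.setVar x (e.eval m)) := by
  constructor
  · rintro ⟨t, m', he, hq⟩
    cases he
    exact hq
  · exact fun h => ⟨_, _, Exec.assign x e m, h⟩

theorem store_iff {a : ℕ} {i j e : IntExp} :
    Runs (Prog.store a i j e) m Q ↔
      Q (i.cost + j.cost + e.cost + 1) (m.setArr a (i.eval m) (j.eval m) (e.eval m)) := by
  constructor
  · rintro ⟨t, m', he, hq⟩
    cases he
    exact hq
  · exact fun h => ⟨_, _, Exec.store a i j e m, h⟩

theorem seq_iff :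
    Runs (P ;; P') m Q ↔ Runs P m fun t m' => Runs P' m' fun t' m'' => Q (t + t') m'' := by
  constructor
  · rintro ⟨t, m', he, hq⟩
    cases he with
    | seq _ _ _ m1 _ t1 t2 h1 h2 => exact ⟨t1, m1, h1, t2, _, h2, hq⟩
  · rintro ⟨t, m', he, t', m'', he', hq⟩
    exact ⟨_, _, Exec.seq _ _ _ _ _ _ _ he he', hq⟩

theorem ite_iff {b : Test} :
    Runs (Prog.ite b P P') m Q ↔
      (b.Holds m → Runs P m fun t m' => Q (b.cost + t + 1) m') ∧
        (¬ b.Holds m → Runs P' m fun t m' => Q (b.cost + t + 1) m') := by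
  constructor
  · rintro ⟨t, m', he, hq⟩
    cases he with
    | ite_true _ _ _ _ _ t hb h => exact ⟨fun _ => ⟨t, _, h, hq⟩, fun h' => absurd hb h'⟩
    | ite_false _ _ _ _ _ t hb h => exact ⟨fun h' => absurd h' hb, fun _ => ⟨t, _, h, hq⟩⟩
  · rintro ⟨h1, h2⟩
    by_cases hb : b.Holds m
    · obtain ⟨t, m', he, hq⟩ := h1 hb
      exact ⟨_, _, Exec.ite_true _ _ _ _ _ _ hb he, hq⟩
    · obtain ⟨t, m', he, hq⟩ := h2 hb
      exact ⟨_, _, Exec.ite_false _ _ _ _ _ _ hb he, hq⟩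

theorem seq_intro {R : ℕ → Mem → Prop} (h : Runs P m R)
    (h' : ∀ t m', P.Frame m m' → R t m' → Runs P' m' fun t' m'' => Q (t + t') m'') :
    Runs (P ;; P') m Q :=
  seq_iff.2 (h.mono_frame h')

/-- The rule for loops: `I v τ m` holds at the head of the loop when `τ` elementary operations have
been made since its beginning; `v` decreases at each passage. -/
theorem loop_intro {b : Test} (I : ℕ → ℕ → Mem → Prop) {v₀ : ℕ} {m₀ : Mem} (h₀ : I v₀ 0 m₀)
    (h : ∀ v τ m, P.Frame m₀ m → I v τ m → b.Holds m →
      Runs P m fun t m' => ∃ v' < v, I v' (τ + (b.cost + t + 1)) m') :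
    Runs (Prog.loop b P) m₀ fun t m' =>
      ∃ v τ, t = τ + (b.cost + 1) ∧ I v τ m' ∧ ¬ b.Holds m' := by
  suffices H : ∀ v τ m, P.Frame m₀ m → I v τ m → Runs (Prog.loop b P) m fun t m' =>
      ∃ v' τ', τ + t = τ' + (b.cost + 1) ∧ I v' τ' m' ∧ ¬ b.Holds m' by
    simpa using H v₀ 0 m₀ ⟨fun _ _ => rfl, fun _ _ => rfl⟩ h₀
  intro v
  induction v using Nat.strong_induction_on with
  | _ v ih =>
    intro τ m hf hI
    by_cases hb : b.Holds m
    · obtain ⟨t, m', he, v', hv', hI'⟩ := h v τ m hf hI hb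
      have hf' : P.Frame m₀ m' := ⟨fun x hx => (he.frame.1 x hx).trans (hf.1 x hx),
        fun a ha => (he.frame.2 a ha).trans (hf.2 a ha)⟩
      obtain ⟨t2, m2, he2, v2, τ2, h1, h2, h3⟩ := ih v' hv' _ m' hf' hI'
      exact ⟨_, _, Exec.loop_true _ _ _ _ _ _ _ hb he he2, v2, τ2, by omega, h2, h3⟩
    · exact ⟨_, _, Exec.loop_false _ _ _ hb, v, τ, rfl, hI, hb⟩

/-- The rule for `for` loops: `I i τ m` holds at the head of the loop when the index is `i` and `τ`
elementary operations have been made since its beginning. -/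
theorem forTo_elapsed {x y : ℕ} {n : ℕ} (I : ℤ → ℕ → Mem → Prop) (hn : m.var y = n)
    (hxy : x ≠ y) (hPy : P.writesVar y = false) (hPx : P.writesVar x = false)
    (h₀ : I 0 0 (m.setVar x 0))
    (h : ∀ (i : ℤ) τ m', (Prog.forTo x y P).Frame m m' → 0 ≤ i → i < n → m'.var x = i →
      m'.var y = n → I i τ m' →
        Runs P m' fun t m'' => I (i + 1) (τ + (t + 9)) (m''.setVar x (i + 1))) :
    Runs (Prog.forTo x y P) m fun t m' => m'.var x = n ∧ ∃ τ, t = τ + 7 ∧ I n τ m' := by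
  rw [Prog.forTo, seq_iff, assign_iff]
  refine (loop_intro (fun v τ m' => ∃ i : ℕ, i + v = n ∧ m'.var x = i ∧
    m'.var y = n ∧ I i τ m') (v₀ := n) ⟨0, by simp, by simp [Mem.setVar_var, IntExp.eval],
      by rw [Mem.setVar_var, if_neg hxy.symm, hn], by simpa [IntExp.eval] using h₀⟩ ?_).mono ?_
  · rintro v τ m' hf ⟨i, hi, hx, hy, hI⟩ hb
    simp only [Test.Holds, IntExp.eval, hx, hy] at hb
    rw [seq_iff]
    refine (h i τ m' ⟨fun z hz => ?_, fun a ha => ?_⟩ (by omega) (by omega) hx hy hI).mono_frame ?_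
    · simp only [Prog.forTo, Prog.writesVar, Bool.or_eq_false_iff, beq_eq_false_iff_ne] at hz
      rw [hf.1 z (by simp [Prog.writesVar, hz]), Mem.setVar_var, if_neg hz.1]
    · simp only [Prog.forTo, Prog.writesArr, Bool.or_eq_false_iff] at ha
      rw [hf.2 a (by simp [Prog.writesArr, ha]), Mem.setVar_arr]
    · rintro t m'' hf' hI'
      have hx' : m''.var x = i := (hf'.1 x hPx).trans hx
      rw [assign_iff]
      refine ⟨v - 1, by omega, i + 1, by omega, ?_, ?_, ?_⟩
      · simp [Mem.setVar_var, IntExp.eval, hx']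
      · rw [Mem.setVar_var, if_neg hxy.symm, hf'.1 y hPy, hy]
      · simp only [IntExp.cost, Test.cost, IntExp.eval, hx']
        -- Besides its body, a passage costs `4` for the test, `4` for the increment and `1` for the
        -- control step of the loop.
        rw [show τ + (1 + 1 + 1 + 1 + (t + (1 + 1 + 1 + 1)) + 1) = τ + (t + 9) by omega]
        exact_mod_cast hI'
  · rintro t m' ⟨v, τ, rfl, ⟨i, hi, hx, hy, hI⟩, hb⟩
    have hi' : i = n := by
      simp only [Test.Holds, IntExp.eval, hx, hy] at hb
      omega
    subst hi'
    -- The constant `7` is `2` for the initial assignment and `5` for the last, failing test.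
    simp only [IntExp.cost, Test.cost]
    exact ⟨hx, τ, by omega, hI⟩

/-- The rule for `for` loops whose body takes a bounded number of elementary operations. -/
theorem forTo_intro {x y : ℕ} {n c : ℕ} (I : ℤ → Mem → Prop) (hn : m.var y = n)
    (hxy : x ≠ y) (hPy : P.writesVar y = false) (hPx : P.writesVar x = false)
    (h₀ : I 0 (m.setVar x 0))
    (h : ∀ (i : ℤ) m', (Prog.forTo x y P).Frame m m' → 0 ≤ i → i < n → m'.var x = i →
      m'.var y = n → I i m' → Runs P m' fun t m'' => t ≤ c ∧ I (i + 1) (m''.setVar x (i + 1))) :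
    Runs (Prog.forTo x y P) m fun t m' => t ≤ (c + 9) * n + 7 ∧ m'.var x = n ∧ I n m' := by
  refine (forTo_elapsed (fun i τ m' => I i m' ∧ (τ : ℤ) ≤ (c + 9) * i) hn hxy hPy hPx
    ⟨h₀, by simp⟩ ?_).mono ?_
  · rintro i τ m' hf hi0 hin hx hy ⟨hI, hτ⟩
    refine (h i m' hf hi0 hin hx hy hI).mono ?_
    rintro t m'' ⟨ht, hI'⟩
    refine ⟨hI', ?_⟩
    push_cast
    linarith [show (t : ℤ) ≤ c by exact_mod_cast ht]
  · rintro t m' ⟨hx, τ, rfl, hI, hτ⟩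
    refine ⟨?_, hx, hI⟩
    have : τ ≤ (c + 9) * n := by exact_mod_cast hτ
    omega

end Runs

theorem Mem.setArr_arr_self (m : Mem) (a : ℕ) (i j v : ℤ) :
    (m.setArr a i j v).arr a i = Function.update (m.arr a i) j v := by
  funext l
  simp [Mem.setArr_arr, Function.update_apply]

attribute [simp] Mem.setVar_var Mem.setVar_arr Mem.setArr_var Mem.setArr_arr Mem.setArr_arr_self
  Mem.setArr_arr_of_ne IntExp.eval IntExp.cost Test.Holds Test.cost Runs.skip_iff Runs.assign_iff
  Runs.store_iff Runs.seq_iff Runs.ite_iff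


/-! ### Matchings between initial segments of the integers -/

/-- `mr` and `mc` describe a matching of the bipartite graph `E` between the rows `0, …, s - 1` and
the columns `0, …, b - 1`: `mr i` is the mate of the row `i` and `mc q` the mate of the column `q`,
`-1` standing for the absence of a mate. -/
structure IsMatching (s b : ℕ) (E : ℤ → ℤ → Prop) (mr mc : ℤ → ℤ) : Prop where
  row : ∀ i : ℤ, 0 ≤ i → i < s → mr i ≠ -1 → 0 ≤ mr i ∧ mr i < b ∧ E i (mr i) ∧ mc (mr i) = i
  col : ∀ q : ℤ, 0 ≤ q → q < b → mc q ≠ -1 → 0 ≤ mc q ∧ mc q < s ∧ mr (mc q) = q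

/-- The matched columns. -/
noncomputable def matchedCols (b : ℕ) (mc : ℤ → ℤ) : Finset ℤ :=
  (Finset.Ico 0 (b : ℤ)).filter (mc · ≠ -1)

theorem mem_matchedCols {b : ℕ} {mc : ℤ → ℤ} {q : ℤ} :
    q ∈ matchedCols b mc ↔ (0 ≤ q ∧ q < b) ∧ mc q ≠ -1 := by
  simp [matchedCols]

theorem card_matchedCols_update {b : ℕ} {mc : ℤ → ℤ} {j c : ℤ} (h0 : 0 ≤ j) (hb : j < b)
    (hj : mc j = -1) (hc : c ≠ -1) :
    (matchedCols b (Function.update mc j c)).card = (matchedCols b mc).card + 1 := by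
  have : matchedCols b (Function.update mc j c) = insert j (matchedCols b mc) := by
    ext q
    simp only [mem_matchedCols, Finset.mem_insert, Function.update_apply]
    grind
  rw [this, Finset.card_insert_of_notMem]
  simp [mem_matchedCols, hj]

theorem matchedCols_update_of_ne {b : ℕ} {mc : ℤ → ℤ} {j c : ℤ}
    (hj : mc j ≠ -1) (hc : c ≠ -1) :
    matchedCols b (Function.update mc j c) = matchedCols b mc := by
  ext q
  simp only [mem_matchedCols, Function.update_apply]
  grind

theorem IsMatching.card_matchedCols_le {s b : ℕ} {E : ℤ → ℤ → Prop} {mr mc : ℤ → ℤ}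
    (h : IsMatching s b E mr mc) : (matchedCols b mc).card ≤ s := by
  have : (matchedCols b mc).card ≤ (Finset.Ico 0 (s : ℤ)).card := by
    apply Finset.card_le_card_of_injOn mc
    · intro q hq
      have hq := mem_matchedCols.1 hq
      have := h.col q hq.1.1 hq.1.2 hq.2
      simp; omega
    · intro q hq q' hq' he
      have hq := mem_matchedCols.1 hq
      have hq' := mem_matchedCols.1 hq'
      have h1 := h.col q hq.1.1 hq.1.2 hq.2
      have h2 := h.col q' hq'.1.1 hq'.1.2 hq'.2
      rw [← h1.2.2, ← h2.2.2, he]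
  simpa using this

/-- Prices of the columns in an auction: they are at most `L`, columns of positive price are
matched, and the mate of a row is, up to `1`, one of its cheapest neighbours. -/
structure IsPricedMatching (s b : ℕ) (E : ℤ → ℤ → Prop) (L : ℤ) (mr mc p : ℤ → ℤ) : Prop
    extends IsMatching s b E mr mc where
  price : ∀ q : ℤ, 0 ≤ q → q < b → 0 ≤ p q ∧ p q ≤ L
  matched : ∀ q : ℤ, 0 ≤ q → q < b → p q ≠ 0 → mc q ≠ -1
  slack : ∀ i q : ℤ, 0 ≤ i → i < s → 0 ≤ q → q < b → mr i ≠ -1 → E i q → p (mr i) ≤ p q + 1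

/-- The slack condition survives because `j` is a cheapest neighbour of `c`: once raised, its price
exceeds that of any neighbour by at most `1`. No other row has the mate `j`, and for the other rows
the prices of neighbours can only grow. -/
theorem IsPricedMatching.bid_free {s b : ℕ} {E : ℤ → ℤ → Prop} {L : ℤ} {mr mc p : ℤ → ℤ}
    (h : IsPricedMatching s b E L mr mc p) {c j : ℤ} (hc0 : 0 ≤ c) (hcs : c < s) (hc : mr c = -1)
    (hj0 : 0 ≤ j) (hjb : j < b) (hE : E c j) (hpj : p j < L)
    (hmin : ∀ q : ℤ, 0 ≤ q → q < b → E c q → p j ≤ p q) (hj : mc j = -1) :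
    IsPricedMatching s b E L (Function.update mr c j) (Function.update mc j c)
      (Function.update p j (p j + 1)) := by
  obtain ⟨⟨hrow, hcol⟩, hp, hm, hs⟩ := h
  refine ⟨⟨?_, ?_⟩, ?_, ?_, ?_⟩ <;> simp only [Function.update_apply] <;> grind

theorem IsPricedMatching.bid_taken {s b : ℕ} {E : ℤ → ℤ → Prop} {L : ℤ} {mr mc p : ℤ → ℤ}
    (h : IsPricedMatching s b E L mr mc p) {c j : ℤ} (hc0 : 0 ≤ c) (hcs : c < s) (hc : mr c = -1)
    (hj0 : 0 ≤ j) (hjb : j < b) (hE : E c j) (hpj : p j < L)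
    (hmin : ∀ q : ℤ, 0 ≤ q → q < b → E c q → p j ≤ p q) (hj : mc j ≠ -1) :
    IsPricedMatching s b E L (Function.update (Function.update mr c j) (mc j) (-1))
      (Function.update mc j c) (Function.update p j (p j + 1)) := by
  obtain ⟨⟨hrow, hcol⟩, hp, hm, hs⟩ := h
  have h1 := hcol j hj0 hjb hj
  -- The two updates of `mr` concern different rows, since `c` is unmatched whereas `mr (mc j) = j`.
  have h2 : c ≠ mc j := by
    rintro rfl
    omega
  refine ⟨⟨?_, ?_⟩, ?_, ?_, ?_⟩ <;> simp only [Function.update_apply] <;> grind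

/-- When all the neighbours of the unmatched rows have price `L`, a matching has at most
`1 + 1 / L` times as many edges as the priced matching. -/
theorem IsPricedMatching.mul_card_le {s b : ℕ} {E : ℤ → ℤ → Prop} {L : ℕ} {mr mc p : ℤ → ℤ}
    (h : IsPricedMatching s b E L mr mc p)
    (hfree : ∀ i q : ℤ, 0 ≤ i → i < s → 0 ≤ q → q < b → mr i = -1 → E i q → L ≤ p q)
    {mr' mc' : ℤ → ℤ} (h' : IsMatching s b E mr' mc') :
    L * (matchedCols b mc').card ≤ L * (matchedCols b mc).card + (matchedCols b mc).card := by
  set M := matchedCols b mc with hM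
  set M' := matchedCols b mc' with hM'
  -- A price level `k` splits the columns of the other matching. Those of price at least `k > 0` are
  -- matched here too. Those of lower price are sent injectively to columns of price at most `k`,
  -- through their mates in one matching and then in the other. Only the columns of price exactly
  -- `k` are counted twice.
  have key : ∀ k ∈ Finset.Ioc 0 L, M'.card ≤ M.card + (M.filter fun q => p q = (k : ℤ)).card := by
    intro k hk
    rw [Finset.mem_Ioc] at hk
    have h1 : (M'.filter fun q => (k : ℤ) ≤ p q).card ≤ (M.filter fun q => (k : ℤ) ≤ p q).card := by
      apply Finset.card_le_card
      intro q hq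
      rw [Finset.mem_filter, mem_matchedCols] at hq ⊢
      exact ⟨⟨hq.1.1, h.matched q hq.1.1.1 hq.1.1.2 (by omega)⟩, hq.2⟩
    have h2 : (M'.filter fun q => ¬ (k : ℤ) ≤ p q).card ≤
        (M.filter fun q => p q ≤ (k : ℤ)).card := by
      -- An unmatched row has no neighbour of price less than `L`, and `k ≤ L`.
      have hh : ∀ q ∈ M'.filter fun q => ¬ (k : ℤ) ≤ p q, mr (mc' q) ≠ -1 := by
        intro q hq
        rw [Finset.mem_filter, mem_matchedCols] at hq
        obtain ⟨⟨⟨hq0, hqb⟩, hq1⟩, hq2⟩ := hq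
        have hc := h'.col q hq0 hqb hq1
        have hr := h'.row (mc' q) hc.1 hc.2.1 (by omega)
        rw [hc.2.2] at hr
        intro he
        have := hfree (mc' q) q hc.1 hc.2.1 hq0 hqb he hr.2.2.1
        omega
      apply Finset.card_le_card_of_injOn fun q => mr (mc' q)
      · intro q hq
        have h3 := hh q hq
        simp only [Finset.coe_filter, Set.mem_ofPred_eq] at hq
        rw [mem_matchedCols] at hq
        obtain ⟨⟨⟨hq0, hqb⟩, hq1⟩, hq2⟩ := hq
        have hc := h'.col q hq0 hqb hq1
        have hr := h'.row (mc' q) hc.1 hc.2.1 (by omega)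
        rw [hc.2.2] at hr
        have hr' := h.row (mc' q) hc.1 hc.2.1 h3
        simp only [Finset.coe_filter, Set.mem_ofPred_eq]
        rw [mem_matchedCols]
        refine ⟨⟨⟨hr'.1, hr'.2.1⟩, by omega⟩, ?_⟩
        have := h.slack (mc' q) q hc.1 hc.2.1 hq0 hqb h3 hr.2.2.1
        omega
      · intro q hq q' hq' he
        have h3 := hh q hq
        have h3' := hh q' hq'
        simp only [Finset.coe_filter, Set.mem_ofPred_eq] at hq hq'
        rw [mem_matchedCols] at hq hq'
        have hc := h'.col q hq.1.1.1 hq.1.1.2 hq.1.2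
        have hc' := h'.col q' hq'.1.1.1 hq'.1.1.2 hq'.1.2
        have hr := h.row (mc' q) hc.1 hc.2.1 h3
        have hr' := h.row (mc' q') hc'.1 hc'.2.1 h3'
        simp only at he
        rw [← he] at hr'
        rw [← hc.2.2, ← hc'.2.2, ← hr.2.2.2, ← hr'.2.2.2]
    have h3 := Finset.card_filter_add_card_filter_not (s := M') (fun q => (k : ℤ) ≤ p q)
    have h4 : (M.filter fun q => (k : ℤ) ≤ p q).card + (M.filter fun q => p q ≤ (k : ℤ)).card =
        M.card + (M.filter fun q => p q = (k : ℤ)).card := by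
      rw [← Finset.card_union_add_card_inter]
      congr 2
      · ext q
        simp only [Finset.mem_union, Finset.mem_filter]
        grind
      · ext q
        simp only [Finset.mem_inter, Finset.mem_filter]
        grind
    omega
  have hsum := Finset.sum_le_sum key
  -- The sets of matched columns of price `1, …, L` are disjoint, so that summing `key` over the
  -- levels costs the size of the matching only once.
  have hdisj : ∑ k ∈ Finset.Ioc 0 L, (M.filter fun q => p q = (k : ℤ)).card ≤ M.card := by
    rw [← Finset.card_biUnion]
    · exact Finset.card_le_card (Finset.biUnion_subset.2 fun _ _ => Finset.filter_subset _ _)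
    · intro x _ y _ hxy
      rw [Function.onFun, Finset.disjoint_left]
      intro q hq hq'
      rw [Finset.mem_filter] at hq hq'
      omega
  rw [Finset.sum_const, Finset.sum_add_distrib, Finset.sum_const, Nat.card_Ioc] at hsum
  simp only [smul_eq_mul, Nat.sub_zero] at hsum
  omega

/-- The columns with a positive price are matched. -/
theorem IsPricedMatching.sum_price_le {s b : ℕ} {E : ℤ → ℤ → Prop} {L : ℕ} {mr mc p : ℤ → ℤ}
    (h : IsPricedMatching s b E L mr mc p) :
    ∑ q ∈ Finset.Ico 0 (b : ℤ), (p q).toNat ≤ s * L := by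
  have h1 : ∑ q ∈ Finset.Ico 0 (b : ℤ), (p q).toNat = ∑ q ∈ matchedCols b mc, (p q).toNat := by
    symm
    apply Finset.sum_subset (Finset.filter_subset _ _)
    intro q hq hq'
    rw [Finset.mem_Ico] at hq
    by_contra hne
    exact hq' (mem_matchedCols.2 ⟨hq, h.matched q hq.1 hq.2 (by omega)⟩)
  rw [h1]
  calc ∑ q ∈ matchedCols b mc, (p q).toNat ≤ ∑ q ∈ matchedCols b mc, L := by
        apply Finset.sum_le_sum
        intro q hq
        have := mem_matchedCols.1 hq
        have := h.price q this.1.1 this.1.2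
        omega
    _ = (matchedCols b mc).card * L := by simp
    _ ≤ s * L := Nat.mul_le_mul_right _ h.card_matchedCols_le

theorem sum_toNat_update {b : ℕ} {p : ℤ → ℤ} {j : ℤ} (h0 : 0 ≤ j) (hb : j < b) (hp : 0 ≤ p j) :
    ∑ q ∈ Finset.Ico 0 (b : ℤ), (Function.update p j (p j + 1) q).toNat =
      ∑ q ∈ Finset.Ico 0 (b : ℤ), (p q).toNat + 1 := by
  have hj : j ∈ Finset.Ico 0 (b : ℤ) := by simp; omega
  rw [← Finset.add_sum_erase _ _ hj, ← Finset.add_sum_erase _ (fun q => (p q).toNat) hj,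
    Function.update_self]
  have : ∑ q ∈ (Finset.Ico 0 (b : ℤ)).erase j, (Function.update p j (p j + 1) q).toNat =
      ∑ q ∈ (Finset.Ico 0 (b : ℤ)).erase j, (p q).toNat := by
    apply Finset.sum_congr rfl
    intro q hq
    rw [Function.update_of_ne (Finset.ne_of_mem_erase hq)]
  omega


/-! ### Maximum matchings: the auction

The number of rows is in the variable `vS` and the number of columns in `vB`; the cell `(i, q)` of
the array `aG` contains `1` if there is an edge between `i` and `q`. The mates of the rows, those
of the columns and the prices are in the rows `0` of `aRow`, `aCol` and `aPrice`. -/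

notation "vS" => 0
notation "vN" => 1
notation "vB" => 2
notation "vCap" => 3
notation "vMu" => 4
notation "vCur" => 5
notation "vI" => 6
notation "vQ" => 7
notation "vBest" => 8
notation "vBj" => 9
notation "vOld" => 10
notation "vSq" => 11
notation "vHead" => 12
notation "vTail" => 13
notation "vFound" => 14
notation "vClock" => 15
notation "vRow" => 16
notation "vNext" => 17
notation "vAgain" => 18

notation "aG" => 5
notation "aRow" => 6
notation "aCol" => 7
notation "aPrice" => 8
notation "aVis" => 9
notation "aPar" => 10
notation "aQueue" => 11

/-- The variable `x`, as an expression. -/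
prefix:max "‵" => IntExp.var

/-- Cell `(0, e)` of the array `a`. -/
abbrev IntExp.cell (a : ℕ) (e : IntExp) : IntExp := .arr a (.const 0) e

/-- `x := x + 1`. -/
abbrev Prog.incr (x : ℕ) : Prog := .assign x (.add ‵x (.const 1))

/-- The strict comparison. -/
abbrev Test.lt (e f : IntExp) : Test := .not (.le f e)

/-- Finds a neighbour of the row `vCur` of smallest price, among those of price less than
`vCap`. -/
def auctionScan : Prog :=
  .assign vBj (.const (-1)) ;; .assign vBest ‵vCap ;;
  .forTo vQ vB
    (.ite (.and (.eq (.arr aG ‵vCur ‵vQ) (.const 1)) (.lt (.cell aPrice ‵vQ) ‵vBest))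
      (.assign vBest (.cell aPrice ‵vQ) ;; .assign vBj ‵vQ)
      .skip)

/-- Gives the column `vBj` to the row `vCur`. -/
def auctionBid : Prog :=
  .assign vOld (.cell aCol ‵vBj) ;; .store aCol (.const 0) ‵vBj ‵vCur ;;
  .store aRow (.const 0) ‵vCur ‵vBj ;;
  .store aPrice (.const 0) ‵vBj (.add (.cell aPrice ‵vBj) (.const 1)) ;;
  .ite (.eq ‵vOld (.const (-1)))
    (.incr vMu ;; .incr vI ;; .assign vCur ‵vI)
    (.store aRow (.const 0) ‵vOld (.const (-1)) ;; .assign vCur ‵vOld)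

/-- The auction: unmatched rows take one of their cheapest neighbours, the price of which increases
by `1`, as long as there is one of price less than `vCap`. -/
def auction : Prog :=
  .assign vI (.const 0) ;; .assign vCur (.const 0) ;;
  .loop (.lt ‵vI ‵vS)
    (.ite (.eq (.cell aRow ‵vCur) (.const (-1)))
      (auctionScan ;; .ite (.eq ‵vBj (.const (-1))) (.incr vI ;; .assign vCur ‵vI) auctionBid)
      (.incr vI ;; .assign vCur ‵vI))

theorem auctionScan_spec {b : ℕ} {m : Mem} (hb : m.var vB = b) :
    Runs auctionScan m fun t m' => t ≤ 40 * (b + 1) ∧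
      (m'.var vBj = -1 → ∀ q : ℤ, 0 ≤ q → q < b → m.arr aG (m.var vCur) q = 1 →
        m.var vCap ≤ m.arr aPrice 0 q) ∧
      (m'.var vBj ≠ -1 → 0 ≤ m'.var vBj ∧ m'.var vBj < b ∧
        m.arr aG (m.var vCur) (m'.var vBj) = 1 ∧ m.arr aPrice 0 (m'.var vBj) < m.var vCap ∧
        ∀ q : ℤ, 0 ≤ q → q < b → m.arr aG (m.var vCur) q = 1 →
          m.arr aPrice 0 (m'.var vBj) ≤ m.arr aPrice 0 q) := by
  simp only [auctionScan, Runs.seq_iff, Runs.assign_iff]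
  refine (Runs.forTo_intro (c := 20) (fun k m' => m'.var vBest ≤ m.var vCap ∧
     (m'.var vBj = -1 → m'.var vBest = m.var vCap) ∧
     (m'.var vBj ≠ -1 → 0 ≤ m'.var vBj ∧ m'.var vBj < b ∧
       m.arr aG (m.var vCur) (m'.var vBj) = 1 ∧ m.arr aPrice 0 (m'.var vBj) < m.var vCap ∧
       m'.var vBest = m.arr aPrice 0 (m'.var vBj)) ∧
     ∀ q : ℤ, 0 ≤ q → q < k → m.arr aG (m.var vCur) q = 1 → m'.var vBest ≤ m.arr aPrice 0 q)
     (n := b) (by simpa using hb) (by decide) rfl rfl ?_ ?_).mono ?_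
  · simp
    omega
  · intro q m1 hf hq0 hqb hq hb1 ⟨hI1, hI2, hI3, hI4⟩
    have h1 := hf.1 vCur rfl
    have h2 := hf.2 aG rfl
    have h3 := hf.2 aPrice rfl
    simp at h1 h2 h3
    simp [h1, h2, h3, hq]
    refine ⟨fun hE hlt => ⟨by omega, by omega, by grind, fun r hr0 hrq hEr => ?_⟩,
      fun h => ⟨hI1, hI2, hI3, fun r hr0 hrq hEr => ?_⟩⟩
    · rcases hrq.lt_or_eq with hr | rfl
      · exact hlt.le.trans (hI4 r hr0 hr hEr)
      · rfl
    · rcases hrq.lt_or_eq with hr | rfl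
      · exact hI4 r hr0 hr hEr
      · exact h hEr
  · rintro t m' ⟨ht, -, -, hI2, hI3, hI4⟩
    refine ⟨by simp; omega, fun h q hq0 hqb hE => ?_, fun h => ?_⟩
    · rw [← hI2 h]
      exact hI4 q hq0 hqb hE
    · obtain ⟨h0, h1, h2, h3, h4⟩ := hI3 h
      exact ⟨h0, h1, h2, h3, fun q hq0 hqb hE => h4 ▸ hI4 q hq0 hqb hE⟩


/-- The relation between rows and columns described by an array. -/
def edges (f : ℤ → ℤ → ℤ) (i q : ℤ) : Prop := f i q = 1

/-- The state of the auction: the unmatched rows up to `i`, except the current row `cur`, have no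
neighbour of price less than `L`. The number `D` measures the progress made. -/
structure AuctionState (s b L : ℕ) (E : ℤ → ℤ → Prop) (mr mc p : ℤ → ℤ) (mu i cur : ℤ)
    (D : ℕ) : Prop extends IsPricedMatching s b E L mr mc p where
  mu_eq : mu = (matchedCols b mc).card
  i_nonneg : 0 ≤ i
  i_le : i ≤ s
  cur_eq : cur = i ∨ (0 ≤ cur ∧ cur < s) ∧ i < s
  given_up : ∀ k q : ℤ, 0 ≤ k → k < s → k ≤ i → k ≠ cur → mr k = -1 → 0 ≤ q → q < b → E k q →
    L ≤ p q
  progress : D = i.toNat + ∑ q ∈ Finset.Ico 0 (b : ℤ), (p q).toNat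

namespace AuctionState

variable {s b L : ℕ} {E : ℤ → ℤ → Prop} {mr mc p : ℤ → ℤ} {mu i cur : ℤ} {D : ℕ}

theorem progress_le (h : AuctionState s b L E mr mc p mu i cur D) : D ≤ s + s * L := by
  have h1 := h.toIsPricedMatching.sum_price_le
  have h2 := h.progress
  have h3 := h.i_le
  omega

theorem advance (h : AuctionState s b L E mr mc p mu i cur D) (hi : i < s)
    (hcur : mr cur = -1 → ∀ q : ℤ, 0 ≤ q → q < b → E cur q → L ≤ p q) :
    AuctionState s b L E mr mc p mu (i + 1) (i + 1) (D + 1) := by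
  refine ⟨h.toIsPricedMatching, h.mu_eq, by linarith [h.i_nonneg], by omega, Or.inl rfl,
    fun k q hk0 hks hki hk hr hq0 hqb hE => ?_, ?_⟩
  · by_cases hkc : k = cur
    · subst hkc
      exact hcur hr q hq0 hqb hE
    · exact h.given_up k q hk0 hks (by omega) hkc hr hq0 hqb hE
  · have := h.i_nonneg
    have := h.progress
    omega

/-- Prices never decrease, so that the rows given up keep only neighbours of price at least `L`.
Both the index and the sum of the prices grow, whence the progress `2`. -/
theorem bid_free (h : AuctionState s b L E mr mc p mu i cur D) (hi : i < s)
    (hc : mr cur = -1) {j : ℤ}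
    (hj0 : 0 ≤ j) (hjb : j < b) (hE : E cur j) (hpj : p j < L)
    (hmin : ∀ q : ℤ, 0 ≤ q → q < b → E cur q → p j ≤ p q) (hj : mc j = -1) :
    AuctionState s b L E (Function.update mr cur j) (Function.update mc j cur)
      (Function.update p j (p j + 1)) (mu + 1) (i + 1) (i + 1) (D + 2) := by
  have hi0 := h.i_nonneg
  have hcur : 0 ≤ cur ∧ cur < s := by
    have := h.cur_eq
    omega
  refine ⟨h.toIsPricedMatching.bid_free hcur.1 hcur.2 hc hj0 hjb hE hpj hmin hj, ?_, by omega,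
    by omega, Or.inl rfl, fun k q hk0 hks hki hk hr hq0 hqb hE => ?_, ?_⟩
  · rw [card_matchedCols_update hj0 hjb hj (by omega), h.mu_eq]
    simp
  · by_cases hkc : k = cur
    · subst hkc
      rw [Function.update_self] at hr
      omega
    · rw [Function.update_of_ne hkc] at hr
      have := h.given_up k q hk0 hks (by omega) hkc hr hq0 hqb hE
      rw [Function.update_apply]
      split_ifs with hqj
      · subst hqj
        omega
      · exact this
  · rw [sum_toNat_update hj0 hjb (h.price j hj0 hjb).1]
    have := h.progress
    omega

/-- The displaced row becomes the current one while `i` stays the same; the progress comes from the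
raised price alone. The displaced row may have an index greater than `i` and, if given up at this
point, is examined again when `i` reaches it. -/
theorem bid_taken (h : AuctionState s b L E mr mc p mu i cur D) (hi : i < s)
    (hc : mr cur = -1) {j : ℤ}
    (hj0 : 0 ≤ j) (hjb : j < b) (hE : E cur j) (hpj : p j < L)
    (hmin : ∀ q : ℤ, 0 ≤ q → q < b → E cur q → p j ≤ p q) (hj : mc j ≠ -1) :
    AuctionState s b L E (Function.update (Function.update mr cur j) (mc j) (-1))
      (Function.update mc j cur) (Function.update p j (p j + 1)) mu i (mc j) (D + 1) := by
  have hi0 := h.i_nonneg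
  have hcur : 0 ≤ cur ∧ cur < s := by
    have := h.cur_eq
    omega
  have hold := h.col j hj0 hjb hj
  refine ⟨h.toIsPricedMatching.bid_taken hcur.1 hcur.2 hc hj0 hjb hE hpj hmin hj, ?_, hi0, by omega,
    Or.inr ⟨⟨hold.1, hold.2.1⟩, hi⟩, fun k q hk0 hks hki hk hr hq0 hqb hE => ?_, ?_⟩
  · rw [matchedCols_update_of_ne hj (by omega), h.mu_eq]
  · rw [Function.update_of_ne hk] at hr
    by_cases hkc : k = cur
    · subst hkc
      rw [Function.update_self] at hr
      omega
    · rw [Function.update_of_ne hkc] at hr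
      have := h.given_up k q hk0 hks (by omega) hkc hr hq0 hqb hE
      rw [Function.update_apply]
      split_ifs with hqj
      · subst hqj
        omega
      · exact this
  · rw [sum_toNat_update hj0 hjb (h.price j hj0 hjb).1]
    have := h.progress
    omega

end AuctionState

/-- Each passage costs at most one scan of the `b` columns and increases the progress, which is
bounded by `s + s * L` because only matched columns have a positive price. The initial priced
matching is arbitrary, so that an auction can continue another one. -/
theorem auction_spec {s b L : ℕ} {m : Mem} (hs : m.var vS = s) (hb : m.var vB = b)
    (hL : m.var vCap = L)
    (hP : IsPricedMatching s b (edges (m.arr aG)) L (m.arr aRow 0) (m.arr aCol 0) (m.arr aPrice 0))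
    (hmu : m.var vMu = (matchedCols b (m.arr aCol 0)).card) :
    Runs auction m fun t m' => t ≤ 100 * (b + 1) * (s + s * L + 1) ∧
      IsPricedMatching s b (edges (m.arr aG)) L (m'.arr aRow 0) (m'.arr aCol 0)
        (m'.arr aPrice 0) ∧
      m'.var vMu = (matchedCols b (m'.arr aCol 0)).card ∧
      ∀ i q : ℤ, 0 ≤ i → i < s → 0 ≤ q → q < b → m'.arr aRow 0 i = -1 → edges (m.arr aG) i q →
        L ≤ m'.arr aPrice 0 q := by
  simp only [auction, Runs.seq_iff, Runs.assign_iff]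
  set E := edges (m.arr aG) with hE
  have h0 : AuctionState s b L E (m.arr aRow 0) (m.arr aCol 0) (m.arr aPrice 0) (m.var vMu) 0 0
      (∑ q ∈ Finset.Ico 0 (b : ℤ), (m.arr aPrice 0 q).toNat) :=
    ⟨hP, hmu, le_rfl, by omega, Or.inl rfl, fun k q hk0 _ hk1 hk2 => by omega, by simp⟩
  refine (Runs.loop_intro (fun v τ m' => ∃ D, v + D = s + s * L ∧ τ ≤ 100 * (b + 1) * D ∧
    AuctionState s b L E (m'.arr aRow 0) (m'.arr aCol 0) (m'.arr aPrice 0) (m'.var vMu)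
      (m'.var vI) (m'.var vCur) D)
    ⟨_, Nat.sub_add_cancel h0.progress_le, by simp, by simpa using h0⟩ ?_).mono_frame ?_
  · rintro v τ m1 hf ⟨D, hv, hτ, hA⟩ hlt
    have h1 := hf.1 vS rfl
    have h2 := hf.2 aG rfl
    have h3 := hf.1 vCap rfl
    have h4 := hf.1 vB rfl
    simp [hs, hL, hb] at h1 h2 h3 h4
    simp [h1] at hlt
    have hstep : ∀ t d, t ≤ 100 * (b + 1) → 1 ≤ d → τ + t ≤ 100 * (b + 1) * (D + d) := by
      intro t d ht hd
      nlinarith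
    have hfin : ∀ (t d : ℕ) (m' : Mem), t ≤ 100 * (b + 1) → 1 ≤ d →
        AuctionState s b L E (m'.arr aRow 0) (m'.arr aCol 0) (m'.arr aPrice 0) (m'.var vMu)
          (m'.var vI) (m'.var vCur) (D + d) →
        ∃ v' < v, ∃ D, v' + D = s + s * L ∧ τ + t ≤ 100 * (b + 1) * D ∧
          AuctionState s b L E (m'.arr aRow 0) (m'.arr aCol 0) (m'.arr aPrice 0) (m'.var vMu)
            (m'.var vI) (m'.var vCur) D := by
      intro t d m' ht hd h
      have := h.progress_le
      exact ⟨v - d, by omega, D + d, by omega, hstep t d ht hd, h⟩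
    rw [Runs.ite_iff]
    constructor
    · intro hfree
      simp at hfree
      rw [Runs.seq_iff]
      refine (auctionScan_spec h4).mono_frame ?_
      rintro t m2 hf2 ⟨ht, hno, hyes⟩
      have g3 := hf2.2 aRow rfl
      have g4 := hf2.2 aCol rfl
      have g5 := hf2.2 aPrice rfl
      have g6 := hf2.1 vI rfl
      have g7 := hf2.1 vCur rfl
      have g8 := hf2.1 vMu rfl
      rw [h2, h3] at hno hyes
      rw [Runs.ite_iff]
      constructor
      · intro hbj
        simp only [Runs.seq_iff, Runs.assign_iff]
        refine hfin _ 1 _ (by simp; omega) le_rfl ?_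
        simpa [g3, g4, g5, g6, g8] using hA.advance hlt fun _ => hno (by simpa using hbj)
      · intro hbj
        obtain ⟨y0, y1, y2, y3, y4⟩ := hyes (by simpa using hbj)
        simp only [auctionBid, Runs.seq_iff, Runs.assign_iff, Runs.store_iff, Runs.ite_iff]
        constructor
        · intro hold
          refine hfin _ 2 _ (by simp; omega) (by omega) ?_
          simp [g4] at hold
          simpa [g3, g4, g5, g6, g7, g8] using hA.bid_free hlt hfree y0 y1 y2 y3 y4 hold
        · intro hold
          refine hfin _ 1 _ (by simp; omega) le_rfl ?_
          simp [g4] at hold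
          simpa [g3, g4, g5, g6, g7, g8] using hA.bid_taken hlt hfree y0 y1 y2 y3 y4 hold
    · intro hfree
      simp at hfree
      simp only [Runs.seq_iff, Runs.assign_iff]
      refine hfin _ 1 _ (by simp; omega) le_rfl ?_
      simpa using hA.advance hlt fun h => absurd h hfree
  · rintro t m' hf ⟨v, τ, rfl, ⟨D, hv, hτ, hA⟩, hlt⟩
    have hs' : m'.var vS = s := by simpa [hs] using hf.1 vS rfl
    refine ⟨?_, hA.toIsPricedMatching, hA.mu_eq, fun i q hi0 his hq0 hqb hr hEq => ?_⟩
    · simp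
      have : D ≤ s + s * L := by omega
      nlinarith
    -- At the exit `i = s`, which forces `cur = s`: no row is excepted any more in `given_up`.
    · simp [hs'] at hlt
      have := hA.cur_eq
      have := hA.i_le
      exact hA.given_up i q hi0 his (by omega) (by omega) hr hq0 hqb hEq


/-! ### Maximum matchings: the search for augmenting paths -/

/-- The unmatched rows are put in the queue, and the columns are marked as not visited. -/
def searchInit : Prog :=
  .assign vTail (.const 0) ;;
  .forTo vI vS
    (.ite (.eq (.cell aRow ‵vI) (.const (-1)))
      (.store aQueue (.const 0) ‵vTail ‵vI ;; .incr vTail)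
      .skip) ;;
  .forTo vQ vB (.store aVis (.const 0) ‵vQ (.const 0)) ;;
  .assign vHead (.const 0) ;; .assign vFound (.const (-1)) ;; .assign vClock (.const 0)

/-- Visits the new neighbours of the row `vRow`, and puts their mates in the queue. -/
def searchRow : Prog :=
  .forTo vQ vB
    (.ite (.and (.eq (.arr aG ‵vRow ‵vQ) (.const 1)) (.eq (.cell aVis ‵vQ) (.const 0)))
      (.incr vClock ;; .store aVis (.const 0) ‵vQ ‵vClock ;; .store aPar (.const 0) ‵vQ ‵vRow ;;
        .ite (.eq (.cell aCol ‵vQ) (.const (-1)))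
          (.assign vFound ‵vQ)
          (.store aQueue (.const 0) ‵vTail (.cell aCol ‵vQ) ;; .incr vTail))
      .skip)

/-- Breadth first search of the columns reachable by an alternating path from an unmatched row.
The row `0` of `aVis` contains the times of the visits, and that of `aPar` the rows from which the
columns are visited; `vFound` is an unmatched column that is reached, or `-1`. -/
def search : Prog :=
  searchInit ;;
  .loop (.lt ‵vHead ‵vTail) (.assign vRow (.cell aQueue ‵vHead) ;; searchRow ;; .incr vHead)

/-- Exchanges the edges of the alternating path found by the search. -/
def flipPath : Prog :=
  .loop (.not (.eq ‵vFound (.const (-1))))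
    (.assign vRow (.cell aPar ‵vFound) ;; .assign vNext (.cell aRow ‵vRow) ;;
      .store aRow (.const 0) ‵vRow ‵vFound ;; .store aCol (.const 0) ‵vFound ‵vRow ;;
      .ite (.eq ‵vNext (.const (-1))) .skip (.store aCol (.const 0) ‵vNext (.const (-1))) ;;
      .assign vFound ‵vNext)

/-- `vis` and `par` describe a forest of alternating paths from the unmatched rows. -/
def IsAlternatingForest (s b : ℕ) (E : ℤ → ℤ → Prop) (mr vis par : ℤ → ℤ) (clk : ℤ) : Prop :=
  ∀ q : ℤ, 0 ≤ q → q < b → 0 < vis q → vis q ≤ clk → 0 ≤ par q ∧ par q < s ∧ E (par q) q ∧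
    (mr (par q) ≠ -1 → 0 < vis (mr (par q)) ∧ vis (mr (par q)) < vis q)

/-- The state of the search. -/
structure SearchState (s b : ℕ) (E : ℤ → ℤ → Prop) (mr mc vis par qu : ℤ → ℤ)
    (clk tail found : ℤ) : Prop where
  matching : IsMatching s b E mr mc
  clk_nonneg : 0 ≤ clk
  tail_nonneg : 0 ≤ tail
  vis_mem : ∀ q : ℤ, 0 ≤ q → q < b → 0 ≤ vis q ∧ vis q ≤ clk
  forest : IsAlternatingForest s b E mr vis par clk
  queue : ∀ k, 0 ≤ k → k < tail → 0 ≤ qu k ∧ qu k < s ∧ (mr (qu k) ≠ -1 → vis (mr (qu k)) ≠ 0)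
  free : ∀ i : ℤ, 0 ≤ i → i < s → mr i = -1 → ∃ k, 0 ≤ k ∧ k < tail ∧ qu k = i
  mates : ∀ q : ℤ, 0 ≤ q → q < b → vis q ≠ 0 → mc q ≠ -1 → ∃ k, 0 ≤ k ∧ k < tail ∧ qu k = mc q
  found_eq : (found = -1 ∧ ∀ q : ℤ, 0 ≤ q → q < b → vis q ≠ 0 → mc q ≠ -1) ∨
    0 ≤ found ∧ found < b ∧ vis found ≠ 0 ∧ mc found = -1
  tail_add : tail + ((matchedCols b mc).filter fun q => vis q = 0).card ≤ s
  clk_add : clk + ((Finset.Ico 0 (b : ℤ)).filter fun q => vis q = 0).card ≤ b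

theorem card_filter_update_eq_zero {S : Finset ℤ} {vis : ℤ → ℤ} {q v : ℤ} (hq : q ∈ S)
    (h : vis q = 0) (hv : v ≠ 0) :
    (S.filter fun r => Function.update vis q v r = 0).card + 1 =
      (S.filter fun r => vis r = 0).card := by
  have : S.filter (fun r => Function.update vis q v r = 0) =
      (S.filter fun r => vis r = 0).erase q := by
    ext r
    simp only [Finset.mem_filter, Finset.mem_erase, Function.update_apply]
    split_ifs with hr <;> simp_all
  rw [this]
  exact Finset.card_erase_add_one (Finset.mem_filter.2 ⟨hq, h⟩)

namespace SearchState

variable {s b : ℕ} {E : ℤ → ℤ → Prop} {mr mc vis par qu : ℤ → ℤ} {clk tail found : ℤ}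

/-- The new column receives the latest time, hence a later one than the mate of its parent; the
times of the columns already visited are unchanged. -/
theorem forest_update (h : SearchState s b E mr mc vis par qu clk tail found) {row q : ℤ}
    (hr0 : 0 ≤ row) (hrs : row < s) (hr : mr row ≠ -1 → vis (mr row) ≠ 0)
    (hE : E row q) (hq : vis q = 0) :
    IsAlternatingForest s b E mr (Function.update vis q (clk + 1)) (Function.update par q row)
      (clk + 1) := by
  have hc := h.clk_nonneg
  intro r hr0' hrb hv1 hv2
  by_cases hrq : r = q
  · subst hrq
    rw [Function.update_self, Function.update_self]
    refine ⟨hr0, hrs, hE, fun hm => ?_⟩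
    have h1 := hr hm
    have h2 := h.matching.row row hr0 hrs hm
    have h3 := h.vis_mem (mr row) h2.1 h2.2.1
    have h4 : mr row ≠ r := by
      rintro h4
      rw [h4] at h1
      exact h1 hq
    rw [Function.update_of_ne h4]
    omega
  · rw [Function.update_of_ne hrq] at hv1 hv2 ⊢
    rw [Function.update_of_ne hrq]
    obtain ⟨h1, h2, h3, h4⟩ := h.forest r hr0' hrb hv1 (h.vis_mem r hr0' hrb).2
    refine ⟨h1, h2, h3, fun hm => ?_⟩
    obtain ⟨h5, h6⟩ := h4 hm
    have h7 : mr (par r) ≠ q := by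
      intro h7
      rw [h7] at h5
      omega
    rw [Function.update_of_ne h7]
    exact ⟨h5, h6⟩

theorem vis_mem_update (h : SearchState s b E mr mc vis par qu clk tail found) {q : ℤ} :
    ∀ r : ℤ, 0 ≤ r → r < b → 0 ≤ Function.update vis q (clk + 1) r ∧
      Function.update vis q (clk + 1) r ≤ clk + 1 := by
  intro r h0 hb
  have := h.vis_mem r h0 hb
  have := h.clk_nonneg
  rw [Function.update_apply]
  split_ifs <;> omega

theorem update_ne_zero (h : SearchState s b E mr mc vis par qu clk tail found) {q r : ℤ}
    (hr : vis r ≠ 0) : Function.update vis q (clk + 1) r ≠ 0 := by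
  have := h.clk_nonneg
  rw [Function.update_apply]
  split_ifs <;> omega

theorem ne_zero_of_update {c q r : ℤ} (hr : Function.update vis q c r ≠ 0) (hrq : r ≠ q) :
    vis r ≠ 0 := by
  rwa [Function.update_of_ne hrq] at hr

theorem visit_free (h : SearchState s b E mr mc vis par qu clk tail found) {row q : ℤ}
    (hr0 : 0 ≤ row) (hrs : row < s) (hr : mr row ≠ -1 → vis (mr row) ≠ 0)
    (hq0 : 0 ≤ q) (hqb : q < b) (hE : E row q) (hq : vis q = 0) (hm : mc q = -1) :
    SearchState s b E mr mc (Function.update vis q (clk + 1)) (Function.update par q row) qu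
      (clk + 1) tail q := by
  have hc := h.clk_nonneg
  refine ⟨h.matching, by omega, h.tail_nonneg, h.vis_mem_update, h.forest_update hr0 hrs hr hE hq,
    fun k hk0 hkt => ?_, h.free, fun r h0 hb hv hmr => ?_, Or.inr ⟨hq0, hqb, ?_, hm⟩, ?_, ?_⟩
  · obtain ⟨h1, h2, h3⟩ := h.queue k hk0 hkt
    exact ⟨h1, h2, fun hm => h.update_ne_zero (h3 hm)⟩
  · by_cases hrq : r = q
    · subst hrq
      exact absurd hm hmr
    · exact h.mates r h0 hb (ne_zero_of_update hv hrq) hmr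
  · rw [Function.update_self]
    omega
  · have : (matchedCols b mc).filter (fun r => Function.update vis q (clk + 1) r = 0) =
        (matchedCols b mc).filter (fun r => vis r = 0) := by
      apply Finset.filter_congr
      intro r hr
      rw [Function.update_of_ne]
      rintro rfl
      exact (mem_matchedCols.1 hr).2 hm
    rw [this]
    exact h.tail_add
  · have := card_filter_update_eq_zero (S := Finset.Ico 0 (b : ℤ)) (v := clk + 1) (by simp; omega)
      hq (by omega)
    have := h.clk_add
    omega

/-- The queue grows by one as the number of unvisited matched columns falls by one, and likewise the
clock against the unvisited columns. This is what bounds the queue by `s` and the clock by `b`. -/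
theorem visit_matched (h : SearchState s b E mr mc vis par qu clk tail found) {row q : ℤ}
    (hr0 : 0 ≤ row) (hrs : row < s) (hr : mr row ≠ -1 → vis (mr row) ≠ 0)
    (hq0 : 0 ≤ q) (hqb : q < b) (hE : E row q) (hq : vis q = 0) (hm : mc q ≠ -1) :
    SearchState s b E mr mc (Function.update vis q (clk + 1)) (Function.update par q row)
      (Function.update qu tail (mc q)) (clk + 1) (tail + 1) found := by
  have hc := h.clk_nonneg
  have ht := h.tail_nonneg
  have hmq := h.matching.col q hq0 hqb hm
  have hself : Function.update vis q (clk + 1) q ≠ 0 := by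
    rw [Function.update_self]
    omega
  have hex : ∀ i, (∃ k, 0 ≤ k ∧ k < tail ∧ qu k = i) →
      ∃ k, 0 ≤ k ∧ k < tail + 1 ∧ Function.update qu tail (mc q) k = i := by
    rintro i ⟨k, h1, h2, h3⟩
    exact ⟨k, h1, by omega, by rw [Function.update_of_ne (by omega), h3]⟩
  refine ⟨h.matching, by omega, by omega, h.vis_mem_update, h.forest_update hr0 hrs hr hE hq,
    fun k hk0 hkt => ?_, fun i h1 h2 h3 => hex i (h.free i h1 h2 h3), fun r h0 hb hv hmr => ?_,
    ?_, ?_, ?_⟩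
  · by_cases hk : k = tail
    · subst hk
      rw [Function.update_self, hmq.2.2]
      exact ⟨hmq.1, hmq.2.1, fun _ => hself⟩
    · rw [Function.update_of_ne hk]
      obtain ⟨h1, h2, h3⟩ := h.queue k hk0 (by omega)
      exact ⟨h1, h2, fun hm => h.update_ne_zero (h3 hm)⟩
  · by_cases hrq : r = q
    · subst hrq
      exact ⟨tail, ht, by omega, by rw [Function.update_self]⟩
    · exact hex _ (h.mates r h0 hb (ne_zero_of_update hv hrq) hmr)
  · rcases h.found_eq with ⟨h1, h2⟩ | ⟨h1, h2, h3, h4⟩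
    · refine Or.inl ⟨h1, fun r h0 hb hv => ?_⟩
      by_cases hrq : r = q
      · rwa [hrq]
      · exact h2 r h0 hb (ne_zero_of_update hv hrq)
    · exact Or.inr ⟨h1, h2, h.update_ne_zero h3, h4⟩
  · have := card_filter_update_eq_zero (S := matchedCols b mc) (v := clk + 1)
      (mem_matchedCols.2 ⟨⟨hq0, hqb⟩, hm⟩) hq (by omega)
    have := h.tail_add
    omega
  · have := card_filter_update_eq_zero (S := Finset.Ico 0 (b : ℤ)) (v := clk + 1) (by simp; omega)
      hq (by omega)
    have := h.clk_add
    omega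

end SearchState

theorem searchRow_spec {s b : ℕ} {E : ℤ → ℤ → Prop} {m : Mem} (hb : m.var vB = b)
    (hE : E = edges (m.arr aG))
    (hS : SearchState s b E (m.arr aRow 0) (m.arr aCol 0) (m.arr aVis 0) (m.arr aPar 0)
      (m.arr aQueue 0) (m.var vClock) (m.var vTail) (m.var vFound))
    (hr0 : 0 ≤ m.var vRow) (hrs : m.var vRow < s)
    (hr : m.arr aRow 0 (m.var vRow) ≠ -1 → m.arr aVis 0 (m.arr aRow 0 (m.var vRow)) ≠ 0) :
    Runs searchRow m fun t m' => t ≤ 60 * (b + 1) ∧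
      SearchState s b E (m'.arr aRow 0) (m'.arr aCol 0) (m'.arr aVis 0) (m'.arr aPar 0)
        (m'.arr aQueue 0) (m'.var vClock) (m'.var vTail) (m'.var vFound) ∧
      m.var vTail ≤ m'.var vTail ∧ (∀ k < m.var vTail, m'.arr aQueue 0 k = m.arr aQueue 0 k) ∧
      (∀ q, m.arr aVis 0 q ≠ 0 → m'.arr aVis 0 q ≠ 0) ∧
      ∀ q : ℤ, 0 ≤ q → q < b → E (m.var vRow) q → m'.arr aVis 0 q ≠ 0 := by
  rw [searchRow]
  refine (Runs.forTo_intro (c := 45) (fun k m' =>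
      SearchState s b E (m'.arr aRow 0) (m'.arr aCol 0) (m'.arr aVis 0) (m'.arr aPar 0)
        (m'.arr aQueue 0) (m'.var vClock) (m'.var vTail) (m'.var vFound) ∧
      m.var vTail ≤ m'.var vTail ∧ (∀ k < m.var vTail, m'.arr aQueue 0 k = m.arr aQueue 0 k) ∧
      (∀ q, m.arr aVis 0 q ≠ 0 → m'.arr aVis 0 q ≠ 0) ∧
      ∀ q : ℤ, 0 ≤ q → q < k → E (m.var vRow) q → m'.arr aVis 0 q ≠ 0)
     (n := b) hb (by decide) rfl rfl ?_ ?_).mono ?_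
  · refine ⟨by simpa using hS, by simp, by simp, by simp, fun q h0 h1 => by omega⟩
  · intro q m1 hf hq0 hqb hq hb1 ⟨hI1, hI2, hI3, hI4, hI5⟩
    have h1 := hf.1 vRow rfl
    have h2 := hf.2 aG rfl
    have h3 := hf.2 aRow rfl
    have h4 := hf.2 aCol rfl
    have hr' : m1.arr aRow 0 (m.var vRow) ≠ -1 →
        m1.arr aVis 0 (m1.arr aRow 0 (m.var vRow)) ≠ 0 := by
      rw [h3]
      exact fun h => hI4 _ (hr h)
    rw [Runs.ite_iff]
    constructor
    · intro hb
      simp [h1, h2, hq] at hb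
      have hEq : E (m.var vRow) q := by
        rw [hE]
        exact hb.1
      simp only [Runs.seq_iff, Runs.assign_iff, Runs.store_iff, Runs.ite_iff]
      constructor
      · intro hc
        simp [hq] at hc
        have := hI1.visit_free hr0 hrs hr' hq0 hqb hEq hb.2 hc
        refine ⟨by simp, by simpa [hq, h1] using this, by simpa using hI2, by simpa using hI3,
          fun r hv => ?_, fun r h0 hrq hEr => ?_⟩
        · simpa [hq, Function.update_apply] using hI1.update_ne_zero (q := q) (hI4 r hv)
        · rcases (Int.lt_add_one_iff.1 hrq).lt_or_eq with hlt | rfl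
          · simpa [hq, Function.update_apply] using hI1.update_ne_zero (q := q) (hI5 r h0 hlt hEr)
          · have := hI1.clk_nonneg
            simp [hq]
            omega
      · intro hc
        simp [hq] at hc
        have := hI1.visit_matched hr0 hrs hr' hq0 hqb hEq hb.2 hc
        refine ⟨by simp, by simpa [hq, h1] using this, by simp; omega, fun k hk => ?_,
          fun r hv => ?_, fun r h0 hrq hEr => ?_⟩
        · simp [hI3 k hk, show k ≠ m1.var vTail by omega]
        · simpa [hq, Function.update_apply] using hI1.update_ne_zero (q := q) (hI4 r hv)
        · rcases (Int.lt_add_one_iff.1 hrq).lt_or_eq with hlt | rfl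
          · simpa [hq, Function.update_apply] using hI1.update_ne_zero (q := q) (hI5 r h0 hlt hEr)
          · have := hI1.clk_nonneg
            simp [hq]
            omega
    · intro hb
      simp [h1, h2, hq] at hb
      rw [Runs.skip_iff]
      refine ⟨by simp, by simpa using hI1, by simpa using hI2, by simpa using hI3,
        by simpa using hI4, fun r h0 hrq hEr => ?_⟩
      simp
      rcases (Int.lt_add_one_iff.1 hrq).lt_or_eq with hlt | rfl
      · exact hI5 r h0 hlt hEr
      · exact hb (by rw [hE] at hEr; exact hEr)
  · rintro t m' ⟨ht, -, hI⟩
    exact ⟨by omega, hI⟩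


theorem card_filter_Ico_succ (p : ℤ → Prop) [DecidablePred p] {k : ℤ} (hk : 0 ≤ k) :
    ((Finset.Ico 0 (k + 1)).filter p).card =
      ((Finset.Ico 0 k).filter p).card + if p k then 1 else 0 := by
  have : Finset.Ico 0 (k + 1) = insert k (Finset.Ico 0 k) := by
    ext x
    simp only [Finset.mem_insert, Finset.mem_Ico]
    omega
  rw [this, Finset.filter_insert]
  split_ifs with h
  · rw [Finset.card_insert_of_notMem (by simp)]
  · rfl

/-- This is the initial case of `SearchState.tail_add`: the queue starts with the unmatched rows,
and each matched column will add its mate at most once. -/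
theorem IsMatching.card_free_add_le {s b : ℕ} {E : ℤ → ℤ → Prop} {mr mc : ℤ → ℤ}
    (h : IsMatching s b E mr mc) :
    ((Finset.Ico 0 (s : ℤ)).filter fun i => mr i = -1).card + (matchedCols b mc).card ≤ s := by
  have h1 : (matchedCols b mc).card ≤
      ((Finset.Ico 0 (s : ℤ)).filter fun i => ¬ mr i = -1).card := by
    apply Finset.card_le_card_of_injOn mc
    · intro q hq
      have hq := mem_matchedCols.1 hq
      have := h.col q hq.1.1 hq.1.2 hq.2
      simp
      omega
    · intro q hq q' hq' he
      have hq := mem_matchedCols.1 hq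
      have hq' := mem_matchedCols.1 hq'
      have h1 := h.col q hq.1.1 hq.1.2 hq.2
      have h2 := h.col q' hq'.1.1 hq'.1.2 hq'.2
      rw [← h1.2.2, ← h2.2.2, he]
  have h2 := Finset.card_filter_add_card_filter_not (s := Finset.Ico 0 (s : ℤ)) (fun i => mr i = -1)
  have h3 : (Finset.Ico 0 (s : ℤ)).card = s := by simp
  omega

theorem searchInit_spec {s b : ℕ} {E : ℤ → ℤ → Prop} {m : Mem} (hs : m.var vS = s)
    (hb : m.var vB = b) (hM : IsMatching s b E (m.arr aRow 0) (m.arr aCol 0)) :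
    Runs searchInit m fun t m' => t ≤ 60 * (s + b + 1) ∧ m'.var vHead = 0 ∧
      SearchState s b E (m'.arr aRow 0) (m'.arr aCol 0) (m'.arr aVis 0) (m'.arr aPar 0)
        (m'.arr aQueue 0) (m'.var vClock) (m'.var vTail) (m'.var vFound) := by
  rw [searchInit, Runs.seq_iff, Runs.assign_iff]
  refine Runs.seq_intro (Runs.forTo_intro (c := 20) (fun k m' =>
    (∀ l, 0 ≤ l → l < m'.var vTail → 0 ≤ m'.arr aQueue 0 l ∧ m'.arr aQueue 0 l < k ∧
      m.arr aRow 0 (m'.arr aQueue 0 l) = -1) ∧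
    (∀ i, 0 ≤ i → i < k → m.arr aRow 0 i = -1 →
      ∃ l, 0 ≤ l ∧ l < m'.var vTail ∧ m'.arr aQueue 0 l = i) ∧
    m'.var vTail = ((Finset.Ico 0 k).filter fun i => m.arr aRow 0 i = -1).card)
    (n := s) (by simpa using hs) (by decide) rfl rfl ?_ ?_) ?_
  · refine ⟨fun l h0 h1 => ?_, fun i h0 h1 => by omega, by simp⟩
    simp at h1
    omega
  · intro i m1 hf hi0 his hi hs1 ⟨hI1, hI2, hI3⟩
    have h1 := hf.2 aRow rfl
    simp at h1
    have hc := card_filter_Ico_succ (fun i => m.arr aRow 0 i = -1) hi0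
    have ht : 0 ≤ m1.var vTail := by omega
    rw [Runs.ite_iff]
    constructor
    · intro hr
      simp [hi, h1] at hr
      simp only [Runs.seq_iff, Runs.assign_iff, Runs.store_iff]
      rw [if_pos hr] at hc
      refine ⟨by simp, fun l h0 hl => ?_, fun k h0 hk hkr => ?_, ?_⟩
      · simp at hl
        rcases hl.lt_or_eq with hlt | rfl
        · obtain ⟨g1, g2, g3⟩ := hI1 l h0 hlt
          simp [hlt.ne, g3]
          omega
        · simp [hi, hr]
          omega
      · simp
        rcases (Int.lt_add_one_iff.1 hk).lt_or_eq with hlt | rfl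
        · obtain ⟨l, g1, g2, g3⟩ := hI2 k h0 hlt hkr
          exact ⟨l, g1, g2.le, by simp [g2.ne, g3]⟩
        · exact ⟨_, ht, le_rfl, by simp [hi]⟩
      · simp [hc, hI3]
    · intro hr
      simp [hi, h1] at hr
      rw [Runs.skip_iff]
      rw [if_neg hr] at hc
      refine ⟨by simp, fun l h0 hl => ?_, fun k h0 hk hkr => ?_, ?_⟩
      · obtain ⟨g1, g2, g3⟩ := hI1 l h0 (by simpa using hl)
        simp
        exact ⟨g1, by omega, g3⟩
      · simp
        rcases (Int.lt_add_one_iff.1 hk).lt_or_eq with hlt | rfl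
        · exact hI2 k h0 hlt hkr
        · exact absurd hkr hr
      · simpa [hc] using hI3
  rintro t1 m1 hf1 ⟨ht1, -, hI1, hI2, hI3⟩
  have hb1 := hf1.1 vB rfl
  simp [hb] at hb1
  refine Runs.seq_intro (Runs.forTo_intro (c := 4) (fun k m' =>
    ∀ q, 0 ≤ q → q < k → m'.arr aVis 0 q = 0) (n := b) hb1 (by decide) rfl rfl ?_ ?_) ?_
  · intro q h0 h1
    omega
  · intro k m2 hf hk0 hkb hk hb2 hI
    rw [Runs.store_iff]
    refine ⟨by simp, fun q h0 hq => ?_⟩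
    simp [hk]
    intro hne
    exact hI q h0 (by omega)
  rintro t2 m2 hf2 ⟨ht2, -, hI⟩
  have f1 := (hf2.2 aRow rfl).trans (hf1.2 aRow rfl)
  have f2 := (hf2.2 aCol rfl).trans (hf1.2 aCol rfl)
  have f3 := hf2.2 aQueue rfl
  have f4 := hf2.1 vTail rfl
  simp at f1 f2 f3 f4
  simp only [Runs.seq_iff, Runs.assign_iff]
  refine ⟨by simp; omega, by simp, ?_⟩
  simp [f1, f2, f3, f4]
  refine ⟨hM, le_rfl, by omega, fun q h0 h1 => by simp [hI q h0 h1], fun q h0 h1 h2 => ?_,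
    fun k h0 h1 => ?_, hI2, fun q h0 h1 h2 => absurd (hI q h0 h1) h2,
    Or.inl ⟨rfl, fun q h0 h1 h2 => absurd (hI q h0 h1) h2⟩, ?_, ?_⟩
  · have := hI q h0 h1
    omega
  · obtain ⟨g1, g2, g3⟩ := hI1 k h0 h1
    exact ⟨g1, g2, fun h => absurd g3 h⟩
  · have h1 := hM.card_free_add_le
    have h2 := Finset.card_filter_le (matchedCols b (m.arr aCol 0)) fun q => m2.arr aVis 0 q = 0
    omega
  · have h2 := Finset.card_filter_le (Finset.Ico 0 (b : ℤ)) fun q => m2.arr aVis 0 q = 0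
    simp at h2
    omega

/-- All the neighbours of the rows that are reached are visited. -/
def IsClosedSearch (s b : ℕ) (E : ℤ → ℤ → Prop) (mr vis : ℤ → ℤ) : Prop :=
  ∀ i q : ℤ, 0 ≤ i → i < s → 0 ≤ q → q < b → E i q → (mr i ≠ -1 → vis (mr i) ≠ 0) → vis q ≠ 0

/-- By `tail_add` at most `s` rows are scanned, each in time `O(b)`. At the end the whole queue has
been scanned, and it contains the unmatched rows and the mates of the visited columns, whence the
closure property. -/
theorem search_spec {s b : ℕ} {m : Mem} (hs : m.var vS = s)
    (hb : m.var vB = b)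
    (hM : IsMatching s b (edges (m.arr aG)) (m.arr aRow 0) (m.arr aCol 0)) :
    Runs search m fun t m' => t ≤ 200 * (s + 1) * (b + 1) ∧
      IsClosedSearch s b (edges (m.arr aG)) (m'.arr aRow 0) (m'.arr aVis 0) ∧
      SearchState s b (edges (m.arr aG)) (m'.arr aRow 0) (m'.arr aCol 0) (m'.arr aVis 0)
        (m'.arr aPar 0) (m'.arr aQueue 0) (m'.var vClock) (m'.var vTail) (m'.var vFound) := by
  rw [search]
  refine Runs.seq_intro (searchInit_spec hs hb hM) ?_
  rintro t1 m1 hf1 ⟨ht1, hh1, hS1⟩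
  have e1 := hf1.1 vB rfl
  have e2 := hf1.2 aG rfl
  rw [← e2] at hS1 ⊢
  set E := edges (m1.arr aG) with hE
  refine (Runs.loop_intro (fun v τ m' => v + (m'.var vHead).toNat = s ∧
    τ ≤ 100 * (b + 1) * (m'.var vHead).toNat ∧ 0 ≤ m'.var vHead ∧ m'.var vHead ≤ m'.var vTail ∧
    SearchState s b E (m'.arr aRow 0) (m'.arr aCol 0) (m'.arr aVis 0)
      (m'.arr aPar 0) (m'.arr aQueue 0) (m'.var vClock) (m'.var vTail) (m'.var vFound) ∧
    ∀ k q : ℤ, 0 ≤ k → k < m'.var vHead → 0 ≤ q → q < b → E (m'.arr aQueue 0 k) q →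
      m'.arr aVis 0 q ≠ 0)
    (v₀ := s) ⟨by simp [hh1], by simp, by simp [hh1], by rw [hh1]; exact hS1.tail_nonneg,
      hS1, fun k q h0 h1 => by omega⟩ ?_).mono ?_
  · rintro v τ m2 hf2 ⟨hv, hτ, hh0, hht, hS, hc⟩ hlt
    simp at hlt
    have g1 := (hf2.1 vB rfl).trans (e1.trans hb)
    have g2 := hf2.2 aG rfl
    rw [Runs.seq_iff, Runs.assign_iff]
    obtain ⟨q1, q2, q3⟩ := hS.queue _ hh0 hlt
    refine Runs.seq_intro (searchRow_spec (b := b) (s := s) (E := E) (by simpa using g1)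
      (by rw [hE, Mem.setVar_arr, g2]) (by simpa using hS) (by simpa using q1) (by simpa using q2)
      (by simpa using q3)) ?_
    rintro t m3 hf3 ⟨ht, hS3, hta, hqu, hvi, hro⟩
    have k1 := hf3.1 vHead rfl
    simp at k1 hta hqu hvi hro
    rw [Runs.assign_iff]
    have := hS.tail_add
    refine ⟨v - 1, by omega, ?_, ?_, ?_, ?_, ?_, ?_⟩
    · simp [k1]
      omega
    · simp [k1]
      rw [show (m2.var vHead + 1).toNat = (m2.var vHead).toNat + 1 by omega, Nat.mul_succ]
      omega
    · simp [k1]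
      omega
    · simp [k1]
      omega
    · simpa using hS3
    · intro k q hk0 hk hq0 hqb hEk
      simp [k1] at hk hEk ⊢
      rw [hqu k (by omega)] at hEk
      rcases hk.lt_or_eq with hkl | rfl
      · exact hvi q (hc k q hk0 hkl hq0 hqb hEk)
      · exact hro q hq0 hqb hEk
  · rintro t m2 ⟨v, τ, rfl, ⟨hv, hτ, hh0, hht, hS, hc⟩, hlt⟩
    simp at hlt
    refine ⟨?_, ?_, hS⟩
    · simp
      have h1 : 100 * (b + 1) * (m2.var vHead).toNat ≤ 100 * (b + 1) * s :=
        Nat.mul_le_mul_left _ (by omega)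
      have h2 : 200 * (s + 1) * (b + 1) = 100 * (b + 1) * s + 100 * (s * b + s + 2 * b + 2) := by
        ring
      omega
    · intro i q hi0 his hq0 hqb hEi hv
      have : ∃ k, 0 ≤ k ∧ k < m2.var vTail ∧ m2.arr aQueue 0 k = i := by
        by_cases hr : m2.arr aRow 0 i = -1
        · exact hS.free i hi0 his hr
        · have h1 := hS.matching.row i hi0 his hr
          have h2 := hS.mates _ h1.1 h1.2.1 (hv hr) (by omega)
          rwa [h1.2.2.2] at h2
      obtain ⟨k, h0, h1, rfl⟩ := this
      exact hc k q h0 (by omega) hq0 hqb hEi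


/-- The state of the exchange along an alternating path, that ends at the unmatched column
`found`. -/
structure FlipState (s b : ℕ) (E : ℤ → ℤ → Prop) (mr mc vis par : ℤ → ℤ) (found : ℤ) : Prop
    extends IsMatching s b E mr mc where
  found_nonneg : 0 ≤ found
  found_lt : found < b
  found_free : mc found = -1
  vis_found : 0 < vis found
  forest : IsAlternatingForest s b E mr vis par (vis found)

namespace FlipState

variable {s b : ℕ} {E : ℤ → ℤ → Prop} {mr mc vis par : ℤ → ℤ} {found : ℤ}

theorem mate_ne (h : FlipState s b E mr mc vis par found) {k : ℤ} (h0 : 0 ≤ k) (h1 : k < s) :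
    mr k ≠ found := by
  intro he
  have hf := h.found_nonneg
  have h2 := h.row k h0 h1 (by omega)
  rw [he, h.found_free] at h2
  omega

theorem last (h : FlipState s b E mr mc vis par found) (hn : mr (par found) = -1) :
    IsMatching s b E (Function.update mr (par found) found)
      (Function.update mc found (par found)) ∧
    (matchedCols b (Function.update mc found (par found))).card = (matchedCols b mc).card + 1 := by
  obtain ⟨p0, p1, p2, -⟩ := h.forest found h.found_nonneg h.found_lt h.vis_found le_rfl
  refine ⟨⟨fun i h0 h1 hi => ?_, fun q h0 h1 hq => ?_⟩,
    card_matchedCols_update h.found_nonneg h.found_lt h.found_free (by omega)⟩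
  · by_cases hip : i = par found
    · subst hip
      rw [Function.update_self, Function.update_self]
      exact ⟨h.found_nonneg, h.found_lt, p2, rfl⟩
    · rw [Function.update_of_ne hip] at hi ⊢
      rw [Function.update_of_ne (h.mate_ne h0 h1)]
      exact h.row i h0 h1 hi
  · by_cases hqf : q = found
    · subst hqf
      rw [Function.update_self, Function.update_self]
      exact ⟨p0, p1, rfl⟩
    · rw [Function.update_of_ne hqf] at hq ⊢
      have h2 := h.col q h0 h1 hq
      rw [Function.update_of_ne]
      · exact h2
      · intro he
        rw [he, hn] at h2
        omega

/-- The former mate of `par found` becomes the unmatched end of a shorter alternating path. The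
forest property is only kept up to the time of this new end, since `par found` now has a mate
visited later. -/
theorem next (h : FlipState s b E mr mc vis par found) (hn : mr (par found) ≠ -1) :
    FlipState s b E (Function.update mr (par found) found)
      (Function.update (Function.update mc found (par found)) (mr (par found)) (-1)) vis par
      (mr (par found)) ∧
    (matchedCols b (Function.update (Function.update mc found (par found))
      (mr (par found)) (-1))).card = (matchedCols b mc).card ∧
    vis (mr (par found)) < vis found := by
  obtain ⟨p0, p1, p2, p3⟩ := h.forest found h.found_nonneg h.found_lt h.vis_found le_rfl
  obtain ⟨p3, p4⟩ := p3 hn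
  obtain ⟨r1, r2, r3, r4⟩ := h.row _ p0 p1 hn
  have hne := h.mate_ne p0 p1
  refine ⟨⟨⟨fun i h0 h1 hi => ?_, fun q h0 h1 hq => ?_⟩, r1, r2, Function.update_self .., p3,
    fun q h0 h1 hq hv => ?_⟩, ?_, p4⟩
  · by_cases hip : i = par found
    · subst hip
      rw [Function.update_self, Function.update_of_ne hne.symm, Function.update_self]
      exact ⟨h.found_nonneg, h.found_lt, p2, rfl⟩
    · rw [Function.update_of_ne hip] at hi ⊢
      have h2 := h.row i h0 h1 hi
      rw [Function.update_of_ne, Function.update_of_ne (h.mate_ne h0 h1)]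
      · exact h2
      · intro he
        rw [he] at h2
        omega
  · by_cases hqn : q = mr (par found)
    · subst hqn
      rw [Function.update_self] at hq
      exact absurd rfl hq
    · rw [Function.update_of_ne hqn] at hq ⊢
      by_cases hqf : q = found
      · subst hqf
        rw [Function.update_self, Function.update_self]
        exact ⟨p0, p1, rfl⟩
      · rw [Function.update_of_ne hqf] at hq ⊢
        have h2 := h.col q h0 h1 hq
        rw [Function.update_of_ne]
        · exact h2
        · intro he
          rw [he] at h2
          exact hqn h2.2.2.symm
  · obtain ⟨g1, g2, g3, g4⟩ := h.forest q h0 h1 hq (by omega)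
    refine ⟨g1, g2, g3, ?_⟩
    rw [Function.update_of_ne]
    · exact g4
    -- The rerouted row is not the parent of `q`: the forest would give `vis (mr (par found)) < vis
    -- q`, against the time bound on `q`.
    · intro he
      rw [he] at g4
      have := g4 hn
      omega
  -- Both maps are compared with the intermediate one, where `found` has received its mate and the
  -- former mate column has not yet lost its own: it has one more matched column than either.
  · have h1 := card_matchedCols_update (c := par found) h.found_nonneg h.found_lt h.found_free
      (by omega)
    have h2 := card_matchedCols_update (c := par found) (b := b)
      (mc := Function.update (Function.update mc found (par found)) (mr (par found)) (-1))
      r1 r2 (Function.update_self ..) (by omega)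
    rw [Function.update_idem, show Function.update (Function.update mc found (par found))
      (mr (par found)) (par found) = Function.update mc found (par found) by
        rw [Function.update_eq_self_iff, Function.update_of_ne hne, r4]] at h2
    omega

end FlipState

/-- The time of the visit of `vFound` decreases strictly along the path and is at most `b` at the
start, so there are at most `b` exchanges. Only the last one changes the number of matched columns.
-/
theorem flipPath_spec {s b : ℕ} {E : ℤ → ℤ → Prop} {m : Mem}
    (hF : FlipState s b E (m.arr aRow 0) (m.arr aCol 0) (m.arr aVis 0) (m.arr aPar 0)
      (m.var vFound)) (hv : m.arr aVis 0 (m.var vFound) ≤ b) :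
    Runs flipPath m fun t m' => t ≤ 60 * (b + 1) ∧
      IsMatching s b E (m'.arr aRow 0) (m'.arr aCol 0) ∧
      (matchedCols b (m'.arr aCol 0)).card = (matchedCols b (m.arr aCol 0)).card + 1 := by
  rw [flipPath]
  refine (Runs.loop_intro (fun v τ m' => τ + 50 * v ≤ 50 * b ∧
    (m'.var vFound = -1 ∧ IsMatching s b E (m'.arr aRow 0) (m'.arr aCol 0) ∧
      (matchedCols b (m'.arr aCol 0)).card = (matchedCols b (m.arr aCol 0)).card + 1 ∨
     m'.var vFound ≠ -1 ∧ v = (m'.arr aVis 0 (m'.var vFound)).toNat ∧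
     FlipState s b E (m'.arr aRow 0) (m'.arr aCol 0) (m'.arr aVis 0) (m'.arr aPar 0)
      (m'.var vFound) ∧
      (matchedCols b (m'.arr aCol 0)).card = (matchedCols b (m.arr aCol 0)).card))
    (v₀ := (m.arr aVis 0 (m.var vFound)).toNat) ⟨by omega, Or.inr ⟨?_, rfl, hF, rfl⟩⟩ ?_).mono ?_
  · have := hF.found_nonneg
    omega
  · rintro v τ m1 hf ⟨hτ, ⟨hI, -⟩ | ⟨-, hv, hF1, hc⟩⟩ hne
    · simp [hI] at hne
    have hpos := hF1.vis_found
    have hfn := hF1.found_nonneg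
    obtain ⟨p0, p1, p2, p3⟩ := hF1.forest _ hF1.found_nonneg hF1.found_lt hF1.vis_found le_rfl
    simp only [Runs.seq_iff, Runs.assign_iff, Runs.store_iff, Runs.ite_iff, Runs.skip_iff]
    constructor
    · intro hn
      simp at hn
      obtain ⟨h1, h2⟩ := hF1.last hn
      refine ⟨v - 1, by omega, by simp; omega, Or.inl ⟨by simpa using hn, by simpa using h1, ?_⟩⟩
      rw [← hc, ← h2]
      simp
    · intro hn
      simp at hn
      obtain ⟨h1, h2, h3⟩ := hF1.next hn
      have h4 := h1.found_nonneg
      have h5 := h1.vis_found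
      refine ⟨(m1.arr aVis 0 (m1.arr aRow 0 (m1.arr aPar 0 (m1.var vFound)))).toNat, by omega,
        by simp; omega, Or.inr ⟨by simpa using hn, by simp, by simpa using h1, ?_⟩⟩
      rw [← hc, ← h2]
      simp
  · rintro t m1 ⟨v, τ, rfl, ⟨hτ, ⟨hI, h1, h2⟩ | ⟨hne, -⟩⟩, hb⟩
    · exact ⟨by simp; omega, h1, h2⟩
    · simp at hb
      exact absurd hb hne


/-- Computes a maximum matching: an auction where the price of the columns is at most `1`, that
gives half a maximum matching, then a second auction up to a price of the order of its square root,
and then augmenting paths. -/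
def maxMatching : Prog :=
  .forTo vI vS (.store aRow (.const 0) ‵vI (.const (-1))) ;;
  .forTo vQ vB (.store aCol (.const 0) ‵vQ (.const (-1)) ;;
    .store aPrice (.const 0) ‵vQ (.const 0)) ;;
  .assign vMu (.const 0) ;; .assign vCap (.const 1) ;; auction ;;
  .assign vSq (.const 1) ;;
  .loop (.le ‵vSq ‵vMu) (.assign vSq (.add (.add ‵vSq ‵vCap) (.add ‵vCap (.const 1))) ;;
    .incr vCap) ;;
  auction ;; .assign vAgain (.const 1) ;;
  .loop (.eq ‵vAgain (.const 1))
    (search ;; .ite (.eq ‵vFound (.const (-1))) (.assign vAgain (.const 0)) flipPath)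

/-- A matching without augmenting path, and the columns reachable by an alternating path from an
unmatched row. -/
structure IsMaxMatching (s b : ℕ) (E : ℤ → ℤ → Prop) (mr mc vis : ℤ → ℤ) : Prop
    extends IsMatching s b E mr mc where
  closed : IsClosedSearch s b E mr vis
  visited : ∀ q : ℤ, 0 ≤ q → q < b → vis q ≠ 0 → mc q ≠ -1
  vis_nonneg : ∀ q : ℤ, 0 ≤ q → q < b → 0 ≤ vis q
  forest : ∃ par : ℤ → ℤ, ∀ q : ℤ, 0 ≤ q → q < b → vis q ≠ 0 →
    0 ≤ par q ∧ par q < s ∧ E (par q) q ∧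
    (mr (par q) ≠ -1 → vis (mr (par q)) ≠ 0 ∧ vis (mr (par q)) < vis q)

/-- Here `μ₀`, `μ₁`, `μ` are the sizes after the first auction, after the second and at the end.
From `L ≥ 1` comes `μ₀ ≤ 2 μ₁`, hence `(L - 1) ^ 2 ≤ 2 μ`, which is less than `2 (√μ + 1) ^ 2` with
the integer square root. -/
theorem cap_le_sqrt {L μ₀ μ₁ μ : ℕ} (hL : (L - 1) ^ 2 ≤ μ₀) (hL1 : 1 ≤ L)
    (h0 : L * μ₀ ≤ L * μ₁ + μ₁) (h1 : μ₁ ≤ μ) : L ≤ 2 * Nat.sqrt μ + 2 := by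
  have h2 : μ₀ ≤ 2 * μ₁ := by
    by_contra hlt
    nlinarith
  have h3 := Nat.lt_succ_sqrt' μ
  by_contra hlt
  have h4 : (2 * Nat.sqrt μ + 2) ^ 2 ≤ (L - 1) ^ 2 := Nat.pow_le_pow_left (by omega) 2
  rw [Nat.succ_eq_add_one] at h3
  nlinarith

/-- One has `L (μ - μ₁) ≤ μ₁ ≤ μ ≤ 2 μ₀ < 2 L ^ 2`. -/
theorem augmentations_le {L μ₀ μ₁ μ : ℕ} (hL : μ₀ < L ^ 2)
    (h0 : μ ≤ μ₀ + μ₀) (h1 : L * μ ≤ L * μ₁ + μ₁) (h2 : μ₁ ≤ μ) : μ - μ₁ ≤ 2 * L := by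
  obtain ⟨k, rfl⟩ := Nat.exists_eq_add_of_le h2
  by_contra hlt
  rw [Nat.add_sub_cancel_left] at hlt
  nlinarith

/-- The language has no multiplication: `vSq` is kept equal to the square of `vCap` by `(L + 1) ^ 2
= L ^ 2 + L + (L + 1)`. -/
theorem capLoop_spec {μ : ℕ} {m : Mem} (hmu : m.var vMu = μ) (hcap : m.var vCap = 1)
    (hsq : m.var vSq = 1) :
    Runs (.loop (.le ‵vSq ‵vMu) (.assign vSq (.add (.add ‵vSq ‵vCap) (.add ‵vCap (.const 1))) ;;
      .incr vCap)) m fun t m' => ∃ L : ℕ, m'.var vCap = L ∧ t ≤ 30 * L ∧ 1 ≤ L ∧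
        (L - 1) ^ 2 ≤ μ ∧ μ < L ^ 2 := by
  refine (Runs.loop_intro (fun v τ m' => ∃ L : ℕ, v + L = μ + 1 ∧ τ ≤ 20 * (L - 1) ∧
    m'.var vCap = L ∧ 1 ≤ L ∧ m'.var vSq = L ^ 2 ∧ (L - 1) ^ 2 ≤ μ)
    (v₀ := μ) ⟨1, rfl, le_rfl, by simpa using hcap, le_rfl, by simpa using hsq,
      by simp⟩ ?_).mono_frame ?_
  · rintro v τ m1 hf ⟨L, hv, hτ, hL, hL1, hs, hLμ⟩ hle
    have h1 := hf.1 vMu rfl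
    simp [h1, hmu, hs] at hle
    have hle' : L ^ 2 ≤ μ := by exact_mod_cast hle
    have hlt : L ≤ μ := by nlinarith
    simp only [Runs.seq_iff, Runs.assign_iff]
    refine ⟨v - 1, by omega, L + 1, by omega, by simp; omega, by simp [hL], by omega, ?_, ?_⟩
    · simp [hL, hs]
      ring
    · simpa using hle'
  · rintro t m1 hf ⟨v, τ, rfl, ⟨L, hv, hτ, hL, hL1, hs, hLμ⟩, hle⟩
    have h1 := hf.1 vMu rfl
    simp [h1, hmu, hs] at hle
    exact ⟨L, hL, by simp; omega, hL1, hLμ, by exact_mod_cast hle⟩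

/-- Every round but the last enlarges the matching by one edge, so the number of rounds is the gain
plus `1`. The last round leaves in `aVis` the closed set of reachable columns, all of them matched.
-/
theorem augmentLoop_spec {s b : ℕ} {m : Mem} (hs : m.var vS = s) (hb : m.var vB = b)
    (hag : m.var vAgain = 1)
    (hM : IsMatching s b (edges (m.arr aG)) (m.arr aRow 0) (m.arr aCol 0)) :
    Runs (.loop (.eq ‵vAgain (.const 1))
      (search ;; .ite (.eq ‵vFound (.const (-1))) (.assign vAgain (.const 0)) flipPath)) m
      fun t m' =>
        IsMaxMatching s b (edges (m.arr aG)) (m'.arr aRow 0) (m'.arr aCol 0) (m'.arr aVis 0) ∧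
        (matchedCols b (m.arr aCol 0)).card ≤ (matchedCols b (m'.arr aCol 0)).card ∧
        t ≤ 300 * ((s + 1) * (b + 1)) * ((matchedCols b (m'.arr aCol 0)).card -
          (matchedCols b (m.arr aCol 0)).card + 1) + 4 := by
  set E := edges (m.arr aG) with hE
  set μ₁ := (matchedCols b (m.arr aCol 0)).card with hμ₁
  refine (Runs.loop_intro (fun v τ m' =>
    IsMatching s b E (m'.arr aRow 0) (m'.arr aCol 0) ∧
    μ₁ ≤ (matchedCols b (m'.arr aCol 0)).card ∧
    (m'.var vAgain = 1 ∧ v + (matchedCols b (m'.arr aCol 0)).card = s + 1 ∧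
      τ ≤ 300 * ((s + 1) * (b + 1)) * ((matchedCols b (m'.arr aCol 0)).card - μ₁) ∨
     m'.var vAgain = 0 ∧
      τ ≤ 300 * ((s + 1) * (b + 1)) * ((matchedCols b (m'.arr aCol 0)).card - μ₁ + 1) ∧
      IsMaxMatching s b E (m'.arr aRow 0) (m'.arr aCol 0) (m'.arr aVis 0)))
    (v₀ := s + 1 - μ₁) ⟨hM, le_rfl, Or.inl ⟨hag, ?_, by simp⟩⟩ ?_).mono ?_
  · have := hM.card_matchedCols_le
    omega
  · rintro v τ m1 hf ⟨hM1, hle, ⟨-, hv, hτ⟩ | ⟨h0, -⟩⟩ hag1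
    swap
    · simp [h0] at hag1
    have h1 := (hf.1 vS rfl).trans hs
    have h2 := (hf.1 vB rfl).trans hb
    have h3 := hf.2 aG rfl
    have h4 := hM1.card_matchedCols_le
    have hW : b + 1 ≤ (s + 1) * (b + 1) := Nat.le_mul_of_pos_left _ (by omega)
    rw [← h3] at hE
    rw [hE] at hM1
    refine Runs.seq_intro (search_spec h1 h2 hM1) ?_
    rw [← hE]
    rintro t m2 hf2 ⟨ht, hcl, hS⟩
    have g1 := hf2.2 aCol rfl
    have g2 := hf2.1 vAgain rfl
    rw [← g1] at hv hτ hle h4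
    simp only [Test.Holds, IntExp.eval] at hag1
    rw [Nat.mul_assoc] at ht
    rw [Runs.ite_iff]
    constructor
    · intro hf
      simp at hf
      rw [Runs.assign_iff]
      refine ⟨v - 1, by omega, by simpa using hS.matching, by simpa using hle,
        Or.inr ⟨by simp, ?_, ?_⟩⟩
      · simp
        rw [Nat.mul_succ]
        omega
      · simp
        refine ⟨hS.matching, hcl, ?_, fun q h0 h1 => (hS.vis_mem q h0 h1).1, m2.arr aPar 0,
          fun q h0 h1 hq => ?_⟩
        · rcases hS.found_eq with ⟨-, h⟩ | ⟨h, -⟩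
          · exact h
          · omega
        · have := hS.vis_mem q h0 h1
          obtain ⟨k1, k2, k3, k4⟩ := hS.forest q h0 h1 (by omega) this.2
          exact ⟨k1, k2, k3, fun h => ⟨(k4 h).1.ne', (k4 h).2⟩⟩
    · intro hf
      simp at hf
      obtain ⟨k0, k1, k2, k3⟩ : 0 ≤ m2.var vFound ∧ m2.var vFound < b ∧
          m2.arr aVis 0 (m2.var vFound) ≠ 0 ∧ m2.arr aCol 0 (m2.var vFound) = -1 := by
        rcases hS.found_eq with ⟨h, -⟩ | h
        · exact absurd h hf
        · exact h
      have k4 := hS.vis_mem _ k0 k1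
      have k5 := hS.clk_add
      refine (flipPath_spec (b := b) (s := s) (E := E) ⟨hS.matching, k0, k1, k3, by omega,
        fun q q0 q1 q2 q3 => hS.forest q q0 q1 q2 (by omega)⟩ (by omega)).mono_frame ?_
      rintro t2 m3 hf3 ⟨ht2, hM3, hc3⟩
      have l1 := hf3.1 vAgain rfl
      refine ⟨v - 1, by omega, hM3, by omega, Or.inl ⟨?_, by omega, ?_⟩⟩
      · rw [l1, g2, hag1]
      · rw [hc3, show (matchedCols b (m2.arr aCol 0)).card + 1 - μ₁ =
          (matchedCols b (m2.arr aCol 0)).card - μ₁ + 1 by omega, Nat.mul_succ]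
        simp
        omega
  · rintro t m1 ⟨v, τ, rfl, ⟨hM1, hle, ⟨h1, -⟩ | ⟨h0, hτ, hI⟩⟩, hag1⟩
    · simp [h1] at hag1
    · exact ⟨hI, hle, by simpa using hτ⟩

theorem maxMatching_spec {s b : ℕ} {m : Mem} (hs : m.var vS = s) (hb : m.var vB = b) :
    Runs maxMatching m fun t m' =>
      t ≤ 4000 * ((s + 1) * (b + 1)) * (Nat.sqrt (matchedCols b (m'.arr aCol 0)).card + 1) ∧
      IsMaxMatching s b (edges (m.arr aG)) (m'.arr aRow 0) (m'.arr aCol 0) (m'.arr aVis 0) := by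
  rw [maxMatching]
  refine Runs.seq_intro (Runs.forTo_intro (c := 4) (fun k m' =>
    ∀ i, 0 ≤ i → i < k → m'.arr aRow 0 i = -1) (n := s) hs (by decide) rfl rfl ?_ ?_) ?_
  · intro q h0 h1
    omega
  · intro k m2 hf hk0 hkb hk hb2 hI
    rw [Runs.store_iff]
    refine ⟨by simp, fun q h0 hq => ?_⟩
    simp [hk]
    intro hne
    exact hI q h0 (by omega)
  rintro t1 m1 hf1 ⟨ht1, -, hr1⟩
  have hb1 := (hf1.1 vB rfl).trans hb
  refine Runs.seq_intro (Runs.forTo_intro (c := 8) (fun k m' =>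
    ∀ q, 0 ≤ q → q < k → m'.arr aCol 0 q = -1 ∧ m'.arr aPrice 0 q = 0)
    (n := b) hb1 (by decide) rfl rfl ?_ ?_) ?_
  · intro q h0 h1
    omega
  · intro k m2 hf hk0 hkb hk hb2 hI
    simp only [Runs.store_iff, Runs.seq_iff]
    refine ⟨by simp, fun q h0 hq => ?_⟩
    by_cases hqk : q = k
    · simp [hk, hqk]
    · simpa [hk, hqk] using hI q h0 (by omega)
  rintro t2 m2 hf2 ⟨ht2, -, hc2⟩
  have hb2 := (hf2.1 vB rfl).trans hb1
  have hs2 := (hf2.1 vS rfl).trans ((hf1.1 vS rfl).trans hs)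
  have hG2 := (hf2.2 aG rfl).trans (hf1.2 aG rfl)
  have hr2 := hf2.2 aRow rfl
  rw [← hr2] at hr1
  rw [← hG2]
  have hcard0 : (matchedCols b (m2.arr aCol 0)).card = 0 := by
    rw [Finset.card_eq_zero, Finset.eq_empty_iff_forall_notMem]
    intro q hq
    rw [mem_matchedCols] at hq
    exact hq.2 (hc2 q hq.1.1 hq.1.2).1
  have hP2 : IsPricedMatching s b (edges (m2.arr aG)) (1 : ℕ) (m2.arr aRow 0) (m2.arr aCol 0)
      (m2.arr aPrice 0) := by
    refine ⟨⟨fun i h0 h1 h2 => absurd (hr1 i h0 h1) h2,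
      fun q h0 h1 h2 => absurd (hc2 q h0 h1).1 h2⟩,
      fun q h0 h1 => by simp [hc2 q h0 h1], fun q h0 h1 h2 => absurd (hc2 q h0 h1).2 h2,
      fun i q h0 h1 _ _ h2 => absurd (hr1 i h0 h1) h2⟩
  rw [Runs.seq_iff, Runs.assign_iff, Runs.seq_iff, Runs.assign_iff]
  refine Runs.seq_intro (auction_spec (s := s) (b := b) (L := 1) (by simpa using hs2)
    (by simpa using hb2) (by simp) (by simpa using hP2) (by simp [hcard0])) ?_
  rintro t3 m3 hf3 ⟨ht3, hP3, hmu3, hfree3⟩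
  have hb3 := hf3.1 vB rfl
  have hs3 := hf3.1 vS rfl
  have hG3 := hf3.2 aG rfl
  simp [hb2, hs2] at hb3 hs3 hG3 hP3 hfree3
  rw [← hG3] at hP3 hfree3 ⊢
  rw [Runs.seq_iff, Runs.assign_iff]
  refine Runs.seq_intro (capLoop_spec (μ := (matchedCols b (m3.arr aCol 0)).card)
    (by simpa using hmu3) ?_ (by simp)) ?_
  · have := hf3.1 vCap rfl
    simpa using this
  rintro t4 m4 hf4 ⟨L, hL4, ht4, hL1, hLl, hLu⟩
  have hb4 := hf4.1 vB rfl
  have hs4 := hf4.1 vS rfl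
  have hG4 := hf4.2 aG rfl
  have hR4 := hf4.2 aRow rfl
  have hC4 := hf4.2 aCol rfl
  have hp4 := hf4.2 aPrice rfl
  have hmu4 := hf4.1 vMu rfl
  simp [hb3, hs3] at hb4 hs4 hG4 hR4 hC4 hp4 hmu4
  -- The prices left by the first auction are at most `1 ≤ L`, so the second auction can start from
  -- them.
  have hP4 : IsPricedMatching s b (edges (m4.arr aG)) (L : ℕ) (m4.arr aRow 0) (m4.arr aCol 0)
      (m4.arr aPrice 0) := by
    rw [hG4, hR4, hC4, hp4]
    exact { hP3 with
      price := fun q h0 h1 => ⟨(hP3.price q h0 h1).1, by have := (hP3.price q h0 h1).2; omega⟩ }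
  refine Runs.seq_intro (auction_spec hs4 hb4 hL4 hP4 (by rw [hmu4, hC4, hmu3])) ?_
  rintro t5 m5 hf5 ⟨ht5, hP5, hmu5, hfree5⟩
  have hb5 := (hf5.1 vB rfl).trans hb4
  have hs5 := (hf5.1 vS rfl).trans hs4
  have hG5 := hf5.2 aG rfl
  rw [hG4] at hP5 hfree5 hG5
  rw [Runs.seq_iff, Runs.assign_iff]
  refine (augmentLoop_spec (s := s) (b := b) (by simpa using hs5) (by simpa using hb5) (by simp)
    (by simpa [hG5] using hP5.toIsMatching)).mono ?_
  rintro t6 m6 ⟨hM6, hle6, ht6⟩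
  simp [hG5] at hM6 hle6 ht6
  refine ⟨?_, hM6⟩
  -- Three comparisons of sizes: `c1` says that the first auction reaches half of the maximum, `c2`
  -- bounds the number of augmentations, and `c3` shows that the second auction has not lost much of
  -- the first matching, which bounds `L`.
  have c1 := IsPricedMatching.mul_card_le (L := 1) (by simpa using hP3) (by simpa using hfree3)
    hM6.toIsMatching
  have c2 := hP5.mul_card_le hfree5 hM6.toIsMatching
  have c3 := hP5.mul_card_le hfree5 hP3.toIsMatching
  have d1 := cap_le_sqrt hLl hL1 c3 hle6
  have d2 := augmentations_le hLu (by omega) c2 hle6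
  simp only [IntExp.cost]
  set W := (s + 1) * (b + 1) with hW
  set r := Nat.sqrt (matchedCols b (m6.arr aCol 0)).card with hr
  have w1 : s + 1 ≤ W := Nat.le_mul_of_pos_right _ (by omega)
  have w2 : b + 1 ≤ W := Nat.le_mul_of_pos_left _ (by omega)
  have w3 : 100 * (b + 1) * (s + s * 1 + 1) ≤ 200 * W := by
    have : 200 * W = 100 * (b + 1) * (s + s * 1 + 1) + 100 * (b + 1) := by rw [hW]; ring
    omega
  have w4 : 100 * (b + 1) * (s + s * L + 1) ≤ 100 * (W * L) + 100 * W := by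
    have : 100 * (W * L) + 100 * W = 100 * (b + 1) * (s + s * L + 1) + 100 * ((b + 1) * L) := by
      rw [hW]; ring
    omega
  have w5 := Nat.mul_le_mul_left (300 * W) (Nat.add_le_add_right d2 1)
  have w6 : 300 * W * (2 * L + 1) = 600 * (W * L) + 300 * W := by ring
  have w7 : W * L ≤ W * (2 * r + 2) := Nat.mul_le_mul_left _ d1
  have w8 : L ≤ W * L := Nat.le_mul_of_pos_left _ (by omega)
  have w9 : 4000 * W * (r + 1) = 2000 * (W * (2 * r + 2)) := by ring
  have w10 : W * 2 ≤ W * (2 * r + 2) := Nat.mul_le_mul_left _ (by omega)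
  omega


/-! ### Transversal zeros and covers -/

section Covers

variable {s n : ℕ} {A : Matrix (Fin s) (Fin n) (WithBot ℕ)} {R R' : Finset (Fin s)}
  {B C' : Finset (Fin n)} {M : Finset (Fin s × Fin n)}

theorem IsTransversalZeros.card_le_max (hM : IsTransversalZeros A R B M) :
    M.card ≤ maxTransversalZeros A R B := by
  classical
  unfold maxTransversalZeros
  exact Finset.le_sup (f := Finset.card) (Finset.mem_filter.2 ⟨Finset.mem_univ M, hM⟩)

theorem exists_card_eq_maxTransversalZeros (A : Matrix (Fin s) (Fin n) (WithBot ℕ))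
    (R : Finset (Fin s)) (B : Finset (Fin n)) :
    ∃ M, IsTransversalZeros A R B M ∧ M.card = maxTransversalZeros A R B := by
  classical
  have hne : ((Finset.univ : Finset (Finset (Fin s × Fin n))).filter
      (IsTransversalZeros A R B)).Nonempty :=
    ⟨∅, by simp [IsTransversalZeros]⟩
  obtain ⟨M, hM, he⟩ := Finset.exists_mem_eq_sup _ hne Finset.card
  refine ⟨M, (Finset.mem_filter.1 hM).2, ?_⟩
  unfold maxTransversalZeros
  convert he.symm

theorem IsTransversalZeros.card_filter_fst_le (hM : IsTransversalZeros A R B M) :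
    (M.filter fun x => x.1 ∈ R').card ≤ R'.card := by
  apply Finset.card_le_card_of_injOn Prod.fst
  · intro x hx
    simp at hx ⊢
    exact hx.2
  · intro x hx y hy h
    simp at hx hy
    exact hM.2.1 x hx.1 y hy.1 h

theorem IsTransversalZeros.card_filter_snd_le (hM : IsTransversalZeros A R B M) :
    (M.filter fun x => x.2 ∈ C').card ≤ C'.card := by
  apply Finset.card_le_card_of_injOn Prod.snd
  · intro x hx
    simp at hx ⊢
    exact hx.2
  · intro x hx y hy h
    simp at hx hy
    exact hM.2.2 x hx.1 y hy.1 h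

/-- In a cover with as many lines as there are transversal zeros, every zero of the family is on
exactly one line, and every line contains one of them. -/
theorem IsTransversalZeros.of_cover (hM : IsTransversalZeros A R B M)
    (hc : ∀ i ∈ R, ∀ j ∈ B, A i j = 0 → i ∈ R' ∨ j ∈ C') :
    M.card ≤ R'.card + C'.card ∧ (R'.card + C'.card = M.card →
      (∀ x ∈ M, x.1 ∈ R' → x.2 ∉ C') ∧ (∀ i ∈ R', ∃ x ∈ M, x.1 = i) ∧
        ∀ j ∈ C', ∃ x ∈ M, x.2 = j) := by
  have h1 := hM.card_filter_fst_le (R' := R')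
  have h2 := hM.card_filter_snd_le (C' := C')
  have h3 : (M.filter fun x => x.1 ∈ R') ∪ (M.filter fun x => x.2 ∈ C') = M := by
    ext x
    simp only [Finset.mem_union, Finset.mem_filter, ← and_or_left, and_iff_left_iff_imp]
    intro hx
    obtain ⟨a, b, c⟩ := hM.1 x hx
    exact hc _ a _ b c
  have h4 := Finset.card_union_add_card_inter (M.filter fun x => x.1 ∈ R')
    (M.filter fun x => x.2 ∈ C')
  rw [h3] at h4
  refine ⟨by omega, fun he => ⟨fun x hx h5 h6 => ?_, fun i hi => ?_, fun j hj => ?_⟩⟩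
  · have : ((M.filter fun x => x.1 ∈ R') ∩ (M.filter fun x => x.2 ∈ C')).card = 0 := by omega
    rw [Finset.card_eq_zero] at this
    have hx' : x ∈ (M.filter fun x => x.1 ∈ R') ∩ (M.filter fun x => x.2 ∈ C') := by
      simp [hx, h5, h6]
    simp [this] at hx'
  · have : (M.filter fun x => x.1 ∈ R').image Prod.fst = R' := by
      apply Finset.eq_of_subset_of_card_le
      · intro k hk
        obtain ⟨x, hx, rfl⟩ := Finset.mem_image.1 hk
        exact (Finset.mem_filter.1 hx).2
      · rw [Finset.card_image_of_injOn]
        · omega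
        · intro x hx y hy h
          simp at hx hy
          exact hM.2.1 x hx.1 y hy.1 h
    rw [← this] at hi
    obtain ⟨x, hx, rfl⟩ := Finset.mem_image.1 hi
    exact ⟨x, (Finset.mem_filter.1 hx).1, rfl⟩
  · have : (M.filter fun x => x.2 ∈ C').image Prod.snd = C' := by
      apply Finset.eq_of_subset_of_card_le
      · intro k hk
        obtain ⟨x, hx, rfl⟩ := Finset.mem_image.1 hk
        exact (Finset.mem_filter.1 hx).2
      · rw [Finset.card_image_of_injOn]
        · omega
        · intro x hx y hy h
          simp at hx hy
          exact hM.2.2 x hx.1 y hy.1 h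
    rw [← this] at hj
    obtain ⟨x, hx, rfl⟩ := Finset.mem_image.1 hj
    exact ⟨x, (Finset.mem_filter.1 hx).1, rfl⟩

theorem maxTransversalZeros_le_of_cover
    (hc : ∀ i ∈ R, ∀ j ∈ B, A i j = 0 → i ∈ R' ∨ j ∈ C') :
    maxTransversalZeros A R B ≤ R'.card + C'.card := by
  obtain ⟨M, hM, he⟩ := exists_card_eq_maxTransversalZeros A R B
  rw [← he]
  exact (hM.of_cover hc).1

/-- The output of HK described by a family of transversal zeros and the set `Z` of the columns
reachable by an alternating path from an unmatched row. -/
theorem isHKOutput_of_reachable {Z : Finset (Fin n)} (hM : IsTransversalZeros A R B M)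
    (hclosed : ∀ i ∈ R, ∀ j ∈ B, A i j = 0 → (∀ x ∈ M, x.1 = i → x.2 ∈ Z) → j ∈ Z)
    (hZ : ∀ j ∈ Z, ∃ x ∈ M, x.2 = j)
    (hreach : ∀ D : Finset (Fin n), (∀ i ∈ R, ∀ j ∈ Z, A i j = 0 →
      (∀ x ∈ M, x.1 = i → x.2 ∈ D) → j ∈ D) → Z ⊆ D) :
    IsHKOutput A R B ((M.filter fun x => x.2 ∉ Z).image Prod.fst) Z (M.image Prod.snd \ Z) ∧
      maxTransversalZeros A R B = M.card := by
  set R₀ := (M.filter fun x => x.2 ∉ Z).image Prod.fst with hR₀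
  have hcov : ∀ i ∈ R, ∀ j ∈ B, A i j = 0 → i ∈ R₀ ∨ j ∈ Z := by
    intro i hi j hj h0
    by_contra! hcon
    apply hcon.2
    refine hclosed i hi j hj h0 fun x hx hxi => ?_
    by_contra hxZ
    exact hcon.1 (Finset.mem_image.2 ⟨x, Finset.mem_filter.2 ⟨hx, hxZ⟩, hxi⟩)
  -- Each element of `M` is counted once: by its column if that is in `Z`, by its row otherwise. All
  -- the columns of `Z` are used.
  have hcard : R₀.card + Z.card = M.card := by
    have h1 : R₀.card = (M.filter fun x => x.2 ∉ Z).card := by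
      apply Finset.card_image_of_injOn
      intro x hx y hy h
      simp at hx hy
      exact hM.2.1 x hx.1 y hy.1 h
    have h2 : Z.card = (M.filter fun x => x.2 ∈ Z).card := by
      refine le_antisymm ?_ hM.card_filter_snd_le
      have : Z ⊆ (M.filter fun x => x.2 ∈ Z).image Prod.snd := by
        intro j hj
        obtain ⟨x, hx, rfl⟩ := hZ j hj
        exact Finset.mem_image_of_mem _ (Finset.mem_filter.2 ⟨hx, hj⟩)
      exact (Finset.card_le_card this).trans Finset.card_image_le
    have h3 := Finset.card_filter_add_card_filter_not (s := M) (fun x => x.2 ∈ Z)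
    omega
  have hmax : maxTransversalZeros A R B = M.card :=
    le_antisymm ((maxTransversalZeros_le_of_cover hcov).trans hcard.le) hM.card_le_max
  refine ⟨⟨⟨?_, ?_, hcov, hcard.trans hmax.symm⟩, ?_, M, hM, hmax.symm, rfl⟩, hmax⟩
  · intro i hi
    obtain ⟨x, hx, rfl⟩ := Finset.mem_image.1 hi
    exact (hM.1 x (Finset.mem_filter.1 hx).1).1
  · intro j hj
    obtain ⟨x, hx, rfl⟩ := hZ j hj
    exact (hM.1 x hx).2.1
  · rintro R' C' ⟨hR', hC', hc, he⟩
    obtain ⟨h1, h2, -⟩ := (hM.of_cover hc).2 (he.trans hmax)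
    have hsub : Z ⊆ C' := by
      -- In a tight cover, each row of `R'` carries an element of `M` whose column is outside `C'`.
      -- A row whose mates are all in `C'`, in particular an unmatched row, is therefore not in
      -- `R'`, and its zeros have to be covered by `C'`.
      refine hreach C' fun i hi j hj h0 hx => ?_
      obtain ⟨y, hy, hyj⟩ := hZ j hj
      rcases hc i hi j (hyj ▸ (hM.1 y hy).2.1) h0 with h | h
      · obtain ⟨x, hxM, rfl⟩ := h2 i h
        exact absurd (hx x hxM rfl) (h1 x hxM h)
      · exact h
    refine ⟨fun i hi => ?_, hsub⟩
    obtain ⟨x, hxM, rfl⟩ := h2 i hi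
    exact Finset.mem_image.2
      ⟨x, Finset.mem_filter.2 ⟨hxM, fun h => h1 x hxM hi (hsub h)⟩, rfl⟩

end Covers

/-- The integers `bl 0, …, bl (b - 1)` are the elements of `B`, without repetition. -/
structure IsColumnList {n : ℕ} (b : ℕ) (bl : ℤ → ℤ) (B : Finset (Fin n)) : Prop where
  mem : ∀ q : ℤ, 0 ≤ q → q < b → ∃ j ∈ B, bl q = (j : ℕ)
  surj : ∀ j ∈ B, ∃ q : ℤ, 0 ≤ q ∧ q < b ∧ bl q = (j : ℕ)
  inj : ∀ q q' : ℤ, 0 ≤ q → q < b → 0 ≤ q' → q' < b → bl q = bl q' → q = q'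

/-! ### From matchings of index intervals to transversal zeros -/

section Transport

open Classical in
/-- The columns in `bl` with index satisfying `p`. -/
noncomputable def columnsWith {n : ℕ} (b : ℕ) (bl : ℤ → ℤ) (p : ℤ → Prop) : Finset (Fin n) :=
  Finset.univ.filter fun j => ∃ q : ℤ, 0 ≤ q ∧ q < b ∧ bl q = (j : ℕ) ∧ p q

theorem mem_columnsWith {n b : ℕ} {bl : ℤ → ℤ} {p : ℤ → Prop} {j : Fin n} :
    j ∈ columnsWith b bl p ↔ ∃ q : ℤ, 0 ≤ q ∧ q < b ∧ bl q = (j : ℕ) ∧ p q := by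
  simp [columnsWith]

open Classical in
/-- The rows `i` such that `p i`. -/
noncomputable def rowsWith (s : ℕ) (p : ℤ → Prop) : Finset (Fin s) :=
  Finset.univ.filter fun i => p (i : ℕ)

theorem mem_rowsWith {s : ℕ} {p : ℤ → Prop} {i : Fin s} : i ∈ rowsWith s p ↔ p (i : ℕ) := by
  simp [rowsWith]

variable {s n b : ℕ} {A : Matrix (Fin s) (Fin n) (WithBot ℕ)} {R : Finset (Fin s)}
  {B : Finset (Fin n)} {E : ℤ → ℤ → Prop} {mr mc vis bl : ℤ → ℤ}

/-- The columns are renumbered by `bl`, whereas the rows keep their numbers: those outside `R`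
remain as isolated vertices, never matched and without influence on the reachable columns. -/
theorem IsMaxMatching.isHKOutput (h : IsMaxMatching s b E mr mc vis) (hbl : IsColumnList b bl B)
    (hE : ∀ (i : Fin s) (j : Fin n) (q : ℤ), 0 ≤ q → q < b → bl q = (j : ℕ) →
      (E (i : ℕ) q ↔ i ∈ R ∧ A i j = 0)) :
    IsHKOutput A R B (rowsWith s fun i => mr i ≠ -1 ∧ vis (mr i) = 0)
      (columnsWith b bl fun q => vis q ≠ 0) (columnsWith b bl fun q => mc q ≠ -1 ∧ vis q = 0) ∧
    maxTransversalZeros A R B = (matchedCols b mc).card := by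
  classical
  set M : Finset (Fin s × Fin n) := Finset.univ.filter fun x =>
    ∃ q : ℤ, 0 ≤ q ∧ q < b ∧ bl q = ((x.2 : ℕ) : ℤ) ∧ mc q = ((x.1 : ℕ) : ℤ) with hMdef
  have memM : ∀ x, x ∈ M ↔ ∃ q : ℤ, 0 ≤ q ∧ q < b ∧ bl q = ((x.2 : ℕ) : ℤ) ∧
      mc q = ((x.1 : ℕ) : ℤ) := by
    intro x
    simp [hMdef]
  have hedge : ∀ q : ℤ, 0 ≤ q → q < b → mc q ≠ -1 → ∃ x ∈ M, bl q = ((x.2 : ℕ) : ℤ) ∧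
      mc q = ((x.1 : ℕ) : ℤ) := by
    intro q h0 h1 hm
    obtain ⟨c0, c1, -⟩ := h.col q h0 h1 hm
    obtain ⟨j, -, hj⟩ := hbl.mem q h0 h1
    have hi : mc q = (((⟨(mc q).toNat, by omega⟩ : Fin s) : ℕ) : ℤ) := by
      simp
      omega
    exact ⟨(⟨(mc q).toNat, by omega⟩, j), (memM _).2 ⟨q, h0, h1, hj, hi⟩, hj, hi⟩
  have hcell : ∀ x ∈ M, ∀ q : ℤ, 0 ≤ q → q < b → bl q = ((x.2 : ℕ) : ℤ) →
      mc q = ((x.1 : ℕ) : ℤ) ∧ mr ((x.1 : ℕ) : ℤ) = q ∧ E ((x.1 : ℕ) : ℤ) q := by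
    intro x hx q h0 h1 hq
    obtain ⟨q', h0', h1', hq', hm⟩ := (memM x).1 hx
    have := hbl.inj q q' h0 h1 h0' h1' (hq.trans hq'.symm)
    subst this
    have hc := h.col q h0 h1 (by omega)
    rw [hm] at hc
    have hr := h.row _ hc.1 hc.2.1 (by rw [hc.2.2]; omega)
    rw [hc.2.2] at hr
    exact ⟨hm, hc.2.2, hr.2.2.1⟩
  have hM : IsTransversalZeros A R B M := by
    refine ⟨fun x hx => ?_, fun x hx y hy hxy => ?_, fun x hx y hy hxy => ?_⟩
    · obtain ⟨q, h0, h1, hq, -⟩ := (memM x).1 hx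
      obtain ⟨-, -, hEq⟩ := hcell x hx q h0 h1 hq
      obtain ⟨j, hj, hqj⟩ := hbl.mem q h0 h1
      have hj2 : j = x.2 := by
        ext
        omega
      rw [hE x.1 x.2 q h0 h1 hq] at hEq
      exact ⟨hEq.1, hj2 ▸ hj, hEq.2⟩
    · obtain ⟨q, h0, h1, hq, -⟩ := (memM x).1 hx
      obtain ⟨q', h0', h1', hq', -⟩ := (memM y).1 hy
      have e1 := (hcell x hx q h0 h1 hq).2.1
      have e2 := (hcell y hy q' h0' h1' hq').2.1
      rw [hxy, e2] at e1
      subst e1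
      refine Prod.ext hxy (Fin.ext ?_)
      omega
    · obtain ⟨q, h0, h1, hq, hm⟩ := (memM x).1 hx
      have e2 := (hcell y hy q h0 h1 (by rw [hq, hxy])).1
      refine Prod.ext (Fin.ext ?_) hxy
      omega
  set Z : Finset (Fin n) := columnsWith b bl fun q => vis q ≠ 0 with hZ
  have hmemZ : ∀ (j : Fin n) (q : ℤ), 0 ≤ q → q < b → bl q = (j : ℕ) → (j ∈ Z ↔ vis q ≠ 0) := by
    intro j q h0 h1 hq
    rw [hZ, mem_columnsWith]
    constructor
    · rintro ⟨q', h0', h1', hq', hv⟩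
      rwa [hbl.inj q q' h0 h1 h0' h1' (hq.trans hq'.symm)]
    · exact fun hv => ⟨q, h0, h1, hq, hv⟩
  have hrowM : ∀ i : Fin s, mr (i : ℕ) ≠ -1 → ∃ x ∈ M, x.1 = i ∧
      bl (mr (i : ℕ)) = ((x.2 : ℕ) : ℤ) ∧ (0 ≤ mr (i : ℕ) ∧ mr (i : ℕ) < b) := by
    intro i hi
    obtain ⟨r0, r1, -, r3⟩ := h.row (i : ℕ) (by omega) (by omega) hi
    obtain ⟨x, hx, hx1, hx2⟩ := hedge _ r0 r1 (by rw [r3]; omega)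
    refine ⟨x, hx, Fin.ext ?_, hx1, r0, r1⟩
    omega
  have main := isHKOutput_of_reachable (Z := Z) hM ?_ ?_ ?_
  · have e1 : (M.filter fun x => x.2 ∉ Z).image Prod.fst =
        rowsWith s fun i => mr i ≠ -1 ∧ vis (mr i) = 0 := by
      ext i
      rw [Finset.mem_image, mem_rowsWith]
      constructor
      · rintro ⟨x, hx, rfl⟩
        rw [Finset.mem_filter] at hx
        obtain ⟨q, h0, h1, hq, -⟩ := (memM x).1 hx.1
        have hx2 := hx.2
        rw [hmemZ x.2 q h0 h1 hq, not_not] at hx2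
        rw [(hcell x hx.1 q h0 h1 hq).2.1]
        exact ⟨by omega, hx2⟩
      · rintro ⟨hi, hv⟩
        obtain ⟨x, hx, hxi, hq, h0, h1⟩ := hrowM i hi
        refine ⟨x, Finset.mem_filter.2 ⟨hx, ?_⟩, hxi⟩
        rw [hmemZ _ _ h0 h1 hq, not_not]
        exact hv
    have e2 : M.image Prod.snd \ Z = columnsWith b bl fun q => mc q ≠ -1 ∧ vis q = 0 := by
      ext j
      rw [Finset.mem_sdiff, Finset.mem_image]
      constructor
      · rintro ⟨⟨x, hx, rfl⟩, hj⟩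
        obtain ⟨q, h0, h1, hq, hm⟩ := (memM x).1 hx
        rw [hmemZ x.2 q h0 h1 hq, not_not] at hj
        exact mem_columnsWith.2 ⟨q, h0, h1, hq, by omega, hj⟩
      · intro hj
        obtain ⟨q, h0, h1, hq, hm, hv⟩ := mem_columnsWith.1 hj
        obtain ⟨x, hx, hx1, hx2⟩ := hedge q h0 h1 hm
        refine ⟨⟨x, hx, Fin.ext (by omega)⟩, ?_⟩
        rw [hmemZ j q h0 h1 hq, not_not]
        exact hv
    have e3 : M.card = (matchedCols b mc).card := by
      symm
      refine Finset.card_bij' (fun q hq => (hedge q (mem_matchedCols.1 hq).1.1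
        (mem_matchedCols.1 hq).1.2 (mem_matchedCols.1 hq).2).choose)
        (fun x _ => mr ((x.1 : ℕ) : ℤ)) ?_ ?_ ?_ ?_
      · intro q hq
        have hq' := mem_matchedCols.1 hq
        exact (hedge q hq'.1.1 hq'.1.2 hq'.2).choose_spec.1
      · intro x hx
        obtain ⟨q, h0, h1, hq, hm⟩ := (memM x).1 hx
        rw [(hcell x hx q h0 h1 hq).2.1, mem_matchedCols]
        exact ⟨⟨h0, h1⟩, by omega⟩
      · intro q hq
        have hq' := mem_matchedCols.1 hq
        have hs := (hedge q hq'.1.1 hq'.1.2 hq'.2).choose_spec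
        exact (hcell _ hs.1 q hq'.1.1 hq'.1.2 hs.2.1).2.1
      · intro x hx
        obtain ⟨q, h0, h1, hq, hm⟩ := (memM x).1 hx
        have hr := (hcell x hx q h0 h1 hq).2.1
        have hs := (hedge q h0 h1 (by omega)).choose_spec
        simp only [hr]
        refine Prod.ext (Fin.ext ?_) (Fin.ext ?_)
        · omega
        · omega
    rw [e1, e2, e3] at main
    exact main
  · intro i hi j hj h0 hx
    obtain ⟨q, q0, q1, hq⟩ := hbl.surj j hj
    rw [hmemZ j q q0 q1 hq]
    refine h.closed (i : ℕ) q (by omega) (by omega) q0 q1 ((hE i j q q0 q1 hq).2 ⟨hi, h0⟩) ?_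
    intro hm
    obtain ⟨x, hxM, hxi, hbx, r0, r1⟩ := hrowM i hm
    rw [← hmemZ _ _ r0 r1 hbx]
    exact hx x hxM hxi
  · intro j hj
    obtain ⟨q, h0, h1, hq, hv⟩ := mem_columnsWith.1 hj
    obtain ⟨x, hx, hx1, -⟩ := hedge q h0 h1 (h.visited q h0 h1 hv)
    exact ⟨x, hx, Fin.ext (by omega)⟩
  · intro D hD
    obtain ⟨par, hpar⟩ := h.forest
    -- Induction on a bound of the time of the visit: the mate of the parent of `q` was visited
    -- before `q`, so the forest is climbed towards the unmatched rows.
    have key : ∀ (N : ℕ) (q : ℤ), 0 ≤ q → q < b → vis q ≠ 0 → vis q ≤ N →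
        ∀ j : Fin n, bl q = (j : ℕ) → j ∈ D := by
      intro N
      induction N with
      | zero =>
        intro q h0 h1 hv hN
        have := h.vis_nonneg q h0 h1
        omega
      | succ N ih =>
        intro q h0 h1 hv hN j hq
        obtain ⟨p0, p1, p2, p3⟩ := hpar q h0 h1 hv
        have hi : par q = (((⟨(par q).toNat, by omega⟩ : Fin s) : ℕ) : ℤ) := by
          simp
          omega
        generalize (⟨(par q).toNat, by omega⟩ : Fin s) = i at hi
        rw [hi] at p2 p3
        obtain ⟨hiR, h0'⟩ := (hE i j q h0 h1 hq).1 p2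
        refine hD i hiR j ((hmemZ j q h0 h1 hq).2 hv) h0' fun x hx hxi => ?_
        obtain ⟨q', k0, k1, hq', hm'⟩ := (memM x).1 hx
        have hr := (hcell x hx q' k0 k1 hq').2.1
        rw [hxi] at hr
        rw [hr] at p3
        obtain ⟨p4, p5⟩ := p3 (by omega)
        exact ih q' k0 k1 p4 (by omega) x.2 hq'
    intro j hj
    obtain ⟨q, h0, h1, hq, hv⟩ := mem_columnsWith.1 hj
    exact key (vis q).toNat q h0 h1 hv (by omega) j hq

end Transport

/-- HK has an output on every matrix. -/
theorem exists_isHKOutput {s n : ℕ} (A : Matrix (Fin s) (Fin n) (WithBot ℕ)) (R : Finset (Fin s))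
    (B : Finset (Fin n)) : ∃ R₀ C₀ Y₁, IsHKOutput A R B R₀ C₀ Y₁ := by
  classical
  let bl : ℤ → ℤ := fun q =>
    if h : q.toNat < B.card then ((B.orderEmbOfFin rfl ⟨_, h⟩ : ℕ) : ℤ) else 0
  -- The same contents serve for every array: `maxMatching_spec` assumes nothing about those other
  -- than `aG`.
  let f : ℕ → ℤ → ℤ → ℤ := fun _ i q =>
    if ∃ (i' : Fin s) (j' : Fin n), i = (i' : ℕ) ∧ bl q = (j' : ℕ) ∧ i' ∈ R ∧ A i' j' = 0
    then 1 else 0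
  -- The existence of an output is read off from the terminating execution of the program itself.
  obtain ⟨t, m', -, -, h⟩ := maxMatching_spec (s := s) (b := B.card)
    (m := ⟨fun x => if x = vS then s else B.card, f⟩) (by simp) (by simp)
  have hbl : ∀ q : ℤ, q < B.card → 0 ≤ q → ∃ h : q.toNat < B.card,
      bl q = ((B.orderEmbOfFin rfl ⟨q.toNat, h⟩ : ℕ) : ℤ) := fun q h h0 =>
    ⟨by omega, by simp [bl, show q.toNat < B.card by omega]⟩
  refine ⟨_, _, _, (h.isHKOutput (A := A) (R := R) (B := B) (bl := bl)
    ⟨fun q h0 h1 => ?_, fun j hj => ?_, fun q q' h0 h1 h0' h1' he => ?_⟩ ?_).1⟩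
  · obtain ⟨hq, h2⟩ := hbl q h1 h0
    exact ⟨_, Finset.orderEmbOfFin_mem B rfl _, h2⟩
  · have : j ∈ Set.range (B.orderEmbOfFin rfl) := by
      rw [Finset.range_orderEmbOfFin]
      exact hj
    obtain ⟨k, rfl⟩ := this
    exact ⟨(k : ℕ), by omega, by omega, by simp [bl]⟩
  · obtain ⟨hq, h2⟩ := hbl q h1 h0
    obtain ⟨hq', h2'⟩ := hbl q' h1' h0'
    rw [h2, h2'] at he
    have := (B.orderEmbOfFin rfl).injective (Fin.ext (by exact_mod_cast he))
    simp at this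
    omega
  · intro i j q h0 h1 hq
    simp only [edges, f]
    constructor
    · intro h
      split_ifs at h with hc
      · obtain ⟨i', j', hi, hj, hc⟩ := hc
        have e1 : i' = i := Fin.ext (by omega)
        have e2 : j' = j := Fin.ext (by omega)
        rwa [e1, e2] at hc
      · omega
    · intro h
      rw [if_pos ⟨i, j, rfl, hq, h⟩]


/-! ### Correctness of the algorithm -/

/-- The submatrix of `A` with rows `R` and columns `Y` is square and its Jacobi number is `0`. -/
structure IsZeroBlock {s n : ℕ} (A : Matrix (Fin s) (Fin n) (WithBot ℕ)) (R : Finset (Fin s))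
    (Y : Finset (Fin n)) : Prop where
  card_eq : Y.card = R.card
  exists_zero : ∃ σ : R → Fin n, Function.Injective σ ∧ ∀ i, σ i ∈ Y ∧ A i (σ i) = 0
  all_zero : ∀ τ : R → Fin n, Function.Injective τ → (∀ i, τ i ∈ Y ∧ A i (τ i) ≠ ⊥) →
    ∀ i : R, A i (τ i) = 0

/-! ### Zero blocks and the saddle Jacobi number -/

section Jacobi

variable {s n : ℕ} {A : Matrix (Fin s) (Fin n) (WithBot ℕ)}

theorem WithBot.nonneg_of_ne_bot {x : WithBot ℕ} (h : x ≠ ⊥) : 0 ≤ x := by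
  lift x to ℕ using h
  rw [← WithBot.coe_zero]
  exact WithBot.coe_le_coe.2 (Nat.zero_le x)

theorem WithBot.sum_le_zero {ι : Type*} {S : Finset ι} {f : ι → WithBot ℕ}
    (hf : ∀ i ∈ S, f i ≠ ⊥) (h : ∑ i ∈ S, f i ≤ 0) : ∀ i ∈ S, f i = 0 := by
  have h0 : ∀ i ∈ S, 0 ≤ f i := fun i hi => WithBot.nonneg_of_ne_bot (hf i hi)
  exact fun i hi => le_antisymm ((Finset.single_le_sum h0 hi).trans h) (h0 i hi)

theorem WithBot.ne_bot_of_sum_ne_bot {ι : Type*} {S : Finset ι} {f : ι → WithBot ℕ}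
    (h : ∑ i ∈ S, f i ≠ ⊥) : ∀ i ∈ S, f i ≠ ⊥ := by
  classical
  intro i hi hb
  apply h
  rw [← Finset.add_sum_erase _ _ hi, hb, WithBot.bot_add]

/-- A finite sum of entries has nonnegative terms, so it is at most `0` only if they all vanish. A
maximum equal to `0` thus means that some transversal is finite and that the finite ones consist of
zeros. -/
theorem isZeroBlock_univ_iff {Y : Finset (Fin n)} :
    IsZeroBlock A Finset.univ Y ↔ Y.card = s ∧ jacobiNumberOn A Y = 0 := by
  constructor
  · rintro ⟨hc, ⟨σ, hσ, hσ0⟩, hall⟩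
    refine ⟨by simpa using hc, le_antisymm (Finset.sup_le fun τ _ => ?_) ?_⟩
    · by_cases hb : ∑ i, (A.submatrix id (Subtype.val : {j // j ∈ Y} → Fin n)) i (τ i) = ⊥
      · rw [hb]
        exact bot_le
      · have h1 := WithBot.ne_bot_of_sum_ne_bot hb
        have h2 := hall (fun i => τ i.1) (fun i j h => Subtype.ext (τ.injective (Subtype.ext h)))
          (fun i => ⟨(τ i.1).2, h1 i.1 (Finset.mem_univ _)⟩)
        exact (Finset.sum_eq_zero fun i _ => h2 ⟨i, Finset.mem_univ i⟩).le
    · let τ : Fin s ↪ {j // j ∈ Y} := ⟨fun i => ⟨σ ⟨i, Finset.mem_univ i⟩, (hσ0 _).1⟩,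
        fun i j h => by
        simpa using hσ (Subtype.ext_iff.1 h)⟩
      refine le_trans (le_of_eq ?_) (Finset.le_sup (Finset.mem_univ τ))
      exact (Finset.sum_eq_zero fun i _ => (hσ0 ⟨i, Finset.mem_univ i⟩).2).symm
  · rintro ⟨hc, hj⟩
    have hle : ∀ τ : Fin s ↪ {j // j ∈ Y}, ∑ i, A i (τ i) ≤ 0 := by
      intro τ
      rw [← hj]
      exact Finset.le_sup (f := fun σ : Fin s ↪ {j // j ∈ Y} =>
        ∑ i, (A.submatrix id (Subtype.val : {j // j ∈ Y} → Fin n)) i (σ i)) (Finset.mem_univ τ)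
    refine ⟨by simpa using hc, ?_, fun τ hτ hτY i => ?_⟩
    · have hne : (Finset.univ : Finset (Fin s ↪ {j // j ∈ Y})).Nonempty := by
        by_contra hne
        rw [Finset.not_nonempty_iff_eq_empty] at hne
        rw [jacobiNumberOn, jacobiNumber, hne, Finset.sup_empty] at hj
        exact absurd hj (by simp)
      obtain ⟨τ, -, hτ⟩ := Finset.exists_mem_eq_sup _ hne fun σ : Fin s ↪ {j // j ∈ Y} =>
        ∑ i, (A.submatrix id (Subtype.val : {j // j ∈ Y} → Fin n)) i (σ i)
      rw [jacobiNumberOn, jacobiNumber, hτ] at hj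
      have h1 := WithBot.ne_bot_of_sum_ne_bot (by rw [hj]; simp)
      have h2 := WithBot.sum_le_zero h1 hj.le
      exact ⟨fun i => τ i.1, fun i j h => Subtype.ext (τ.injective (Subtype.ext h)),
        fun i => ⟨(τ i.1).2, h2 i.1 (Finset.mem_univ _)⟩⟩
    · let τ' : Fin s ↪ {j // j ∈ Y} := ⟨fun i => ⟨τ ⟨i, Finset.mem_univ i⟩, (hτY _).1⟩,
        fun i j h => by
        simpa using hτ (Subtype.ext_iff.1 h)⟩
      exact WithBot.sum_le_zero (fun i _ => (hτY ⟨i, Finset.mem_univ i⟩).2) (hle τ') i.1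
        (Finset.mem_univ _)

/-- Finite values of `jacobiNumberOn` are nonnegative, so a single `Y` of value `0` attains the
minimum. -/
theorem saddleJacobiNumber_eq_zero_iff :
    saddleJacobiNumber A = 0 ↔ ∃ Y, IsZeroBlock A Finset.univ Y := by
  simp only [isZeroBlock_univ_iff]
  rw [saddleJacobiNumber]
  have hmem : ∀ Y, Y ∈ finiteColumnSets A ↔ Y.card = s ∧ jacobiNumberOn A Y ≠ ⊥ := by
    intro Y
    simp [finiteColumnSets]
  constructor
  · intro h
    split_ifs at h with hne
    · obtain ⟨Y, hY, he⟩ := Finset.exists_mem_eq_inf' hne (jacobiNumberOn A)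
      exact ⟨Y, ((hmem Y).1 hY).1, he ▸ h⟩
    · exact absurd h (by simp)
  · rintro ⟨Y, hc, hj⟩
    have hY : Y ∈ finiteColumnSets A := (hmem Y).2 ⟨hc, by rw [hj]; simp⟩
    rw [dif_pos ⟨Y, hY⟩]
    refine le_antisymm (hj ▸ Finset.inf'_le _ hY) (Finset.le_inf' _ _ fun Y' hY' => ?_)
    exact WithBot.nonneg_of_ne_bot ((hmem Y').1 hY').2

end Jacobi

/-! ### The effect of one step of the algorithm on zero blocks -/

section Run

variable {s n : ℕ} {A : Matrix (Fin s) (Fin n) (WithBot ℕ)} {R R₀ : Finset (Fin s)}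
  {B C C' C₀ Y Y₁ Y₂ : Finset (Fin n)}

theorem IsZeroBlock.exists_surj (h : IsZeroBlock A R Y) :
    ∃ σ : R → Fin n, Function.Injective σ ∧ (∀ i, σ i ∈ Y ∧ A i (σ i) = 0) ∧
      ∀ j ∈ Y, ∃ i, σ i = j := by
  obtain ⟨σ, hσ, hσ0⟩ := h.exists_zero
  refine ⟨σ, hσ, hσ0, fun j hj => ?_⟩
  have : Finset.univ.image σ = Y := by
    apply Finset.eq_of_subset_of_card_le
    · intro j hj
      obtain ⟨i, -, rfl⟩ := Finset.mem_image.1 hj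
      exact (hσ0 i).1
    · rw [Finset.card_image_of_injective _ hσ, h.card_eq]
      simp
  rw [← this] at hj
  obtain ⟨i, -, rfl⟩ := Finset.mem_image.1 hj
  exact ⟨i, rfl⟩

theorem IsZeroBlock.subset_liveColumns (h : IsZeroBlock A R Y) (hY : Y ⊆ C) :
    Y ⊆ liveColumns A R C := by
  obtain ⟨σ, -, hσ0, hsurj⟩ := h.exists_surj
  intro j hj
  obtain ⟨i, rfl⟩ := hsurj j hj
  exact Finset.mem_filter.2 ⟨hY hj, i, i.2, by rw [(hσ0 i).2]; simp⟩

theorem IsZeroBlock.not_obviousFailure (h : IsZeroBlock A R Y) (hY : Y ⊆ C) :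
    ¬ ObviousFailure A R C := by
  obtain ⟨σ, -, hσ0⟩ := h.exists_zero
  rintro (hlt | ⟨i, hi, h0⟩)
  · have := Finset.card_le_card hY
    have := h.card_eq
    omega
  · exact h0 _ (hY (hσ0 ⟨i, hi⟩).1) (hσ0 ⟨i, hi⟩).2

/-- The rows and columns that do not belong to the others in a zero block form again such a
block. -/
theorem IsZeroBlock.sdiff (h : IsZeroBlock A R Y) (R₀ : Finset (Fin s)) :
    ∃ Y' ⊆ Y, IsZeroBlock A (R \ R₀) Y' := by
  classical
  obtain ⟨σ, hσ, hσ0⟩ := h.exists_zero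
  let inc : ↥(R \ R₀) → R := fun i => ⟨i.1, (Finset.mem_sdiff.1 i.2).1⟩
  have hinc : Function.Injective inc := fun i j hij => Subtype.ext (congrArg (fun k : R => k.1) hij)
  refine ⟨Finset.univ.image (σ ∘ inc), ?_, ?_, ⟨σ ∘ inc, hσ.comp hinc, fun i =>
    ⟨Finset.mem_image_of_mem _ (Finset.mem_univ i), (hσ0 (inc i)).2⟩⟩, fun τ hτ hτ0 i => ?_⟩
  · intro j hj
    obtain ⟨i, -, rfl⟩ := Finset.mem_image.1 hj
    exact (hσ0 _).1
  · rw [Finset.card_image_of_injective _ (hσ.comp hinc)]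
    simp
  · have hval : ∀ i, ∃ k, σ (inc k) = τ i := by
      intro i
      obtain ⟨k, -, hk⟩ := Finset.mem_image.1 (hτ0 i).1
      exact ⟨k, hk⟩
    -- A finite transversal of the smaller block is completed by `σ` on the suppressed rows. It
    -- stays injective because `τ` takes its values in the columns that `σ` assigns to the other
    -- rows.
    let τ' : R → Fin n := fun i =>
      if hi : i.1 ∈ R \ R₀ then τ ⟨i.1, hi⟩ else σ i
    have key := h.all_zero τ' ?_ ?_ (inc i)
    · have : (inc i).1 ∈ R \ R₀ := i.2
      simp only [τ', dif_pos this] at key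
      exact key
    · intro x y hxy
      by_cases hx : x.1 ∈ R \ R₀ <;> by_cases hy : y.1 ∈ R \ R₀
      · simp only [τ', dif_pos hx, dif_pos hy] at hxy
        exact Subtype.ext (Subtype.mk.inj (hτ hxy))
      · simp only [τ', dif_pos hx, dif_neg hy] at hxy
        obtain ⟨k, hk⟩ := hval ⟨x.1, hx⟩
        have := hσ (hk.trans hxy)
        exact absurd (this ▸ k.2) hy
      · simp only [τ', dif_neg hx, dif_pos hy] at hxy
        obtain ⟨k, hk⟩ := hval ⟨y.1, hy⟩
        have := hσ (hk.trans hxy.symm)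
        exact absurd (this ▸ k.2) hx
      · simp only [τ', dif_neg hx, dif_neg hy] at hxy
        exact hσ hxy
    · intro x
      by_cases hx : x.1 ∈ R \ R₀
      · simp only [τ', dif_pos hx]
        obtain ⟨k, hk⟩ := hval ⟨x.1, hx⟩
        exact ⟨hk ▸ (hσ0 _).1, (hτ0 ⟨x.1, hx⟩).2⟩
      · simp only [τ', dif_neg hx]
        exact ⟨(hσ0 x).1, by rw [(hσ0 x).2]; simp⟩

/-- The columns `Y₁` are perfectly matched with the rows `R₀`, and have no other zeros. -/
theorem IsHKOutput.zeros (h : IsHKOutput A R B R₀ C₀ Y₁) :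
    R₀ ⊆ R ∧ Y₁ ⊆ B ∧ Y₁.card = R₀.card ∧ (∀ j ∈ Y₁, ∀ i ∈ R, A i j = 0 → i ∈ R₀) ∧
      ∃ σ : R₀ → Fin n, Function.Injective σ ∧ ∀ i, σ i ∈ Y₁ ∧ A i (σ i) = 0 := by
  classical
  obtain ⟨⟨hR, hC, hcov, hcard⟩, -, M, hM, hMc, rfl⟩ := h
  obtain ⟨h1, h2, -⟩ := (hM.of_cover hcov).2 (hcard.trans hMc.symm)
  choose f hf hf1 using h2
  have hfinj : Function.Injective fun i : R₀ => (f i.1 i.2).2 := by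
    intro i j hij
    have := hM.2.2 _ (hf i.1 i.2) _ (hf j.1 j.2) hij
    apply Subtype.ext
    rw [← hf1 i.1 i.2, ← hf1 j.1 j.2, this]
  have hfY : ∀ i : R₀, (f i.1 i.2).2 ∈ M.image Prod.snd \ C₀ := fun i =>
    Finset.mem_sdiff.2 ⟨Finset.mem_image_of_mem _ (hf _ _),
      h1 _ (hf _ _) (by rw [hf1]; exact i.2)⟩
  have himg : Finset.univ.image (fun i : R₀ => (f i.1 i.2).2) = M.image Prod.snd \ C₀ := by
    ext j
    constructor
    · intro hj
      obtain ⟨i, -, rfl⟩ := Finset.mem_image.1 hj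
      exact hfY i
    · intro hj
      obtain ⟨hj1, hj2⟩ := Finset.mem_sdiff.1 hj
      obtain ⟨x, hx, rfl⟩ := Finset.mem_image.1 hj1
      obtain ⟨a, b, c⟩ := hM.1 x hx
      have hx1 := (hcov _ a _ b c).resolve_right hj2
      refine Finset.mem_image.2 ⟨⟨x.1, hx1⟩, Finset.mem_univ _, ?_⟩
      rw [hM.2.1 _ (hf x.1 hx1) x hx (hf1 _ _)]
  refine ⟨hR, fun j hj => ?_, ?_, fun j hj i hi h0 => ?_, fun i => (f i.1 i.2).2, hfinj,
    fun i => ⟨hfY i, ?_⟩⟩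
  · obtain ⟨x, hx, rfl⟩ := Finset.mem_image.1 (Finset.mem_sdiff.1 hj).1
    exact (hM.1 x hx).2.1
  · rw [← himg, Finset.card_image_of_injective _ hfinj]
    simp
  · obtain ⟨hj1, hj2⟩ := Finset.mem_sdiff.1 hj
    obtain ⟨x, hx, rfl⟩ := Finset.mem_image.1 hj1
    exact (hcov i hi _ (hM.1 x hx).2.1 h0).resolve_right hj2
  · have := (hM.1 _ (hf i.1 i.2)).2.2
    rwa [hf1] at this

/-- On `Y₁` finite entries are zeros, and these zeros are in `R₀`. By counting, a finite transversal
matches `R₀` with `Y₁`, and so restricts to a finite transversal of the block `Y₂`. -/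
theorem IsZeroBlock.union (h : IsZeroBlock A (R \ R₀) Y₂)
    (hHK : IsHKOutput A R (flatColumns A R C') R₀ C₀ Y₁) : IsZeroBlock A R (Y₂ ∪ Y₁) := by
  classical
  obtain ⟨hR, hB, hc1, hz1, σ₁, hσ₁, hσ₁0⟩ := hHK.zeros
  obtain ⟨σ₂, hσ₂, hσ₂0, hsurj⟩ := h.exists_surj
  have hdisj : Disjoint Y₂ Y₁ := by
    rw [Finset.disjoint_left]
    intro j hj2 hj1
    obtain ⟨i, rfl⟩ := hsurj j hj2
    obtain ⟨h1, h2⟩ := Finset.mem_sdiff.1 i.2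
    exact h2 (hz1 _ hj1 _ h1 (hσ₂0 i).2)
  have hcard : (Y₂ ∪ Y₁).card = R.card := by
    rw [Finset.card_union_of_disjoint hdisj, h.card_eq, hc1, Finset.card_sdiff_add_card_eq_card hR]
  refine ⟨hcard, ⟨fun i => if hi : i.1 ∈ R₀ then σ₁ ⟨i.1, hi⟩ else
    σ₂ ⟨i.1, Finset.mem_sdiff.2 ⟨i.2, hi⟩⟩, ?_, fun i => ?_⟩, fun τ hτ hτ0 => ?_⟩
  · intro x y hxy
    by_cases hx : x.1 ∈ R₀ <;> by_cases hy : y.1 ∈ R₀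
    · simp only [dif_pos hx, dif_pos hy] at hxy
      exact Subtype.ext (Subtype.mk.inj (hσ₁ hxy))
    · simp only [dif_pos hx, dif_neg hy] at hxy
      exact absurd (hxy ▸ (hσ₁0 ⟨x.1, hx⟩).1) (Finset.disjoint_left.1 hdisj (hσ₂0 _).1)
    · simp only [dif_neg hx, dif_pos hy] at hxy
      exact absurd (hxy ▸ (hσ₁0 ⟨y.1, hy⟩).1) (Finset.disjoint_left.1 hdisj (hσ₂0 _).1)
    · simp only [dif_neg hx, dif_neg hy] at hxy
      exact Subtype.ext (Subtype.mk.inj (hσ₂ hxy))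
  · by_cases hi : i.1 ∈ R₀
    · simp only [dif_pos hi]
      exact ⟨Finset.mem_union_right _ (hσ₁0 ⟨i.1, hi⟩).1, (hσ₁0 ⟨i.1, hi⟩).2⟩
    · simp only [dif_neg hi]
      exact ⟨Finset.mem_union_left _ (hσ₂0 _).1, (hσ₂0 ⟨i.1, Finset.mem_sdiff.2 ⟨i.2, hi⟩⟩).2⟩
  · have hflat : ∀ i : R, τ i ∈ Y₁ → A i (τ i) = 0 := fun i hi =>
      ((Finset.mem_filter.1 (hB hi)).2 i.1 i.2).resolve_left (hτ0 i).2
    -- The rows sent into `Y₁` belong to `R₀`; since every column of `Y₁` is reached and the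
    -- cardinalities agree, they are all the rows of `R₀`.
    have hback : ∀ i : R, i.1 ∈ R₀ → τ i ∈ Y₁ := by
      have himg : Finset.univ.image τ = Y₂ ∪ Y₁ := by
        apply Finset.eq_of_subset_of_card_le
        · intro j hj
          obtain ⟨i, -, rfl⟩ := Finset.mem_image.1 hj
          exact (hτ0 i).1
        · rw [Finset.card_image_of_injective _ hτ, hcard]
          simp
      have hsub : (Finset.univ.filter fun i : R => τ i ∈ Y₁) ⊆
          Finset.univ.filter fun i : R => i.1 ∈ R₀ := by
        intro i hi
        rw [Finset.mem_filter] at hi ⊢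
        exact ⟨hi.1, hz1 _ hi.2 _ i.2 (hflat i hi.2)⟩
      have h1 : (Finset.univ.filter fun i : R => i.1 ∈ R₀).card ≤ R₀.card := by
        apply Finset.card_le_card_of_injOn Subtype.val
        · intro i hi
          simpa using hi
        · exact Subtype.val_injective.injOn
      have h2 : Y₁.card ≤ (Finset.univ.filter fun i : R => τ i ∈ Y₁).card := by
        refine le_trans (Finset.card_le_card ?_)
          (Finset.card_image_le (f := τ) (s := Finset.univ.filter fun i : R => τ i ∈ Y₁))
        intro j hj
        have : j ∈ Finset.univ.image τ := by
          rw [himg]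
          exact Finset.mem_union_right _ hj
        obtain ⟨i, -, rfl⟩ := Finset.mem_image.1 this
        exact Finset.mem_image_of_mem _ (Finset.mem_filter.2 ⟨Finset.mem_univ _, hj⟩)
      have he := Finset.eq_of_subset_of_card_le hsub (by omega)
      intro i hi
      have : i ∈ Finset.univ.filter fun i : R => τ i ∈ Y₁ := by
        rw [he]
        simpa using hi
      exact (Finset.mem_filter.1 this).2
    intro i
    by_cases hi : τ i ∈ Y₁
    · exact hflat i hi
    · have hi0 : i.1 ∉ R₀ := fun hh => hi (hback i hh)
      refine h.all_zero (fun k => τ ⟨k.1, (Finset.mem_sdiff.1 k.2).1⟩) ?_ ?_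
        ⟨i.1, Finset.mem_sdiff.2 ⟨i.2, hi0⟩⟩
      · intro x y hxy
        exact Subtype.ext (Subtype.mk.inj (hτ hxy))
      · intro k
        refine ⟨?_, (hτ0 ⟨k.1, (Finset.mem_sdiff.1 k.2).1⟩).2⟩
        refine (Finset.mem_union.1 (hτ0 _).1).resolve_right fun hk => ?_
        exact (Finset.mem_sdiff.1 k.2).2 (hz1 _ hk _ (Finset.mem_sdiff.1 k.2).1 (hflat _ hk))

/-- In a zero block, there are rows whose zeros of a transversal family are in columns that contain
only zeros, which are in these rows, and `-∞`. -/
theorem IsZeroBlock.exists_flat (h : IsZeroBlock A R Y) (hR : R.Nonempty) {σ : R → Fin n}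
    (hσ : Function.Injective σ) (hσ0 : ∀ i, σ i ∈ Y ∧ A i (σ i) = 0) :
    ∃ S : Finset R, S.Nonempty ∧
      ∀ y ∈ S, ∀ x : R, A x (σ y) ≠ ⊥ → x ∈ S ∧ A x (σ y) = 0 := by
  classical
  -- In the digraph with an arc from `x` to `y` when `A x (σ y)` is finite, these are the nonempty
  -- sets closed under predecessors. One of minimal size is the required `S`.
  let F : Finset (Finset R) := Finset.univ.filter fun S => S.Nonempty ∧
    ∀ y ∈ S, ∀ x : R, A x (σ y) ≠ ⊥ → x ∈ S
  have hF : F.Nonempty := by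
    obtain ⟨i, hi⟩ := hR
    exact ⟨Finset.univ, by simp only [F, Finset.mem_filter]; exact
      ⟨Finset.mem_univ _, ⟨⟨i, hi⟩, Finset.mem_univ _⟩, fun _ _ _ _ => Finset.mem_univ _⟩⟩
  obtain ⟨S, hS, hmin⟩ := Finset.exists_min_image F Finset.card hF
  simp only [F, Finset.mem_filter, Finset.mem_univ, true_and] at hS hmin
  obtain ⟨hne, hpre⟩ := hS
  refine ⟨S, hne, fun y hy x hx => ⟨hpre y hy x hx, ?_⟩⟩
  have hdiag : ∀ x : R, A x (σ x) ≠ ⊥ := fun x => by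
    rw [(hσ0 x).2]
    simp
  by_contra hx0
  let N : {z : R // z ≠ x} → Finset R := fun z =>
    Finset.univ.filter fun w => w ≠ y ∧ A z.1 (σ w) ≠ ⊥
  -- If `A x (σ y)` is finite and nonzero, Hall's condition for the other rows and columns would
  -- complete this entry to a finite transversal, contrary to the definition of a zero block.
  by_cases hall : ∀ T : Finset {z : R // z ≠ x}, T.card ≤ (T.biUnion N).card
  · obtain ⟨f, hf, hfN⟩ := (Finset.all_card_le_biUnion_card_iff_exists_injective N).1 hall
    simp only [N, Finset.mem_filter, Finset.mem_univ, true_and] at hfN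
    have key := h.all_zero (fun z => if hz : z = x then σ y else σ (f ⟨z, hz⟩)) ?_ ?_ x
    · rw [dif_pos rfl] at key
      exact hx0 key
    · intro z w hzw
      by_cases hz : z = x <;> by_cases hw : w = x
      · rw [hz, hw]
      · simp only [dif_pos hz, dif_neg hw] at hzw
        exact absurd (hσ hzw).symm (hfN _).1
      · simp only [dif_neg hz, dif_pos hw] at hzw
        exact absurd (hσ hzw) (hfN _).1
      · simp only [dif_neg hz, dif_neg hw] at hzw
        exact Subtype.ext_iff.1 (hf (hσ hzw))
    · intro z
      by_cases hz : z = x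
      · simp only [dif_pos hz]
        exact ⟨(hσ0 y).1, hz ▸ hx⟩
      · simp only [dif_neg hz]
        exact ⟨(hσ0 _).1, (hfN ⟨z, hz⟩).2⟩
  · push Not at hall
    -- A set `T` violating Hall's condition contains `y`, because `σ` already provides finite
    -- entries on the diagonal. Its neighbours are then exactly `T` without `y`, so `T` is closed
    -- under successors.
    obtain ⟨T, hT⟩ := hall
    let T' : Finset R := T.image Subtype.val
    have hT'c : T'.card = T.card := Finset.card_image_of_injective _ Subtype.val_injective
    have hsub : T'.erase y ⊆ T.biUnion N := by
      intro z hz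
      obtain ⟨hzy, hz⟩ := Finset.mem_erase.1 hz
      obtain ⟨w, hw, rfl⟩ := Finset.mem_image.1 hz
      refine Finset.mem_biUnion.2 ⟨w, hw, ?_⟩
      simp only [N, Finset.mem_filter, Finset.mem_univ, true_and]
      exact ⟨hzy, hdiag _⟩
    have hyT : y ∈ T' := by
      by_contra hyT
      rw [Finset.erase_eq_of_notMem hyT] at hsub
      have := Finset.card_le_card hsub
      omega
    have heq : T'.erase y = T.biUnion N := by
      apply Finset.eq_of_subset_of_card_le hsub
      rw [Finset.card_erase_of_mem hyT]
      omega
    have hsucc : ∀ z ∈ T', ∀ w : R, A z (σ w) ≠ ⊥ → w ∈ T' := by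
      intro z hz w hw
      by_cases hwy : w = y
      · rwa [hwy]
      · obtain ⟨v, hv, rfl⟩ := Finset.mem_image.1 hz
        have : w ∈ T'.erase y := by
          rw [heq]
          refine Finset.mem_biUnion.2 ⟨v, hv, ?_⟩
          simp only [N, Finset.mem_filter, Finset.mem_univ, true_and]
          exact ⟨hwy, hw⟩
        exact (Finset.mem_erase.1 this).2
    have hxT : x ∉ T' := by
      intro hxT
      obtain ⟨v, -, hv⟩ := Finset.mem_image.1 hxT
      exact v.2 hv
    -- Removing a set closed under successors leaves a set closed under predecessors; it contains
    -- `x` but not `y`, against the minimality of `S`.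
    have hle := hmin (S \ T') ⟨⟨x, Finset.mem_sdiff.2 ⟨hpre y hy x hx, hxT⟩⟩, fun w hw z hz => by
      obtain ⟨hw1, hw2⟩ := Finset.mem_sdiff.1 hw
      exact Finset.mem_sdiff.2 ⟨hpre w hw1 z hz, fun hzT => hw2 (hsucc z hzT w hz)⟩⟩
    have hlt : (S \ T').card < S.card := by
      apply Finset.card_lt_card
      rw [Finset.ssubset_iff_of_subset Finset.sdiff_subset]
      exact ⟨y, hy, fun hh => (Finset.mem_sdiff.1 hh).2 hyT⟩
    omega

/-- For the set `S` of `exists_flat`, the columns `σ S` have all their zeros in the rows `S`, so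
these rows may replace these columns in the cover. A row of `S` outside `R₀` has its column in `C₀`,
hence the exchange does not increase the size. The maximality of `R₀` then gives `S ⊆ R₀`. -/
theorem IsZeroBlock.nonempty_of_isHKOutput (h : IsZeroBlock A R Y) (hR : R.Nonempty)
    (hY : Y ⊆ C') (hHK : IsHKOutput A R (flatColumns A R C') R₀ C₀ Y₁) : R₀.Nonempty := by
  classical
  obtain ⟨σ, hσ, hσ0⟩ := h.exists_zero
  obtain ⟨S, ⟨x, hx⟩, hS⟩ := h.exists_flat hR hσ hσ0
  obtain ⟨⟨hR₀, hC₀, hcov, hcard⟩, hmax, -⟩ := hHK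
  set S' : Finset (Fin s) := S.image Subtype.val with hS'
  set T : Finset (Fin n) := S.image σ with hT
  have hflat : ∀ y ∈ S, σ y ∈ flatColumns A R C' := by
    intro y hy
    refine Finset.mem_filter.2 ⟨hY (hσ0 y).1, fun i hi => ?_⟩
    by_cases hb : A i (σ y) = ⊥
    · exact Or.inl hb
    · exact Or.inr (hS y hy ⟨i, hi⟩ hb).2
  have hcov' : ∀ i ∈ R, ∀ j ∈ flatColumns A R C', A i j = 0 → i ∈ R₀ ∪ S' ∨ j ∈ C₀ \ T := by
    intro i hi j hj h0
    by_cases hjT : j ∈ T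
    · obtain ⟨y, hy, rfl⟩ := Finset.mem_image.1 hjT
      have := (hS y hy ⟨i, hi⟩ (by rw [h0]; simp)).1
      exact Or.inl (Finset.mem_union_right _ (Finset.mem_image_of_mem Subtype.val this))
    · rcases hcov i hi j hj h0 with h1 | h1
      · exact Or.inl (Finset.mem_union_left _ h1)
      · exact Or.inr (Finset.mem_sdiff.2 ⟨h1, hjT⟩)
  have hle : (R₀ ∪ S').card + (C₀ \ T).card ≤ R₀.card + C₀.card := by
    have h1 : (S' \ R₀).card ≤ (C₀ ∩ T).card := by
      have h2 : (S' \ R₀).card ≤ (S.filter fun y => y.1 ∉ R₀).card := by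
        refine le_trans (Finset.card_le_card ?_)
          (Finset.card_image_le (f := Subtype.val) (s := S.filter fun y => y.1 ∉ R₀))
        intro i hi
        obtain ⟨h3, h4⟩ := Finset.mem_sdiff.1 hi
        obtain ⟨y, hy, rfl⟩ := Finset.mem_image.1 h3
        exact Finset.mem_image_of_mem _ (Finset.mem_filter.2 ⟨hy, h4⟩)
      refine h2.trans (Finset.card_le_card_of_injOn σ ?_ hσ.injOn)
      intro y hy
      simp only [Finset.coe_filter, Set.mem_ofPred_eq] at hy
      have := (hcov y.1 y.2 _ (hflat y hy.1) (hσ0 y).2).resolve_left hy.2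
      exact Finset.mem_coe.2 (Finset.mem_inter.2 ⟨this, Finset.mem_image_of_mem _ hy.1⟩)
    have h3 : (R₀ ∪ S').card = R₀.card + (S' \ R₀).card := by
      rw [← Finset.union_sdiff_self_eq_union, Finset.card_union_of_disjoint Finset.disjoint_sdiff]
    have h4 := Finset.card_sdiff_add_card_inter C₀ T
    omega
  have hge := maxTransversalZeros_le_of_cover hcov'
  have hmin : IsMinZeroCover A R (flatColumns A R C') (R₀ ∪ S') (C₀ \ T) := by
    refine ⟨Finset.union_subset hR₀ ?_, Finset.sdiff_subset.trans hC₀, hcov', by omega⟩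
    intro i hi
    obtain ⟨y, -, rfl⟩ := Finset.mem_image.1 hi
    exact y.2
  exact ⟨x.1, (hmax _ _ hmin).1
    (Finset.mem_union_right _ (Finset.mem_image_of_mem Subtype.val hx))⟩

/-- Success and failure are treated in one induction: `union` makes a block of the returned set, and
by `sdiff` a block for the present call would give one for a recursive call that fails. Suppressing
columns loses no block, since each column of a block contains a zero. -/
theorem OTestRun.correct {p : ℕ} {tr : List (HKCall s n)} {res : Option (Finset (Fin n))}
    (h : OTestRun A R C p tr res) :
    (∀ Y, res = some Y → Y ⊆ C ∧ IsZeroBlock A R Y) ∧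
      (res = none → ∀ Y ⊆ C, ¬ IsZeroBlock A R Y) := by
  induction h with
  | empty C =>
    refine ⟨fun Y hY => ?_, fun h => by simp at h⟩
    obtain rfl : ∅ = Y := by simpa using hY
    exact ⟨Finset.empty_subset _, rfl, ⟨fun i => absurd i.2 (Finset.notMem_empty _),
      fun i => absurd i.2 (Finset.notMem_empty _), fun i => absurd i.2 (Finset.notMem_empty _)⟩,
      fun τ _ _ i => absurd i.2 (Finset.notMem_empty _)⟩
  | obvious R C hR hf =>
    exact ⟨fun Y hY => by simp at hY, fun _ Y hY h => h.not_obviousFailure hY hf⟩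
  | stuck R C C' B C₀ Y₁ hR hf hC' hB hHK =>
    subst hC' hB
    refine ⟨fun Y hY => by simp at hY, fun _ Y hY h => ?_⟩
    exact absurd (h.nonempty_of_isHKOutput hR (h.subset_liveColumns hY) hHK) (by simp)
  | step R C C' B R₀ C₀ Y₁ p tr res hR hf hC' hB hHK hR₀ hrec ih =>
    subst hC' hB
    refine ⟨fun Y hY => ?_, fun hn Y hY h => ?_⟩
    · obtain ⟨Y₂, hY₂, rfl⟩ := Option.map_eq_some_iff.1 hY
      obtain ⟨h1, h2⟩ := ih.1 Y₂ hY₂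
      refine ⟨Finset.union_subset (h1.trans (Finset.filter_subset _ _)) ?_, h2.union hHK⟩
      exact hHK.zeros.2.1.trans ((Finset.filter_subset _ _).trans (Finset.filter_subset _ _))
    · obtain ⟨Y', hY', h'⟩ := h.sdiff R₀
      exact ih.2 (by simpa using hn) Y' (hY'.trans (h.subset_liveColumns hY)) h'

theorem exists_oTestRun (A : Matrix (Fin s) (Fin n) (WithBot ℕ)) (R : Finset (Fin s))
    (C : Finset (Fin n)) : ∃ p tr res, OTestRun A R C p tr res := by
  induction hk : R.card using Nat.strong_induction_on generalizing R C with
  | _ k ih =>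
    rcases R.eq_empty_or_nonempty with rfl | hR
    · exact ⟨_, _, _, .empty C⟩
    · by_cases hf : ObviousFailure A R C
      · exact ⟨_, _, _, .obvious R C hR hf⟩
      · obtain ⟨R₀, C₀, Y₁, hHK⟩ :=
          exists_isHKOutput A R (flatColumns A R (liveColumns A R C))
        rcases R₀.eq_empty_or_nonempty with rfl | hR₀
        · exact ⟨_, _, _, .stuck R C _ _ C₀ Y₁ hR hf rfl rfl hHK⟩
        · have hlt : (R \ R₀).card < k := by
            rw [← hk]
            apply Finset.card_lt_card
            exact Finset.sdiff_ssubset hHK.zeros.1 hR₀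
          obtain ⟨p, tr, res, h⟩ := ih _ hlt (R \ R₀) (liveColumns A R C) rfl
          exact ⟨_, _, _, .step R C _ _ R₀ C₀ Y₁ p tr res hR hf rfl rfl hHK hR₀ h⟩

theorem OTestRun.correct_univ {p : ℕ} {tr : List (HKCall s n)} {res : Option (Finset (Fin n))}
    (h : OTestRun A Finset.univ Finset.univ p tr res) :
    (res.isSome ↔ saddleJacobiNumber A = 0) ∧
      ∀ Y, res = some Y → Y.card = s ∧ jacobiNumberOn A Y = 0 := by
  obtain ⟨h1, h2⟩ := h.correct
  refine ⟨?_, fun Y hY => isZeroBlock_univ_iff.1 (h1 Y hY).2⟩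
  rw [saddleJacobiNumber_eq_zero_iff]
  constructor
  · intro hs
    obtain ⟨Y, hY⟩ := Option.isSome_iff_exists.1 hs
    exact ⟨Y, (h1 Y hY).2⟩
  · rintro ⟨Y, hY⟩
    by_contra hn
    exact h2 (by simpa using hn) Y (Finset.subset_univ _) hY

end Run


/-! ### The program -/

notation "vRem" => 19
notation "vCC" => 20
notation "vRun" => 21
notation "vRes" => 22
notation "vOk" => 23
notation "vK" => 24
notation "vJ" => 25
notation "vNr" => 26
notation "vZ" => 27

notation "aList" => 12
notation "aDel" => 13
notation "aFin" => 14
notation "aPos" => 15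

/-- Adds `d` to the counters `aFin` of the finite entries and `aPos` of the positive entries, in
the columns where the row `vI` has such an entry; `vZ` tells if the row contains a zero. -/
def updateRow (d : ℤ) : Prog :=
  .assign vZ (.const 0) ;;
  .forTo vJ vN
    (.ite (.le (.const 0) (.arr 0 ‵vI ‵vJ))
      (.store aFin (.const 0) ‵vJ (.add (.cell aFin ‵vJ) (.const d)) ;;
        .ite (.eq (.arr 0 ‵vI ‵vJ) (.const 0))
          (.assign vZ (.const 1))
          (.store aPos (.const 0) ‵vJ (.add (.cell aPos ‵vJ) (.const d))))
      .skip)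

/-- Initializes the counters; `vOk` tells if every row contains a zero. -/
def countRows : Prog :=
  .assign vOk (.const 1) ;;
  .forTo vI vS (updateRow 1 ;; .ite (.eq ‵vZ (.const 0)) (.assign vOk (.const 0)) .skip)

/-- Counts in `vCC` the columns that are not entirely `-∞`, and lists in `aList` those that contain
only `-∞` or `0`, in number `vB`. -/
def collectColumns : Prog :=
  .assign vCC (.const 0) ;; .assign vB (.const 0) ;;
  .forTo vJ vN
    (.ite (.le (.const 1) (.cell aFin ‵vJ))
      (.incr vCC ;;
        .ite (.eq (.cell aPos ‵vJ) (.const 0))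
          (.store aList (.const 0) ‵vB ‵vJ ;; .incr vB)
          .skip)
      .skip)

/-- Writes in `aG` the zeros of the matrix on which HK is called. -/
def buildGraph : Prog :=
  .forTo vI vS (.forTo vQ vB
    (.ite (.and (.eq (.cell aDel ‵vI) (.const 0))
        (.eq (.arr 0 ‵vI (.cell aList ‵vQ)) (.const 0)))
      (.store aG ‵vI ‵vQ (.const 1))
      (.store aG ‵vI ‵vQ (.const 0))))

/-- Records the rows `R₀` and suppresses them; `vNr` is their number. -/
def recordRows : Prog :=
  .assign vNr (.const 0) ;;
  .forTo vI vS
    (.ite (.and (.not (.eq (.cell aRow ‵vI) (.const (-1))))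
        (.eq (.cell aVis (.cell aRow ‵vI)) (.const 0)))
      (.store 1 ‵vK ‵vI (.const 1) ;; .store aDel (.const 0) ‵vI (.const 1) ;; .incr vNr ;;
        updateRow (-1))
      .skip)

/-- Records the columns `C₀` and `Y₁`. -/
def recordColumns : Prog :=
  .forTo vQ vB
    (.ite (.eq (.cell aVis ‵vQ) (.const 0))
      (.ite (.eq (.cell aCol ‵vQ) (.const (-1)))
        .skip
        (.store 3 ‵vK (.cell aList ‵vQ) (.const 1) ;;
          .store 4 (.const 0) (.cell aList ‵vQ) (.const 1)))
      (.store 2 ‵vK (.cell aList ‵vQ) (.const 1)))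

/-- One call of HK. -/
def hkCall : Prog :=
  collectColumns ;; buildGraph ;; maxMatching ;; recordRows ;; recordColumns ;;
  .assign vRem (.sub ‵vRem ‵vNr) ;; .incr vK ;;
  .ite (.eq ‵vNr (.const 0)) (.assign vRun (.const 0)) .skip

/-- The successive calls of Ō-test. -/
def mainLoop : Prog :=
  .loop (.eq ‵vRun (.const 1))
    (.ite (.eq ‵vRem (.const 0)) (.assign vRun (.const 0) ;; .assign vRes (.const 1))
      (.ite (.lt ‵vCC ‵vRem) (.assign vRun (.const 0)) hkCall))

/-- An implementation of Ō-test. -/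
def oTest : Prog :=
  .ite (.eq ‵vS (.const 0)) (.assign 0 (.const 1) ;; .assign 1 (.const 0))
    (.ite (.lt ‵vN ‵vS) (.assign 0 (.const 0) ;; .assign 1 (.const 0))
      (countRows ;;
        .ite (.eq ‵vOk (.const 0)) (.assign 0 (.const 0) ;; .assign 1 (.const 0))
          (.assign vRem ‵vS ;; .assign vCC ‵vN ;; .assign vK (.const 0) ;;
            .assign vRun (.const 1) ;; .assign vRes (.const 0) ;; mainLoop ;;
            .assign 0 ‵vRes ;; .assign 1 ‵vK)))

/-! ### Counters -/

theorem exists_fin_eq {n : ℕ} {k : ℤ} (h0 : 0 ≤ k) (h1 : k < n) : ∃ j : Fin n, k = (j : ℕ) :=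
  ⟨⟨k.toNat, by omega⟩, by simp; omega⟩

section Count

variable {s n : ℕ} (A : Matrix (Fin s) (Fin n) (WithBot ℕ)) (R : Finset (Fin s))

/-- The array `0` contains the matrix `A`. -/
def HoldsMatrix (m : Mem) : Prop :=
  ∀ (i : Fin s) (j : Fin n), m.arr 0 (i : ℕ) (j : ℕ) = encodeEntry (A i j)

/-- The number of finite entries in the rows `R` of the column `j`. -/
def countFin (j : Fin n) : ℕ := (R.filter fun i => A i j ≠ ⊥).card

/-- The number of positive entries in the rows `R` of the column `j`. -/
def countPos (j : Fin n) : ℕ := (R.filter fun i => A i j ≠ ⊥ ∧ A i j ≠ 0).card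

/-- The counters have the values that correspond to the rows `R`. -/
def HoldsCounts (m : Mem) : Prop :=
  ∀ j : Fin n, m.arr aFin 0 (j : ℕ) = countFin A R j ∧ m.arr aPos 0 (j : ℕ) = countPos A R j

variable {A R}

theorem encodeEntry_nonneg {x : WithBot ℕ} : 0 ≤ encodeEntry x ↔ x ≠ ⊥ := by
  cases x <;> simp [encodeEntry]

theorem encodeEntry_eq_zero {x : WithBot ℕ} : encodeEntry x = 0 ↔ x = 0 := by
  cases x with
  | bot => simp [encodeEntry]
  | coe k => 
    simp only [encodeEntry]
    norm_cast
    exact WithBot.coe_eq_zero.symm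

theorem holdsMatrix_inputMem : HoldsMatrix A (inputMem A) := by
  intro i j
  simp [inputMem]

theorem countFin_insert {i : Fin s} (hi : i ∉ R) (j : Fin n) :
    countFin A (insert i R) j = countFin A R j + if A i j ≠ ⊥ then 1 else 0 := by
  rw [countFin, countFin, Finset.filter_insert]
  split_ifs with h
  · exact Finset.card_insert_of_notMem fun h => hi (Finset.mem_filter.1 h).1
  · rfl

theorem countPos_insert {i : Fin s} (hi : i ∉ R) (j : Fin n) :
    countPos A (insert i R) j = countPos A R j + if A i j ≠ ⊥ ∧ A i j ≠ 0 then 1 else 0 := by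
  rw [countPos, countPos, Finset.filter_insert]
  split_ifs with h
  · exact Finset.card_insert_of_notMem fun h => hi (Finset.mem_filter.1 h).1
  · rfl

/-- With `d = 1` this counts a row, with `d = -1` it suppresses it. Each row is treated at most
twice in a run, so maintaining the counters costs `O(s n)` altogether. -/
theorem updateRow_spec {m : Mem} {d : ℤ} (hA : HoldsMatrix A m) (hn : m.var vN = n) (i : Fin s)
    (hi : m.var vI = (i : ℕ)) :
    Runs (updateRow d) m fun t m' => t ≤ 40 * (n + 1) ∧
      (∀ j : Fin n, m'.arr aFin 0 (j : ℕ) = m.arr aFin 0 (j : ℕ) + (if A i j ≠ ⊥ then d else 0) ∧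
        m'.arr aPos 0 (j : ℕ) =
          m.arr aPos 0 (j : ℕ) + if A i j ≠ ⊥ ∧ A i j ≠ 0 then d else 0) ∧
      (m'.var vZ = 0 ↔ ∀ j, A i j ≠ 0) := by
  rw [updateRow, Runs.seq_iff, Runs.assign_iff]
  refine (Runs.forTo_intro (c := 30) (fun k m' =>
    (∀ j : Fin n, m'.arr aFin 0 (j : ℕ) =
        m.arr aFin 0 (j : ℕ) + (if ((j : ℕ) : ℤ) < k ∧ A i j ≠ ⊥ then d else 0) ∧
      m'.arr aPos 0 (j : ℕ) = m.arr aPos 0 (j : ℕ) +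
        if ((j : ℕ) : ℤ) < k ∧ A i j ≠ ⊥ ∧ A i j ≠ 0 then d else 0) ∧
      (m'.var vZ = 0 ↔ ∀ j : Fin n, ((j : ℕ) : ℤ) < k → A i j ≠ 0))
    (n := n) (by simpa using hn) (by decide) rfl rfl ?_ ?_).mono ?_
  · refine ⟨fun j => ?_, ?_⟩
    · simp
    · simp
  · intro k m1 hf hk0 hkn hk hn1 ⟨hI1, hI2⟩
    obtain ⟨l, rfl⟩ := exists_fin_eq hk0 hkn
    have h1 := hf.2 0 rfl
    have h2 := hf.1 vI rfl
    simp [hi] at h1 h2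
    have h3 := hA i l
    have hlt : ∀ j : Fin n, ((j : ℕ) : ℤ) < (l : ℕ) + 1 ↔ ((j : ℕ) : ℤ) < (l : ℕ) ∨ j = l := by
      intro j
      rw [Fin.ext_iff]
      omega
    have hself : ¬ ((l : ℕ) : ℤ) < (l : ℕ) := lt_irrefl _
    have hne : ∀ j : Fin n, ((j : ℕ) : ℤ) = (l : ℕ) ↔ j = l := by
      intro j
      rw [Fin.ext_iff]
      omega
    simp only [Runs.ite_iff, Runs.seq_iff, Runs.store_iff, Runs.assign_iff, Runs.skip_iff]
    refine ⟨fun hfin => ⟨fun h0 => ?_, fun h0 => ?_⟩, fun hfin => ?_⟩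
    · simp [h1, h2, hk, h3, encodeEntry_nonneg] at hfin
      simp [h1, h2, hk, h3, encodeEntry_eq_zero] at h0
      refine ⟨by simp, fun j => ?_, ?_⟩
      · by_cases hj : j = l
        · subst hj
          simp [hk, hI1, h0]
        · simp [hk, hne, hj, hI1, hlt]
      · simp
        exact ⟨l, by omega, h0⟩
    · simp [h1, h2, hk, h3, encodeEntry_nonneg] at hfin
      simp [h1, h2, hk, h3, encodeEntry_eq_zero] at h0
      refine ⟨by simp, fun j => ?_, ?_⟩
      · by_cases hj : j = l
        · subst hj
          simp [hk, hI1, hfin, h0]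
        · simp [hk, hne, hj, hI1, hlt]
      · simp only [Mem.setVar_var, Mem.setArr_var]
        simp only [hlt]
        simp [hI2]
        grind
    · simp [h1, h2, hk, h3, encodeEntry_nonneg] at hfin
      refine ⟨by simp, fun j => ?_, ?_⟩
      · by_cases hj : j = l
        · subst hj
          simp [hI1, hfin]
        · simp [hj, hI1, hlt]
      · have h0 : A i l ≠ 0 := by simp [hfin]
        simp only [Mem.setVar_var]
        simp only [hlt]
        simp [hI2]
        grind
  · rintro t m' ⟨ht, -, hI1, hI2⟩
    refine ⟨by simp; omega, fun j => ?_, ?_⟩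
    · simpa using hI1 j
    · simpa using hI2

end Count


/-! ### The parts of the program -/

/-! ### Initial segments of a finite set, for the invariants of `for` loops -/

section Below

variable {n : ℕ}

/-- The elements of `D` less than `k`. -/
def below (D : Finset (Fin n)) (k : ℤ) : Finset (Fin n) := D.filter fun i => ((i : ℕ) : ℤ) < k

theorem mem_below {D : Finset (Fin n)} {k : ℤ} {i : Fin n} :
    i ∈ below D k ↔ i ∈ D ∧ ((i : ℕ) : ℤ) < k := Finset.mem_filter

theorem below_zero (D : Finset (Fin n)) : below D 0 = ∅ := by
  ext i
  simp [mem_below]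

theorem below_self (D : Finset (Fin n)) : below D n = D := by
  ext i
  simp [mem_below]

theorem notMem_below (D : Finset (Fin n)) (l : Fin n) : l ∉ below D (l : ℕ) := by
  simp [mem_below]

theorem below_succ_of_mem {D : Finset (Fin n)} {l : Fin n} (h : l ∈ D) :
    below D ((l : ℕ) + 1) = insert l (below D (l : ℕ)) := by
  ext i
  rw [Finset.mem_insert, mem_below, mem_below, Fin.ext_iff]
  constructor
  · rintro ⟨h1, h2⟩
    by_cases hi : (i : ℕ) = l
    · exact Or.inl hi
    · exact Or.inr ⟨h1, by omega⟩
  · rintro (h1 | ⟨h1, h2⟩)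
    · exact ⟨(Fin.ext h1 : i = l) ▸ h, by omega⟩
    · exact ⟨h1, by omega⟩

theorem below_succ_of_notMem {D : Finset (Fin n)} {l : Fin n} (h : l ∉ D) :
    below D ((l : ℕ) + 1) = below D (l : ℕ) := by
  ext i
  rw [mem_below, mem_below]
  constructor
  · rintro ⟨h1, h2⟩
    have : (i : ℕ) ≠ l := fun he => h ((Fin.ext he : i = l) ▸ h1)
    exact ⟨h1, by omega⟩
  · rintro ⟨h1, h2⟩
    exact ⟨h1, by omega⟩

end Below

section Parts

variable {s n : ℕ} {A : Matrix (Fin s) (Fin n) (WithBot ℕ)} {R : Finset (Fin s)}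

theorem HoldsCounts.congr {m m' : Mem} (h : HoldsCounts A R m) (h1 : m'.arr aFin = m.arr aFin)
    (h2 : m'.arr aPos = m.arr aPos) : HoldsCounts A R m' := by
  intro j
  rw [h1, h2]
  exact h j

theorem HoldsMatrix.congr {m m' : Mem} (h : HoldsMatrix A m) (h1 : m'.arr 0 = m.arr 0) :
    HoldsMatrix A m' := by
  intro i j
  rw [h1]
  exact h i j

theorem countRows_spec {m : Mem} (hA : HoldsMatrix A m) (hs : m.var vS = s) (hn : m.var vN = n)
    (h0 : HoldsCounts A ∅ m) :
    Runs countRows m fun t m' => t ≤ 70 * ((s + 1) * (n + 1)) ∧ HoldsCounts A Finset.univ m' ∧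
      (m'.var vOk = 0 ↔ ∃ i, ∀ j, A i j ≠ 0) := by
  rw [countRows, Runs.seq_iff, Runs.assign_iff]
  refine (Runs.forTo_intro (c := 40 * (n + 1) + 10) (fun k m' =>
    HoldsCounts A (below Finset.univ k) m' ∧
      (m'.var vOk = 0 ↔ ∃ i : Fin s, ((i : ℕ) : ℤ) < k ∧ ∀ j, A i j ≠ 0))
    (n := s) (by simpa using hs) (by decide) rfl rfl ?_ ?_).mono ?_
  · rw [below_zero]
    refine ⟨h0.congr (by simp) (by simp), ?_⟩
    simp
  · intro k m1 hf hk0 hks hk hs1 ⟨hI1, hI2⟩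
    obtain ⟨l, rfl⟩ := exists_fin_eq hk0 hks
    have h1 := hf.2 0 rfl
    have h2 := hf.1 vN rfl
    simp [hn] at h1 h2
    refine Runs.seq_intro (updateRow_spec (hA.congr h1) h2 l hk) ?_
    rintro t m2 hf2 ⟨ht, hc, hz⟩
    have h3 := hf2.1 vOk rfl
    rw [below_succ_of_mem (Finset.mem_univ l)]
    have hcount : HoldsCounts A (insert l (below Finset.univ ((l : ℕ) : ℤ))) m2 := by
      intro j
      have h4 := hI1 j
      have h5 := hc j
      rw [countFin_insert (notMem_below _ _), countPos_insert (notMem_below _ _), h5.1, h5.2,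
        h4.1, h4.2]
      push_cast
      exact ⟨rfl, rfl⟩
    have hlt : ∀ i : Fin s, ((i : ℕ) : ℤ) < (l : ℕ) + 1 ↔ ((i : ℕ) : ℤ) < (l : ℕ) ∨ i = l := by
      intro j
      rw [Fin.ext_iff]
      omega
    simp only [Runs.ite_iff, Runs.assign_iff, Runs.skip_iff]
    constructor
    · intro hz0
      simp at hz0
      refine ⟨by simp; omega, hcount.congr (by simp) (by simp), ?_⟩
      simp
      exact ⟨l, by omega, hz.1 hz0⟩
    · intro hz0
      simp at hz0
      refine ⟨by simp; omega, hcount.congr (by simp) (by simp), ?_⟩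
      rw [hz] at hz0
      simp only [Mem.setVar_var, hlt]
      simp [h3]
      rw [hI2]
      constructor
      · rintro ⟨i, h1, h2⟩
        exact Or.inl ⟨i, by omega, h2⟩
      · rintro (⟨i, h1, h2⟩ | h2)
        · exact ⟨i, by omega, h2⟩
        · exact absurd h2 hz0
  · rintro t m' ⟨ht, -, hI1, hI2⟩
    rw [below_self] at hI1
    refine ⟨?_, hI1, by simpa using hI2⟩
    simp
    have : 70 * ((s + 1) * (n + 1)) = (40 * (n + 1) + 10 + 9) * s +
      (40 * (n + 1) + (30 * n + 11) * s
      + 30 * (n + 1)) := by ring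
    omega

theorem IsColumnList.push {b : ℕ} {bl : ℤ → ℤ} {S : Finset (Fin n)} (h : IsColumnList b bl S)
    {l : Fin n} (hl : l ∉ S) :
    IsColumnList (b + 1) (Function.update bl b (l : ℕ)) (insert l S) := by
  have hne : ∀ q : ℤ, 0 ≤ q → q < b → bl q ≠ (l : ℕ) := by
    intro q h0 h1 he
    obtain ⟨j, hj, hq⟩ := h.mem q h0 h1
    apply hl
    rwa [show l = j from Fin.ext (by omega)]
  refine ⟨fun q h0 h1 => ?_, fun j hj => ?_, fun q q' h0 h1 h0' h1' he => ?_⟩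
  · rw [Function.update_apply]
    split_ifs with hq
    · exact ⟨l, Finset.mem_insert_self _ _, rfl⟩
    · obtain ⟨j, hj, hq⟩ := h.mem q h0 (by push_cast at h1; omega)
      exact ⟨j, Finset.mem_insert_of_mem hj, hq⟩
  · rcases Finset.mem_insert.1 hj with rfl | hj
    · exact ⟨b, by omega, by omega, by rw [Function.update_self]⟩
    · obtain ⟨q, h0, h1, hq⟩ := h.surj j hj
      exact ⟨q, h0, by omega, by rw [Function.update_of_ne (by omega), hq]⟩
  · rw [Function.update_apply, Function.update_apply] at he
    push_cast at h1 h1'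
    split_ifs at he with g1 g2 g2
    · omega
    · exact absurd he.symm (hne q' h0' (by omega))
    · exact absurd he (hne q h0 (by omega))
    · exact h.inj q q' h0 (by omega) h0' (by omega) he

theorem collectColumns_spec {m : Mem} {L F : Finset (Fin n)} (hn : m.var vN = n)
    (hc : HoldsCounts A R m) (hL : ∀ j, j ∈ L ↔ 1 ≤ countFin A R j)
    (hF : ∀ j, j ∈ F ↔ 1 ≤ countFin A R j ∧ countPos A R j = 0) :
    Runs collectColumns m fun t m' => t ≤ 60 * (n + 1) ∧ m'.var vCC = L.card ∧
      m'.var vB = F.card ∧ IsColumnList F.card (m'.arr aList 0) F := by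
  rw [collectColumns, Runs.seq_iff, Runs.assign_iff, Runs.seq_iff, Runs.assign_iff]
  refine (Runs.forTo_intro (c := 40) (fun k m' => m'.var vCC = (below L k).card ∧
    m'.var vB = (below F k).card ∧
    IsColumnList (below F k).card (m'.arr aList 0) (below F k))
    (n := n) (by simpa using hn) (by decide) rfl rfl ?_ ?_).mono ?_
  · rw [below_zero, below_zero]
    refine ⟨by simp, by simp, ⟨fun q h0 h1 => ?_, fun j hj => ?_, fun q q' h0 h1 => ?_⟩⟩
    · simp at h1
      omega
    · exact absurd hj (Finset.notMem_empty _)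
    · simp at h1
      omega
  · intro k m1 hf hk0 hks hk hs1 ⟨hI1, hI2, hI3⟩
    obtain ⟨l, rfl⟩ := exists_fin_eq hk0 hks
    have h1 := hf.2 aFin rfl
    have h2 := hf.2 aPos rfl
    simp at h1 h2
    have hcl := hc l
    simp only [Runs.ite_iff, Runs.seq_iff, Runs.store_iff, Runs.assign_iff, Runs.skip_iff]
    refine ⟨fun hfin => ?_, fun hfin => ?_⟩
    · simp [h1, hk, hcl] at hfin
      have hlL : l ∈ L := (hL l).2 hfin
      rw [below_succ_of_mem hlL, Finset.card_insert_of_notMem (notMem_below _ _)]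
      refine ⟨fun h0 => ?_, fun h0 => ?_⟩
      · simp [h2, hk, hcl] at h0
        have hlF : l ∈ F := (hF l).2 ⟨hfin, h0⟩
        rw [below_succ_of_mem hlF, Finset.card_insert_of_notMem (notMem_below _ _)]
        refine ⟨by simp, by simp [hI1], by simp [hI2], ?_⟩
        simpa [hI2, hk] using hI3.push (notMem_below _ _)
      · simp [h2, hk, hcl] at h0
        have hlF : l ∉ F := fun hh => h0 ((hF l).1 hh).2
        rw [below_succ_of_notMem hlF]
        exact ⟨by simp, by simp [hI1], by simp [hI2], by simpa using hI3⟩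
    · simp [h1, hk, hcl] at hfin
      have hlL : l ∉ L := fun hh => by
        have := (hL l).1 hh
        omega
      have hlF : l ∉ F := fun hh => by
        have := (hF l).1 hh
        omega
      rw [below_succ_of_notMem hlL, below_succ_of_notMem hlF]
      exact ⟨by simp, by simp [hI1], by simp [hI2], by simpa using hI3⟩
  · rintro t m' ⟨ht, -, hI⟩
    rw [below_self, below_self] at hI
    exact ⟨by simp; omega, hI⟩

/-- The rows `R` are those that are not marked as suppressed. -/
def HoldsRows (R : Finset (Fin s)) (m : Mem) : Prop :=
  ∀ i : Fin s, m.arr aDel 0 (i : ℕ) = if i ∈ R then 0 else 1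

theorem HoldsRows.congr {m m' : Mem} (h : HoldsRows R m) (h1 : m'.arr aDel = m.arr aDel) :
    HoldsRows R m' := by
  intro i
  rw [h1]
  exact h i

/-- All the cells of the `s × b` rectangle are rewritten, so nothing subsists from previous calls;
suppressed rows get no edge. -/
theorem buildGraph_spec {m : Mem} {b : ℕ} {B : Finset (Fin n)} (hA : HoldsMatrix A m)
    (hs : m.var vS = s) (hb : m.var vB = b) (hR : HoldsRows R m)
    (hbl : IsColumnList b (m.arr aList 0) B) :
    Runs buildGraph m fun t m' => t ≤ 60 * ((s + 1) * (b + 1)) ∧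
      ∀ (i : Fin s) (j : Fin n) (q : ℤ), 0 ≤ q → q < b → m.arr aList 0 q = (j : ℕ) →
        (edges (m'.arr aG) (i : ℕ) q ↔ i ∈ R ∧ A i j = 0) := by
  rw [buildGraph]
  refine (Runs.forTo_intro (c := 40 * b + 7) (fun k m' =>
    ∀ (i : Fin s) (j : Fin n) (q : ℤ), ((i : ℕ) : ℤ) < k → 0 ≤ q → q < b →
      m.arr aList 0 q = (j : ℕ) → (m'.arr aG (i : ℕ) q = 1 ↔ i ∈ R ∧ A i j = 0))
    (n := s) hs (by decide) rfl rfl ?_ ?_).mono ?_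
  · intro i j q h
    omega
  · intro k m1 hf hk0 hks hk hs1 hI
    obtain ⟨l, rfl⟩ := exists_fin_eq hk0 hks
    have e1 := hf.1 vB rfl
    have e2 := hf.2 0 rfl
    have e3 := hf.2 aDel rfl
    have e4 := hf.2 aList rfl
    refine (Runs.forTo_intro (c := 31) (fun k m' =>
      (∀ (i : Fin s) (q : ℤ), i ≠ l → m'.arr aG (i : ℕ) q = m1.arr aG (i : ℕ) q) ∧
      ∀ (j : Fin n) (q : ℤ), 0 ≤ q → q < k →
        m.arr aList 0 q = (j : ℕ) → (m'.arr aG (l : ℕ) q = 1 ↔ l ∈ R ∧ A l j = 0))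
      (n := b) (e1.trans hb) (by decide) rfl rfl ?_ ?_).mono ?_
    · refine ⟨fun i q _ => rfl, fun j q h0 h1 => by omega⟩
    · intro q m2 hf2 hq0 hqb hq hb2 ⟨hJ1, hJ2⟩
      have g1 := hf2.1 vI rfl
      have g2 := (hf2.2 0 rfl).trans e2
      have g3 := (hf2.2 aDel rfl).trans e3
      have g4 := (hf2.2 aList rfl).trans e4
      obtain ⟨j', -, hj'⟩ := hbl.mem q hq0 hqb
      have h3 := hA l j'
      have h4 := hR l
      have hne : ∀ i : Fin s, ((i : ℕ) : ℤ) = (l : ℕ) ↔ i = l := by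
        intro j
        rw [Fin.ext_iff]
        omega
      simp only [Runs.ite_iff, Runs.store_iff]
      constructor
      · intro hc
        simp [g1, g2, g3, g4, hk, hq, hj', h3, h4, encodeEntry_eq_zero] at hc
        refine ⟨by simp, fun i r hil => ?_, fun j r h0 hr hjr => ?_⟩
        · simp [g1, hk, hne, hil, hJ1]
        · simp [g1, hk, hq]
          rcases (Int.lt_add_one_iff.1 hr).lt_or_eq with hlt | rfl
          · simp [hlt.ne, hJ2 j r h0 hlt hjr]
          · obtain rfl : j = j' := Fin.ext (by omega)
            simp [hc]
      · intro hc
        simp [g1, g2, g3, g4, hk, hq, hj', h3, h4, encodeEntry_eq_zero] at hc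
        refine ⟨by simp, fun i r hil => ?_, fun j r h0 hr hjr => ?_⟩
        · simp [g1, hk, hne, hil, hJ1]
        · simp [g1, hk, hq]
          rcases (Int.lt_add_one_iff.1 hr).lt_or_eq with hlt | rfl
          · simp [hlt.ne, hJ2 j r h0 hlt hjr]
          · obtain rfl : j = j' := Fin.ext (by omega)
            simpa using hc
    · rintro t m2 ⟨ht, -, hJ1, hJ2⟩
      refine ⟨by omega, fun i j q hi h0 h1 hj => ?_⟩
      rw [Mem.setVar_arr]
      by_cases hil : i = l
      · subst hil
        exact hJ2 j q h0 h1 hj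
      · rw [hJ1 i q hil]
        have : (i : ℕ) ≠ l := fun h => hil (Fin.ext h)
        exact hI i j q (by omega) h0 h1 hj
  · rintro t m' ⟨ht, -, hI⟩
    refine ⟨?_, fun i j q => hI i j q (by omega)⟩
    have : 60 * ((s + 1) * (b + 1)) = (40 * b + 7 + 9) * s +
      ((20 * b + 44) * s + 60 * (b + 1)) := by
      ring
    omega

end Parts


/-! ### Recording the output of HK and suppressing the rows -/

section Record

variable {s n : ℕ} {A : Matrix (Fin s) (Fin n) (WithBot ℕ)} {R : Finset (Fin s)}

theorem sdiff_below_succ {D : Finset (Fin s)} (hD : D ⊆ R) {l : Fin s} (hl : l ∈ D) :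
    R \ below D (l : ℕ) = insert l (R \ below D ((l : ℕ) + 1)) := by
  have h := hD hl
  rw [below_succ_of_mem hl]
  ext i
  have := notMem_below D l
  by_cases hi : i = l
  · subst hi
    simp [h, this]
  · simp [hi]

/-- The passages have unequal costs: only the rows of `D` pay `O(n)`. The rule `forTo_elapsed` keeps
this amortized bound, where a uniform bound per passage would give `O(s n)` for each call. -/
theorem recordRows_spec {m : Mem} {K : ℕ} {D : Finset (Fin s)} (hA : HoldsMatrix A m)
    (hs : m.var vS = s) (hn : m.var vN = n) (hK : m.var vK = K) (hc : HoldsCounts A R m)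
    (hR : HoldsRows R m) (hz : ∀ i : Fin s, m.arr 1 K (i : ℕ) = 0) (hDR : D ⊆ R)
    (hD : ∀ i : Fin s, i ∈ D ↔
      m.arr aRow 0 (i : ℕ) ≠ -1 ∧ m.arr aVis 0 (m.arr aRow 0 (i : ℕ)) = 0) :
    Runs recordRows m fun t m' => t ≤ 60 * (s + 1) + 60 * (n + 1) * D.card ∧
      HoldsCounts A (R \ D) m' ∧ HoldsRows (R \ D) m' ∧ m'.var vNr = D.card ∧ HoldsSet m' 1 K D ∧
      ∀ k : ℤ, k ≠ K → m'.arr 1 k = m.arr 1 k := by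
  rw [recordRows, Runs.seq_iff, Runs.assign_iff]
  refine (Runs.forTo_elapsed (fun k τ m' => (τ : ℤ) ≤ 40 * k + 60 * (n + 1) * (below D k).card ∧
    HoldsCounts A (R \ below D k) m' ∧ HoldsRows (R \ below D k) m' ∧
    m'.var vNr = (below D k).card ∧ HoldsSet m' 1 K (below D k) ∧
    ∀ k : ℤ, k ≠ K → m'.arr 1 k = m.arr 1 k)
    (n := s) (by simpa using hs) (by decide) rfl rfl ?_ ?_).mono ?_
  · rw [below_zero, Finset.sdiff_empty]
    refine ⟨by simp, hc.congr (by simp) (by simp), hR.congr (by simp), by simp, ?_, by simp⟩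
    intro i
    simpa using hz i
  · intro k τ m1 hf hk0 hks hk hs1 ⟨hτ, hI1, hI2, hI3, hI4, hI5⟩
    obtain ⟨l, rfl⟩ := exists_fin_eq hk0 hks
    have h1 := hf.2 aRow rfl
    have h2 := hf.2 aVis rfl
    have h3 := hf.1 vK rfl
    have h4 := hf.1 vN rfl
    have h5 := hf.2 0 rfl
    simp [hK, hn] at h1 h2 h3 h4 h5
    have hDl := hD l
    have hne : ∀ i : Fin s, ((i : ℕ) : ℤ) = (l : ℕ) ↔ i = l := by
      intro j
      rw [Fin.ext_iff]
      omega
    rw [Runs.ite_iff]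
    constructor
    · intro hb
      simp only [Test.Holds, IntExp.eval, h1, h2, hk] at hb
      have hl : l ∈ D := hDl.2 hb
      rw [Runs.seq_iff, Runs.store_iff, Runs.seq_iff, Runs.store_iff, Runs.seq_iff, Prog.incr,
        Runs.assign_iff]
      refine (updateRow_spec (A := A) (i := l) (hA.congr (by simp [h5]))
        (by simp [h4]) (by simp [hk])).mono_frame ?_
      rintro t m2 hf2 ⟨ht, hcc, -⟩
      have e1 := hf2.1 vNr rfl
      have e2 := hf2.2 1 rfl
      have e3 := hf2.2 aDel rfl
      rw [sdiff_below_succ hDR hl] at hI1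
      have hnot : l ∉ R \ below D ((l : ℕ) + 1) := by
        simp [below_succ_of_mem hl]
      have hcard : (below D ((l : ℕ) + 1)).card = (below D (l : ℕ)).card + 1 := by
        rw [below_succ_of_mem hl, Finset.card_insert_of_notMem (notMem_below _ _)]
      refine ⟨?_, ?_, ?_, ?_, ?_, ?_⟩
      · rw [hcard]
        simp
        have : (t : ℤ) ≤ 40 * (n + 1) := by exact_mod_cast ht
        nlinarith
      · intro j
        have g1 := hI1 j
        have g2 := hcc j
        rw [countFin_insert hnot, countPos_insert hnot] at g1
        simp only [Mem.setVar_arr]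
        rw [g2.1, g2.2]
        simp
        rw [g1.1, g1.2]
        push_cast
        constructor
        · by_cases hx : A l j = ⊥ <;> simp [hx]
        · by_cases hx : A l j ≠ ⊥ ∧ A l j ≠ 0 <;> simp [hx]
      · intro i
        have g1 := hI2 i
        simp [e3, hne, hk]
        by_cases hi : i = l
        · subst hi
          simp [below_succ_of_mem hl]
        · simpa [hi, below_succ_of_mem hl] using g1
      · rw [hcard]
        simp [e1, hI3]
      · intro i
        have g1 := hI4 i
        simp [e2, hne, hk, h3]
        by_cases hi : i = l
        · subst hi
          simp [below_succ_of_mem hl]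
        · simpa [hi, below_succ_of_mem hl] using g1
      · intro k' hk'
        rw [← hI5 k' hk']
        funext x
        simp [e2, h3, hk']
    · intro hb
      simp only [Test.Holds, IntExp.eval, h1, h2, hk] at hb
      have hl : l ∉ D := fun h => hb (hDl.1 h)
      rw [below_succ_of_notMem hl, Runs.skip_iff]
      refine ⟨by simp; linarith, hI1.congr (by simp) (by simp), hI2.congr (by simp), by simp [hI3],
        hI4, hI5⟩
  · rintro t m' ⟨-, τ, rfl, hτ, hI⟩
    rw [below_self] at hτ hI
    refine ⟨?_, hI⟩
    simp
    have : τ ≤ 40 * s + 60 * (n + 1) * D.card := by exact_mod_cast hτ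
    omega

theorem recordColumns_spec {m : Mem} {K b : ℕ} {B Y : Finset (Fin n)} (hb : m.var vB = b)
    (hK : m.var vK = K) (hbl : IsColumnList b (m.arr aList 0) B)
    (hz : ∀ j : Fin n, m.arr 2 K (j : ℕ) = 0 ∧ m.arr 3 K (j : ℕ) = 0) (hY : HoldsSet m 4 0 Y) :
    Runs recordColumns m fun t m' => t ≤ 60 * (b + 1) ∧
      HoldsSet m' 2 K (columnsWith (n := n) b (m.arr aList 0) fun q => m.arr aVis 0 q ≠ 0) ∧
      HoldsSet m' 3 K (columnsWith (n := n) b (m.arr aList 0) fun q =>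
        m.arr aCol 0 q ≠ -1 ∧ m.arr aVis 0 q = 0) ∧
      HoldsSet m' 4 0 (Y ∪ columnsWith (n := n) b (m.arr aList 0) fun q =>
        m.arr aCol 0 q ≠ -1 ∧ m.arr aVis 0 q = 0) ∧
      ∀ k : ℤ, k ≠ K → m'.arr 2 k = m.arr 2 k ∧ m'.arr 3 k = m.arr 3 k := by
  classical
  rw [recordColumns]
  refine (Runs.forTo_intro (c := 40) (fun k m' =>
      (∀ j : Fin n, m'.arr 2 K (j : ℕ) = if ∃ q, 0 ≤ q ∧ q < k ∧ m.arr aList 0 q = (j : ℕ) ∧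
        m.arr aVis 0 q ≠ 0 then 1 else 0) ∧
      (∀ j : Fin n, m'.arr 3 K (j : ℕ) = if ∃ q, 0 ≤ q ∧ q < k ∧ m.arr aList 0 q = (j : ℕ) ∧
        m.arr aCol 0 q ≠ -1 ∧ m.arr aVis 0 q = 0 then 1 else 0) ∧
      (∀ j : Fin n, m'.arr 4 0 (j : ℕ) = if j ∈ Y ∨ ∃ q, 0 ≤ q ∧ q < k ∧
        m.arr aList 0 q = (j : ℕ) ∧ m.arr aCol 0 q ≠ -1 ∧ m.arr aVis 0 q = 0 then 1 else 0) ∧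
      ∀ k : ℤ, k ≠ K → m'.arr 2 k = m.arr 2 k ∧ m'.arr 3 k = m.arr 3 k)
    (n := b) hb (by decide) rfl rfl ?_ ?_).mono ?_
  · have h0 : ∀ p : ℤ → Prop, ¬ ∃ q : ℤ, 0 ≤ q ∧ q < 0 ∧ p q := by
      rintro p ⟨q, h1, h2, -⟩
      omega
    refine ⟨fun j => ?_, fun j => ?_, fun j => ?_, fun k _ => ⟨rfl, rfl⟩⟩
    · rw [if_neg (h0 _), Mem.setVar_arr, (hz j).1]
    · rw [if_neg (h0 _), Mem.setVar_arr, (hz j).2]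
    · simp only [h0, or_false]
      exact hY j
  · intro k m1 hf hk0 hkb hk hb1 ⟨hI1, hI2, hI3, hI4⟩
    have h1 := hf.2 aVis rfl
    have h2 := hf.2 aCol rfl
    have h3 := hf.2 aList rfl
    have h4 := (hf.1 vK rfl).trans hK
    obtain ⟨j₀, -, hj₀⟩ := hbl.mem k hk0 hkb
    have hsplit : ∀ p : ℤ → Prop, (∃ q : ℤ, 0 ≤ q ∧ q < k + 1 ∧ p q) ↔
        (∃ q : ℤ, 0 ≤ q ∧ q < k ∧ p q) ∨ p k := by
      intro p
      constructor
      · rintro ⟨q, g0, g1, hp⟩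
        rcases (Int.lt_add_one_iff.1 g1).lt_or_eq with h | rfl
        · exact Or.inl ⟨q, g0, h, hp⟩
        · exact Or.inr hp
      · rintro (⟨q, g0, g1, hp⟩ | hp)
        · exact ⟨q, g0, by omega, hp⟩
        · exact ⟨k, hk0, by omega, hp⟩
    simp only [hsplit, hj₀]
    have hne : ∀ i : Fin n, ((i : ℕ) : ℤ) = (j₀ : ℕ) ↔ i = j₀ := by
      intro j
      rw [Fin.ext_iff]
      omega
    have hne' : ∀ i : Fin n, ((j₀ : ℕ) : ℤ) = (i : ℕ) ↔ i = j₀ := by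
      intro j
      rw [Fin.ext_iff]
      omega
    simp only [Runs.ite_iff, Runs.seq_iff, Runs.store_iff, Runs.skip_iff]
    refine ⟨fun hv => ⟨fun hcol => ?_, fun hcol => ?_⟩, fun hv => ?_⟩
    · simp [h1, h2, hk] at hv hcol
      refine ⟨by simp, fun j => ?_, fun j => ?_, fun j => ?_, fun k' hk' => ?_⟩
      · simp [hv, hI1]
      · simp [hcol, hI2]
      · simp [hcol, hI3]
      · simpa using hI4 k' hk'
    · simp [h1, h2, hk] at hv hcol
      refine ⟨by simp, fun j => ?_, fun j => ?_, fun j => ?_, fun k' hk' => ?_⟩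
      · simp [hv, hI1]
      · by_cases hj : j = j₀
        · simp [hk, h3, hj₀, h4, hj, hv, hcol]
        · simp [hk, h3, hj₀, h4, hne, hne', hj, hI2]
      · by_cases hj : j = j₀
        · simp [hk, h3, hj₀, hj, hv, hcol]
        · simp [hk, h3, hj₀, hne, hne', hj, hI3]
      · refine ⟨by simpa using (hI4 k' hk').1, ?_⟩
        rw [← (hI4 k' hk').2]
        funext x
        simp [h4, hk']
    · simp [h1, hk] at hv
      refine ⟨by simp, fun j => ?_, fun j => ?_, fun j => ?_, fun k' hk' => ?_⟩
      · by_cases hj : j = j₀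
        · simp [hk, h3, hj₀, h4, hj, hv]
        · simp [hk, h3, hj₀, h4, hne, hne', hj, hI1]
      · simp [hv, hI2]
      · simp [hv, hI3]
      · refine ⟨?_, by simpa using (hI4 k' hk').2⟩
        rw [← (hI4 k' hk').1]
        funext x
        simp [h4, hk']
  · rintro t m' ⟨ht, -, hI1, hI2, hI3, hI4⟩
    refine ⟨by omega, fun j => ?_, fun j => ?_, fun j => ?_, hI4⟩
    · rw [hI1 j]
      simp only [mem_columnsWith]
    · rw [hI2 j]
      simp only [mem_columnsWith]
    · rw [show ((0 : ℕ) : ℤ) = 0 from rfl, hI3 j]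
      simp only [Finset.mem_union, mem_columnsWith]

end Record


/-! ### One call of HK -/

section Call

variable {s n : ℕ} {A : Matrix (Fin s) (Fin n) (WithBot ℕ)} {R : Finset (Fin s)}

/-- A bound, up to a constant factor, for the work done in a call of HK. -/
noncomputable def hkWork (A : Matrix (Fin s) (Fin n) (WithBot ℕ)) (c : HKCall s n) : ℕ :=
  n + (Nat.sqrt (maxTransversalZeros A c.rows c.cols) + 1) * (s * c.cols.card)

theorem one_le_countFin {j : Fin n} : 1 ≤ countFin A R j ↔ ∃ i ∈ R, A i j ≠ ⊥ := by
  rw [countFin, Finset.one_le_card]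
  simp [Finset.filter_nonempty_iff]

theorem countPos_eq_zero {j : Fin n} : countPos A R j = 0 ↔ ∀ i ∈ R, A i j = ⊥ ∨ A i j = 0 := by
  rw [countPos, Finset.card_eq_zero, Finset.filter_eq_empty_iff]
  exact forall₂_congr fun i _ => by tauto

theorem IsHKOutput.maxTransversalZeros_eq_zero {R₀ : Finset (Fin s)} {C₀ Y₁ : Finset (Fin n)}
    (h : IsHKOutput A R ∅ R₀ C₀ Y₁) : maxTransversalZeros A R ∅ = 0 := by
  obtain ⟨-, -, M, hM, hc, -⟩ := h
  rw [← hc, Finset.card_eq_zero, Finset.eq_empty_iff_forall_notMem]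
  intro x hx
  exact Finset.notMem_empty _ (hM.1 x hx).2.1

/-- By `hC` the live columns depend only on `R`, so the counters suffice and the set `C` need not be
stored. Only ones are written in the output arrays, which is why their rows `K` must still be zero.
-/
theorem hkCall_spec {m : Mem} {K : ℕ} {C Y : Finset (Fin n)} (h1s : 1 ≤ s) (hsn : s ≤ n)
    (hA : HoldsMatrix A m) (hs : m.var vS = s) (hn : m.var vN = n) (hK : m.var vK = K)
    (hrem : m.var vRem = R.card) (hc : HoldsCounts A R m) (hR : HoldsRows R m)
    (hz : ∀ l : ℤ, m.arr 1 K l = 0 ∧ m.arr 2 K l = 0 ∧ m.arr 3 K l = 0) (hY : HoldsSet m 4 0 Y)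
    (hC : ∀ j, (∃ i ∈ R, A i j ≠ ⊥) → j ∈ C) :
    Runs hkCall m fun t m' => ∃ R₀ C₀ Y₁,
      IsHKOutput A R (flatColumns A R (liveColumns A R C)) R₀ C₀ Y₁ ∧
      t ≤ 40000 * hkWork A ⟨R, flatColumns A R (liveColumns A R C), R₀, C₀, Y₁⟩ +
        120 * n * R₀.card ∧
      HoldsCounts A (R \ R₀) m' ∧ HoldsRows (R \ R₀) m' ∧ m'.var vRem = (R \ R₀).card ∧
      m'.var vCC = (liveColumns A R C).card ∧ m'.var vK = (K + 1 : ℕ) ∧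
      m'.var vRun = (if R₀ = ∅ then 0 else m.var vRun) ∧
      HoldsSet m' 1 K R₀ ∧ HoldsSet m' 2 K C₀ ∧ HoldsSet m' 3 K Y₁ ∧ HoldsSet m' 4 0 (Y ∪ Y₁) ∧
      ∀ k : ℤ, k ≠ K → m'.arr 1 k = m.arr 1 k ∧ m'.arr 2 k = m.arr 2 k ∧ m'.arr 3 k = m.arr 3 k := by
  set L := liveColumns A R C with hLdef
  set F := flatColumns A R L with hFdef
  have hL : ∀ j, j ∈ L ↔ 1 ≤ countFin A R j := by
    intro j
    rw [one_le_countFin, hLdef, liveColumns, Finset.mem_filter]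
    exact ⟨And.right, fun h => ⟨hC j h, h⟩⟩
  have hF : ∀ j, j ∈ F ↔ 1 ≤ countFin A R j ∧ countPos A R j = 0 := by
    intro j
    rw [countPos_eq_zero, hFdef, flatColumns, Finset.mem_filter, hL]
  rw [hkCall]
  refine Runs.seq_intro (collectColumns_spec hn hc hL hF) ?_
  rintro t1 m1 f1 ⟨ht1, hcc, hb, hbl⟩
  refine Runs.seq_intro (buildGraph_spec (hA.congr (f1.2 0 rfl)) ((f1.1 vS rfl).trans hs) hb
    (hR.congr (f1.2 aDel rfl)) hbl) ?_
  rintro t2 m2 f2 ⟨ht2, hE⟩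
  refine Runs.seq_intro (maxMatching_spec ((f2.1 vS rfl).trans ((f1.1 vS rfl).trans hs))
    ((f2.1 vB rfl).trans hb)) ?_
  rintro t3 m3 f3 ⟨ht3, hmax⟩
  obtain ⟨hHK, hrank⟩ := hmax.isHKOutput hbl hE
  rw [← hrank] at ht3
  set R₀ : Finset (Fin s) :=
    rowsWith s fun i => m3.arr aRow 0 i ≠ -1 ∧ m3.arr aVis 0 (m3.arr aRow 0 i) = 0 with hR₀
  have hR₀R : R₀ ⊆ R := hHK.1.1
  have a12 : ∀ a, collectColumns.writesArr a = false → buildGraph.writesArr a = false →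
      maxMatching.writesArr a = false → m3.arr a = m.arr a := fun a h1 h2 h3 =>
    (f3.2 a h3).trans ((f2.2 a h2).trans (f1.2 a h1))
  have v12 : ∀ x, collectColumns.writesVar x = false → buildGraph.writesVar x = false →
      maxMatching.writesVar x = false → m3.var x = m.var x := fun a h1 h2 h3 =>
    (f3.1 a h3).trans ((f2.1 a h2).trans (f1.1 a h1))
  refine Runs.seq_intro (recordRows_spec (R := R) (D := R₀) (K := K)
    (hA.congr (a12 0 rfl rfl rfl)) ((v12 vS rfl rfl rfl).trans hs) ((v12 vN rfl rfl rfl).trans hn)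
    ((v12 vK rfl rfl rfl).trans hK) (hc.congr (a12 aFin rfl rfl rfl) (a12 aPos rfl rfl rfl))
    (hR.congr (a12 aDel rfl rfl rfl))
    (fun i => by rw [a12 1 rfl rfl rfl]; exact (hz _).1) hR₀R
    (fun i => by rw [hR₀, mem_rowsWith])) ?_
  rintro t4 m4 f4 ⟨ht4, hc4, hR4, hnr, hset1, hother1⟩
  have hlist : m4.arr aList = m1.arr aList :=
    (f4.2 aList rfl).trans ((f3.2 aList rfl).trans (f2.2 aList rfl))
  refine Runs.seq_intro (recordColumns_spec (K := K) (b := F.card) (B := F) (Y := Y)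
    ((f4.1 vB rfl).trans ((f3.1 vB rfl).trans ((f2.1 vB rfl).trans hb)))
    ((f4.1 vK rfl).trans ((v12 vK rfl rfl rfl).trans hK)) (hlist ▸ hbl)
    (fun j => by
      rw [f4.2 2 rfl, f4.2 3 rfl, a12 2 rfl rfl rfl, a12 3 rfl rfl rfl]
      exact (hz _).2)
    (fun j => by
      rw [f4.2 4 rfl, a12 4 rfl rfl rfl]
      exact hY j)) ?_
  rintro t5 m5 f5 ⟨ht5, hset2, hset3, hset4, hother⟩
  rw [hlist, f4.2 aVis rfl] at hset2
  rw [hlist, f4.2 aVis rfl, f4.2 aCol rfl] at hset3 hset4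
  set C₀ : Finset (Fin n) := columnsWith F.card (m1.arr aList 0) fun q => m3.arr aVis 0 q ≠ 0
  set Y₁ : Finset (Fin n) := columnsWith F.card (m1.arr aList 0) fun q =>
    m3.arr aCol 0 q ≠ -1 ∧ m3.arr aVis 0 q = 0
  have hcard : ((R \ R₀).card : ℤ) = R.card - R₀.card := by
    rw [Finset.card_sdiff_of_subset hR₀R, Nat.cast_sub (Finset.card_le_card hR₀R)]
  have hrem5 : m5.var vRem = R.card :=
    (f5.1 vRem rfl).trans ((f4.1 vRem rfl).trans ((v12 vRem rfl rfl rfl).trans hrem))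
  have hnr5 : m5.var vNr = R₀.card := (f5.1 vNr rfl).trans hnr
  have hk5 : m5.var vK = K := (f5.1 vK rfl).trans ((f4.1 vK rfl).trans
    ((v12 vK rfl rfl rfl).trans hK))
  have hcc5 : m5.var vCC = L.card := (f5.1 vCC rfl).trans ((f4.1 vCC rfl).trans
    ((f3.1 vCC rfl).trans ((f2.1 vCC rfl).trans hcc)))
  have hrun5 : m5.var vRun = m.var vRun :=
    (f5.1 vRun rfl).trans ((f4.1 vRun rfl).trans (v12 vRun rfl rfl rfl))
  have htime : t1 + (t2 + (t3 + (t4 + (t5 + 40)))) ≤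
      40000 * hkWork A ⟨R, F, R₀, C₀, Y₁⟩ + 120 * n * R₀.card := by
    have e4 : 60 * (n + 1) * R₀.card ≤ 120 * n * R₀.card :=
      Nat.mul_le_mul_right _ (by omega)
    rw [hkWork]
    simp only
    -- Without flat columns, the cost is linear in `s` and `n` and is absorbed by the term `n` of
    -- `hkWork`, as `s ≤ n`. Otherwise `(s + 1) * (F.card + 1) ≤ 4 * (s * F.card)`.
    rcases Nat.eq_zero_or_pos F.card with h0 | h0
    · have hF0 : F = ∅ := Finset.card_eq_zero.1 h0
      have hr0 : maxTransversalZeros A R F = 0 := by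
        rw [hF0] at hHK ⊢
        exact hHK.maxTransversalZeros_eq_zero
      rw [hr0, h0] at ht3
      rw [h0] at ht2 ht5
      simp at ht2 ht3 ht5
      omega
    · have e : (s + 1) * (F.card + 1) ≤ 4 * (s * F.card) := by nlinarith
      have e3 : 4000 * ((s + 1) * (F.card + 1)) * (Nat.sqrt (maxTransversalZeros A R F) + 1) ≤
          16000 * ((Nat.sqrt (maxTransversalZeros A R F) + 1) * (s * F.card)) := by
        calc _ ≤ 4000 * (4 * (s * F.card)) * (Nat.sqrt (maxTransversalZeros A R F) + 1) := by gcongr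
          _ = _ := by ring
      have e2 : s * F.card ≤ (Nat.sqrt (maxTransversalZeros A R F) + 1) * (s * F.card) :=
        Nat.le_mul_of_pos_left _ (by omega)
      have e5 : F.card ≤ s * F.card := Nat.le_mul_of_pos_left _ (by omega)
      omega
  rw [Runs.seq_iff, Runs.assign_iff, Runs.seq_iff, Prog.incr, Runs.assign_iff, Runs.ite_iff,
    Runs.assign_iff, Runs.skip_iff]
  have hrest : ∀ m' : Mem, m'.arr = m5.arr → HoldsCounts A (R \ R₀) m' ∧ HoldsRows (R \ R₀) m' ∧
      HoldsSet m' 1 K R₀ ∧ HoldsSet m' 2 K C₀ ∧ HoldsSet m' 3 K Y₁ ∧ HoldsSet m' 4 0 (Y ∪ Y₁) ∧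
      ∀ k : ℤ, k ≠ K →
        m'.arr 1 k = m.arr 1 k ∧ m'.arr 2 k = m.arr 2 k ∧ m'.arr 3 k = m.arr 3 k := by
    intro m' hm'
    have g : ∀ a, m'.arr a = m5.arr a := fun a => congrFun hm' a
    refine ⟨hc4.congr ((g _).trans (f5.2 aFin rfl)) ((g _).trans (f5.2 aPos rfl)),
      hR4.congr ((g _).trans (f5.2 aDel rfl)), fun i => ?_, fun i => ?_, fun i => ?_, fun i => ?_,
      fun k hk => ⟨?_, ?_, ?_⟩⟩
    · rw [g, f5.2 1 rfl]
      exact hset1 i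
    · rw [g]
      exact hset2 i
    · rw [g]
      exact hset3 i
    · rw [g]
      exact hset4 i
    · rw [g, f5.2 1 rfl, hother1 k hk, a12 1 rfl rfl rfl]
    · rw [g, (hother k hk).1, f4.2 2 rfl, a12 2 rfl rfl rfl]
    · rw [g, (hother k hk).2, f4.2 3 rfl, a12 3 rfl rfl rfl]
  constructor
  · intro h0
    simp [hnr5] at h0
    obtain ⟨g1, g2, g3⟩ := hrest (((m5.setVar vRem (m5.var vRem - m5.var vNr)).setVar vK
      (m5.var vK + 1)).setVar vRun 0) rfl
    refine ⟨R₀, C₀, Y₁, hHK, ?_, g1, g2, ?_, ?_, ?_, ?_, g3⟩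
    · simp
      omega
    · simp [hrem5, hnr5, hcard]
    · simp [hcc5]
    · simp [hk5]
    · simp [h0]
  · intro h0
    simp [hnr5] at h0
    obtain ⟨g1, g2, g3⟩ := hrest ((m5.setVar vRem (m5.var vRem - m5.var vNr)).setVar vK
      (m5.var vK + 1)) rfl
    refine ⟨R₀, C₀, Y₁, hHK, ?_, g1, g2, ?_, ?_, ?_, ?_, g3⟩
    · simp
      omega
    · simp [hrem5, hnr5, hcard]
    · simp [hcc5]
    · simp [hk5]
    · simp [h0, hrun5]

end Call


/-! ### The whole program -/

section Main

variable {s n : ℕ} {A : Matrix (Fin s) (Fin n) (WithBot ℕ)}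

/-- The triples returned by the calls of HK in `tr` are in memory. -/
def HoldsTrace (m : Mem) (tr : List (HKCall s n)) : Prop :=
  ∀ (k : ℕ) (c : HKCall s n), tr[k]? = some c →
    HoldsSet m 1 k c.R₀ ∧ HoldsSet m 2 k c.C₀ ∧ HoldsSet m 3 k c.Y₁

theorem HoldsTrace.concat {m m' : Mem} {tr : List (HKCall s n)} {c : HKCall s n}
    (h : HoldsTrace m tr) (h1 : HoldsSet m' 1 tr.length c.R₀) (h2 : HoldsSet m' 2 tr.length c.C₀)
    (h3 : HoldsSet m' 3 tr.length c.Y₁) (hk : ∀ k : ℤ, k ≠ tr.length →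
      m'.arr 1 k = m.arr 1 k ∧ m'.arr 2 k = m.arr 2 k ∧ m'.arr 3 k = m.arr 3 k) :
    HoldsTrace m' (tr ++ [c]) := by
  intro k d hd
  rcases lt_trichotomy k tr.length with hlt | rfl | hlt
  · rw [List.getElem?_append_left hlt] at hd
    obtain ⟨g1, g2, g3⟩ := h k d hd
    obtain ⟨e1, e2, e3⟩ := hk k (by omega)
    refine ⟨fun i => ?_, fun i => ?_, fun i => ?_⟩
    · rw [e1]
      exact g1 i
    · rw [e2]
      exact g2 i
    · rw [e3]
      exact g3 i
  · rw [List.getElem?_concat_length] at hd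
    cases hd
    exact ⟨h1, h2, h3⟩
  · rw [List.getElem?_eq_none (by simp; omega)] at hd
    cases hd

/-- The work done in the calls of HK in `tr`. -/
noncomputable def traceWork (A : Matrix (Fin s) (Fin n) (WithBot ℕ)) (tr : List (HKCall s n)) : ℕ :=
  (tr.map (hkWork A)).sum

theorem traceWork_concat {tr : List (HKCall s n)} {c : HKCall s n} :
    traceWork A (tr ++ [c]) = traceWork A tr + hkWork A c := by
  simp [traceWork]

/-- The state of the program when it has come to the submatrix with rows `R` and columns `C`, after
the calls of HK recorded in `tr`, having collected the columns `Y`. -/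
structure LoopState (A : Matrix (Fin s) (Fin n) (WithBot ℕ)) (R : Finset (Fin s))
    (C Y : Finset (Fin n)) (tr : List (HKCall s n)) (m : Mem) : Prop where
  run : m.var vRun = 1
  res : m.var vRes = 0
  rem : m.var vRem = R.card
  cols : m.var vCC = C.card
  counts : HoldsCounts A R m
  rows : HoldsRows R m
  live : ∀ j, (∃ i ∈ R, A i j ≠ ⊥) → j ∈ C
  collected : HoldsSet m 4 0 Y
  index : m.var vK = tr.length
  trace : HoldsTrace m tr
  zero : ∀ k l : ℤ, tr.length ≤ k → m.arr 1 k l = 0 ∧ m.arr 2 k l = 0 ∧ m.arr 3 k l = 0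
  continue_run : ∀ p tr' res, OTestRun A R C p tr' res →
    ∃ p', OTestRun A Finset.univ Finset.univ p' (tr ++ tr') (res.map fun Y' => Y' ∪ Y)

/-- The final state of the main loop. -/
def FinalState (A : Matrix (Fin s) (Fin n) (WithBot ℕ)) (tr : List (HKCall s n)) (m : Mem) : Prop :=
  m.var vRun = 0 ∧ ∃ p res, OTestRun A Finset.univ Finset.univ p tr res ∧
    m.var vRes = (if res.isSome then 1 else 0) ∧ (∀ Y, res = some Y → HoldsSet m 4 0 Y) ∧
    m.var vK = tr.length ∧ HoldsTrace m tr

theorem mainLoop_spec {m : Mem} (h1s : 1 ≤ s) (hsn : s ≤ n) (hA : HoldsMatrix A m)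
    (hs : m.var vS = s) (hn : m.var vN = n) (hrow : ∀ i, ∃ j, A i j = 0)
    (h : LoopState A Finset.univ Finset.univ ∅ [] m) :
    Runs mainLoop m fun t m' => ∃ tr, FinalState A tr m' ∧
      t ≤ 40100 * traceWork A tr + 120 * n * s + 100 := by
  rw [mainLoop]
  -- The term `120 * n * R.card` is a potential that pays for suppressing the remaining rows. The
  -- variant is `R.card + 1`, and the value `0` is kept for the final states.
  refine (Runs.loop_intro (v₀ := s + 1) (fun v τ m' =>
    (∃ R C Y tr, LoopState A R C Y tr m' ∧ v = R.card + 1 ∧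
      τ + 120 * n * R.card ≤ 40100 * traceWork A tr + 120 * n * s) ∨
    (v = 0 ∧ ∃ tr, FinalState A tr m' ∧ τ ≤ 40100 * traceWork A tr + 120 * n * s + 50))
    (Or.inl ⟨_, _, _, _, h, by simp, by simp⟩) ?_).mono ?_
  · rintro v τ m1 hf (⟨R, C, Y, tr, hS, rfl, hτ⟩ | ⟨-, tr, hF, -⟩) hb
    swap
    · simp [hF.1] at hb
    have hA1 := hA.congr (hf.2 0 rfl)
    have hs1 := (hf.1 vS rfl).trans hs
    have hn1 := (hf.1 vN rfl).trans hn
    rw [Runs.ite_iff, Runs.ite_iff]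
    refine ⟨fun h0 => ?_, fun h0 => ⟨fun hlt => ?_, fun hlt => ?_⟩⟩
    · simp [hS.rem] at h0
      subst h0
      rw [Runs.seq_iff, Runs.assign_iff, Runs.assign_iff]
      refine ⟨0, by omega, Or.inr ⟨rfl, tr, ⟨by simp, ?_⟩, by simp at hτ ⊢; omega⟩⟩
      obtain ⟨p, hp⟩ := hS.continue_run _ _ _ (OTestRun.empty C)
      rw [List.append_nil] at hp
      refine ⟨p, _, hp, by simp, ?_, by simpa using hS.index, hS.trace⟩
      simp
      exact hS.collected
    · simp [hS.rem] at h0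
      simp [hS.rem, hS.cols] at hlt
      rw [Runs.assign_iff]
      refine ⟨0, by omega, Or.inr ⟨rfl, tr, ⟨by simp, ?_⟩, by simp; omega⟩⟩
      obtain ⟨p, hp⟩ := hS.continue_run _ _ _
        (OTestRun.obvious R C (Finset.nonempty_iff_ne_empty.2 h0) (Or.inl hlt))
      rw [List.append_nil] at hp
      exact ⟨p, _, hp, by simpa using hS.res, by simp, by simpa using hS.index, hS.trace⟩
    · simp [hS.rem] at h0
      simp [hS.rem, hS.cols] at hlt
      have hne : R.Nonempty := Finset.nonempty_iff_ne_empty.2 h0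
      -- The search for a row without zero need not be repeated: a zero in a remaining row keeps its
      -- column live, so that column is still in `C`.
      have hof : ¬ ObviousFailure A R C := by
        rintro (h1 | ⟨i, hi, h1⟩)
        · omega
        · obtain ⟨j, hj⟩ := hrow i
          exact h1 j (hS.live j ⟨i, hi, by simp [hj]⟩) hj
      refine (hkCall_spec (K := tr.length) (C := C) (Y := Y) h1s hsn hA1 hs1 hn1 hS.index hS.rem
        hS.counts hS.rows (fun l => hS.zero _ l le_rfl) hS.collected hS.live).mono_frame ?_
      rintro t m2 hf2 ⟨R₀, C₀, Y₁, hHK, ht, hc, hR, hrem, hcc, hK, hrun, e1, e2, e3, e4, e5⟩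
      set c : HKCall s n := ⟨R, flatColumns A R (liveColumns A R C), R₀, C₀, Y₁⟩
      have htr : HoldsTrace m2 (tr ++ [c]) := hS.trace.concat e1 e2 e3 e5
      -- As `n ≥ 1`, the overhead of a passage is charged to `hkWork`, whence `40100` instead of
      -- `40000`.
      have hwork : n ≤ hkWork A c := Nat.le_add_right _ _
      have hres : m2.var vRes = 0 := (hf2.1 vRes rfl).trans hS.res
      have hcard : R.card = (R \ R₀).card + R₀.card :=
        (Finset.card_sdiff_add_card_eq_card hHK.1.1).symm
      have htime : τ + (t + 40) + 120 * n * (R \ R₀).card ≤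
          40100 * traceWork A (tr ++ [c]) + 120 * n * s := by
        rw [hcard, Nat.mul_add] at hτ
        rw [traceWork_concat, Nat.mul_add]
        omega
      by_cases hR₀ : R₀ = ∅
      · subst hR₀
        refine ⟨0, by omega, Or.inr ⟨rfl, tr ++ [c], ⟨by simpa using hrun, ?_⟩,
          by simp; omega⟩⟩
        obtain ⟨p, hp⟩ := hS.continue_run _ _ _
          (OTestRun.stuck R C _ _ C₀ Y₁ hne hof rfl rfl hHK)
        exact ⟨p, _, hp, by simpa using hres, by simp, by simpa using hK, htr⟩
      · have hpos : 0 < R₀.card := Finset.card_pos.2 (Finset.nonempty_iff_ne_empty.2 hR₀)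
        refine ⟨(R \ R₀).card + 1, by omega, Or.inl ⟨R \ R₀, liveColumns A R C, Y ∪ Y₁, tr ++ [c],
          ⟨?_, hres, hrem, hcc, hc, hR, ?_, e4, by simpa using hK, htr, ?_, ?_⟩, rfl,
          by simp; omega⟩⟩
        · rw [hrun, if_neg hR₀]
          exact hS.run
        · rintro j ⟨i, hi, hij⟩
          have hi' := (Finset.mem_sdiff.1 hi).1
          exact Finset.mem_filter.2 ⟨hS.live j ⟨i, hi', hij⟩, i, hi', hij⟩
        · intro k l hk
          rw [List.length_append, List.length_singleton] at hk
          obtain ⟨g1, g2, g3⟩ := e5 k (by push_cast at hk; omega)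
          rw [g1, g2, g3]
          exact hS.zero k l (by push_cast at hk; omega)
        · intro p tr' res hrun'
          obtain ⟨p', hp'⟩ := hS.continue_run _ _ _ (OTestRun.step R C _ _ R₀ C₀ Y₁ p tr' res hne hof
            rfl rfl hHK (Finset.nonempty_iff_ne_empty.2 hR₀) hrun')
          refine ⟨p', ?_⟩
          rw [Option.map_map] at hp'
          rw [List.append_assoc]
          rwa [show (fun Y' => Y' ∪ (Y ∪ Y₁)) = (fun Y' => Y' ∪ Y) ∘ fun Y₂ => Y₂ ∪ Y₁ from by
            funext Y'
            rw [Function.comp, Finset.union_comm Y Y₁, Finset.union_assoc]]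
  · rintro t m' ⟨v, τ, rfl, (⟨R, C, Y, tr, hS, -, -⟩ | ⟨-, tr, hF, hτ⟩), hb⟩
    · exact absurd (by simp [hS.run]) hb
    · exact ⟨tr, hF, by simp; omega⟩

theorem holdsRun_nil_none {m : Mem} (h0 : m.var 0 = 0) (h1 : m.var 1 = 0) :
    HoldsRun m ([] : List (HKCall s n)) none :=
  ⟨by simpa using h0, by simp, by simpa using h1, by simp⟩

theorem oTest_spec (A : Matrix (Fin s) (Fin n) (WithBot ℕ)) :
    ∃ t p tr, ImplementsOTest oTest A t p tr ∧
      t ≤ 1000000 * (s * n + traceWork A tr + 1) := by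
  suffices H : Runs oTest (inputMem A) fun t m => ∃ p tr res,
      OTestRun A Finset.univ Finset.univ p tr res ∧ HoldsRun m tr res ∧
        t ≤ 1000000 * (s * n + traceWork A tr + 1) by
    obtain ⟨t, m, hex, p, tr, res, h1, h2, h3⟩ := H
    exact ⟨t, p, tr, ⟨m, res, hex, h1, h2⟩, h3⟩
  have harr : ∀ a k l, a ≠ 0 → (inputMem A).arr a k l = 0 := by
    intro a k l ha
    simp [inputMem, ha]
  have hs : (inputMem A).var vS = s := rfl
  have hn : (inputMem A).var vN = n := rfl
  rw [oTest, Runs.ite_iff, Runs.ite_iff]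
  refine ⟨fun h0 => ?_, fun h0 => ⟨fun hlt => ?_, fun hlt => ?_⟩⟩
  · simp [hs] at h0
    subst h0
    simp only [Runs.seq_iff, Runs.assign_iff]
    refine ⟨1, [], some ∅, OTestRun.empty _, ⟨by simp, ?_, by simp, by simp⟩, by simp; omega⟩
    rintro Y hY
    cases hY
    intro i
    simp [harr]
  · simp [hs] at h0
    simp [hs, hn] at hlt
    simp only [Runs.seq_iff, Runs.assign_iff]
    refine ⟨1, [], none, OTestRun.obvious _ _ ⟨⟨0, by omega⟩, Finset.mem_univ _⟩
      (Or.inl (by simpa using hlt)), holdsRun_nil_none (by simp) (by simp), ?_⟩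
    simp
    omega
  · simp [hs] at h0
    simp [hs, hn] at hlt
    have hns : s ≤ s * n := Nat.le_mul_of_pos_right _ (by omega)
    have hnn : n ≤ s * n := Nat.le_mul_of_pos_left _ (by omega)
    have hprod : (s + 1) * (n + 1) = s * n + s + n + 1 := by ring
    refine Runs.seq_intro (countRows_spec (A := A) holdsMatrix_inputMem hs hn fun j => ?_) ?_
    · simp [harr, countFin, countPos]
    rintro t1 m1 hf1 ⟨ht1, hc1, hok⟩
    have hne : (Finset.univ : Finset (Fin s)).Nonempty := ⟨⟨0, by omega⟩, Finset.mem_univ _⟩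
    rw [Runs.ite_iff]
    refine ⟨fun hz => ?_, fun hz => ?_⟩
    · simp at hz
      obtain ⟨i, hi⟩ := hok.1 hz
      simp only [Runs.seq_iff, Runs.assign_iff]
      refine ⟨1, [], none, OTestRun.obvious _ _ hne
        (Or.inr ⟨i, Finset.mem_univ _, fun j _ => hi j⟩), holdsRun_nil_none (by simp) (by simp), ?_⟩
      simp
      omega
    · simp [hok] at hz
      have hS : m1.var vS = s := hf1.1 vS rfl
      have hN : m1.var vN = n := hf1.1 vN rfl
      iterate 5 rw [Runs.seq_iff, Runs.assign_iff]
      refine Runs.seq_intro (mainLoop_spec (A := A) (by omega) hlt ?_ (by simpa using hS)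
        (by simpa using hN) hz
        ⟨by simp, by simp, by simp [hS], by simp [hN], hc1, ?_, by simp, ?_, by simp,
          by simp [HoldsTrace],
          ?_, ?_⟩) ?_
      · exact holdsMatrix_inputMem.congr (hf1.2 0 rfl)
      · intro i
        simp [hf1.2 aDel rfl, harr]
      · intro i
        simp [hf1.2 4 rfl, harr]
      · intro k l _
        simp [hf1.2 1 rfl, hf1.2 2 rfl, hf1.2 3 rfl, harr]
      · intro p tr' res hr
        exact ⟨p, by simpa using hr⟩
      · rintro t2 m2 hf2 ⟨tr, ⟨-, p, res, hrun, hres, hY, hK, htr⟩, ht2⟩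
        rw [Runs.seq_iff, Runs.assign_iff, Runs.assign_iff]
        refine ⟨p, tr, res, hrun, ⟨by simp [hres], fun Y h => hY Y h, by simp [hK], htr⟩, ?_⟩
        simp
        have : 120 * n * s = 120 * (s * n) := by ring
        omega

end Main


/-! ### The number of calls and the sizes of the matrices -/

section Trace

variable {s n : ℕ} {A : Matrix (Fin s) (Fin n) (WithBot ℕ)}

/-- A call of HK that allows the run to go on suppresses a row, and one where it gets stuck still
has a row to be charged to. -/
theorem OTestRun.length_le {R : Finset (Fin s)} {C : Finset (Fin n)} {p : ℕ}
    {tr : List (HKCall s n)} {res : Option (Finset (Fin n))} (h : OTestRun A R C p tr res) :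
    tr.length ≤ p ∧ 1 ≤ p ∧ tr.length ≤ R.card := by
  induction h with
  | empty C => simp
  | obvious R C hR hf => simp
  | stuck R C C' B C₀ Y₁ hR hf hC' hB hHK => exact ⟨le_rfl, le_rfl, Finset.card_pos.2 hR⟩
  | step R C C' B R₀ C₀ Y₁ p tr res hR hf hC' hB hHK hR₀ hrec ih =>
    have h1 := Finset.card_sdiff_add_card_eq_card hHK.1.1
    have h2 := Finset.card_pos.2 hR₀
    rw [List.length_cons]
    omega

/-- If `C₀ = ∅`, the rows `R₀` contain all the zeros of the flat columns, which are therefore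
entirely `-∞` on the remaining rows and no longer live. The matrices on which HK is called have
disjoint sets of columns. -/
theorem OTestRun.sum_card_cols_le {R : Finset (Fin s)} {C : Finset (Fin n)} {p : ℕ}
    {tr : List (HKCall s n)} {res : Option (Finset (Fin n))} (h : OTestRun A R C p tr res)
    (h0 : ∀ c ∈ tr, c.C₀ = ∅) :
    (tr.map fun c => c.cols.card).sum ≤ (liveColumns A R C).card := by
  induction h with
  | empty C => simp
  | obvious R C hR hf => simp
  | stuck R C C' B C₀ Y₁ hR hf hC' hB hHK =>
    subst hC' hB
    rw [List.map_singleton, List.sum_singleton]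
    exact Finset.card_le_card (Finset.filter_subset _ _)
  | step R C C' B R₀ C₀ Y₁ p tr res hR hf hC' hB hHK hR₀ hrec ih =>
    subst hC'
    have ih := ih fun c hc => h0 c (List.mem_cons_of_mem _ hc)
    have hC₀ : C₀ = ∅ := h0 _ List.mem_cons_self
    rw [List.map_cons, List.sum_cons]
    have hdisj : Disjoint B (liveColumns A (R \ R₀) (liveColumns A R C)) := by
      rw [Finset.disjoint_left]
      intro j hj hj'
      obtain ⟨i, hi, hij⟩ := (Finset.mem_filter.1 hj').2
      obtain ⟨hiR, hi₀⟩ := Finset.mem_sdiff.1 hi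
      have hz : A i j = 0 := by
        rw [hB] at hj
        exact ((Finset.mem_filter.1 hj).2 i hiR).resolve_left hij
      rcases hHK.1.2.2.1 i hiR j hj hz with h | h
      · exact hi₀ h
      · simp [hC₀] at h
    calc _ ≤ B.card + (liveColumns A (R \ R₀) (liveColumns A R C)).card := Nat.add_le_add_left ih _
      _ = (B ∪ liveColumns A (R \ R₀) (liveColumns A R C)).card :=
        (Finset.card_union_of_disjoint hdisj).symm
      _ ≤ _ := Finset.card_le_card
        (Finset.union_subset (hB ▸ Finset.filter_subset _ _) (Finset.filter_subset _ _))

theorem maxTransversalZeros_le_maxHKRank {tr : List (HKCall s n)} {c : HKCall s n} (hc : c ∈ tr) :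
    maxTransversalZeros A c.rows c.cols ≤ maxHKRank A tr := by
  induction tr with
  | nil => simp at hc
  | cons d tr ih =>
    rw [maxHKRank, List.map_cons, List.foldr_cons]
    rcases List.mem_cons.1 hc with rfl | hc
    · exact le_max_left _ _
    · exact (ih hc).trans (le_max_right _ _)

/-- The factor `2` absorbs the `+ 1` of `hkWork`, since the integer square root of the rank and `1`
are both at most `√(max 1 d)`. -/
theorem traceWork_le {tr : List (HKCall s n)} {d : ℕ}
    (hd : ∀ c ∈ tr, maxTransversalZeros A c.rows c.cols ≤ d) :
    (traceWork A tr : ℝ) ≤ tr.length * n +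
      2 * √(max 1 (d : ℝ)) * s * (tr.map fun c => c.cols.card).sum := by
  induction tr with
  | nil => simp [traceWork]
  | cons c tr ih =>
    have ih := ih fun c hc => hd c (List.mem_cons_of_mem _ hc)
    have h1 : (Nat.sqrt (maxTransversalZeros A c.rows c.cols) : ℝ) + 1 ≤ 2 * √(max 1 (d : ℝ)) := by
      have e1 : (Nat.sqrt (maxTransversalZeros A c.rows c.cols) : ℝ) ≤ √(max 1 (d : ℝ)) := by
        refine Real.nat_sqrt_le_real_sqrt.trans (Real.sqrt_le_sqrt (le_max_of_le_right ?_))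
        exact_mod_cast hd c List.mem_cons_self
      have e2 : 1 ≤ √(max 1 (d : ℝ)) := Real.one_le_sqrt.2 (le_max_left _ _)
      linarith
    have h2 : (hkWork A c : ℝ) ≤ n + 2 * √(max 1 (d : ℝ)) * (s * c.cols.card) := by
      rw [hkWork]
      push_cast
      gcongr
    have h3 : traceWork A (c :: tr) = hkWork A c + traceWork A tr := by simp [traceWork]
    rw [h3, List.length_cons, List.map_cons, List.sum_cons]
    push_cast at ih ⊢
    nlinarith

/-- The number `N` stands for `p * n` in general and for `n` when every `C₀` is empty. There are at
most `s` calls of HK, so their linear parts only contribute `s * n`. -/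
theorem oTest_time_le {t p N : ℕ} {tr : List (HKCall s n)} (h : ImplementsOTest oTest A t p tr)
    (ht : t ≤ 1000000 * (s * n + traceWork A tr + 1)) (hn : n ≤ N)
    (hN : (tr.map fun c => c.cols.card).sum ≤ N) :
    (t : ℝ) ≤ 4000000 * (√(max 1 (maxHKRank A tr : ℝ)) * s * N + 1) := by
  obtain ⟨m, res, -, hrun, -⟩ := h
  have hlen : (tr.length : ℝ) ≤ s := by
    have := hrun.length_le.2.2
    rw [Finset.card_univ, Fintype.card_fin] at this
    exact_mod_cast this
  have h1 := traceWork_le (A := A) (tr := tr) fun c hc => maxTransversalZeros_le_maxHKRank hc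
  have h2 : (t : ℝ) ≤ 1000000 * (s * n + traceWork A tr + 1) := by exact_mod_cast ht
  set q := √(max 1 (maxHKRank A tr : ℝ))
  have hq : 1 ≤ q := Real.one_le_sqrt.2 (le_max_left _ _)
  have h3 : (tr.length : ℝ) * n ≤ s * n := by gcongr
  have h4 : (s : ℝ) * n ≤ q * s * N := by
    calc (s : ℝ) * n ≤ s * N := by gcongr
      _ ≤ q * (s * N) := le_mul_of_one_le_left (by positivity) hq
      _ = _ := by ring
  have h5 : 2 * q * s * ((tr.map fun c => c.cols.card).sum : ℕ) ≤ 2 * q * s * N := by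
    gcongr
  linarith

end Trace


/-! ### Correctness and the two time bounds -/

theorem mainTheorem6 :
    -- the algorithm can always run to its end (also from each recursive call), and whatever the
    -- choices of HK it decides whether the saddle Jacobi number is `0`, and if so returns a set `Y`
    -- of `s` columns that reaches it
    (∀ (s n : ℕ) (A : Matrix (Fin s) (Fin n) (WithBot ℕ)),
      (∀ R C, ∃ p tr res, OTestRun A R C p tr res) ∧
      ∀ p tr res, OTestRun A Finset.univ Finset.univ p tr res →
        (res.isSome ↔ saddleJacobiNumber A = 0) ∧
        ∀ Y, res = some Y → Y.card = s ∧ jacobiNumberOn A Y = 0) ∧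
    -- it has an implementation in `O(d ^ (1 / 2) * p * s * n)` elementary operations
    (∃ (P : Prog) (K : ℝ), ∀ (s n : ℕ) (A : Matrix (Fin s) (Fin n) (WithBot ℕ)),
      ∃ t p tr, ImplementsOTest P A t p tr ∧
        (t : ℝ) ≤ K * (√(max 1 (maxHKRank A tr : ℝ)) * p * s * n + 1)) ∧
    -- it has an implementation in `O((d ^ (1 / 2) + log s) * s * n)` elementary operations on the
    -- matrices such that `C₀ = ∅` at each step
    (∃ (P : Prog) (K : ℝ), ∀ (s n : ℕ) (A : Matrix (Fin s) (Fin n) (WithBot ℕ)),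
      ∃ t p tr, ImplementsOTest P A t p tr ∧
        ((∀ c ∈ tr, c.C₀ = ∅) →
          (t : ℝ) ≤ K * ((√(max 1 (maxHKRank A tr : ℝ)) + Real.log s) * s * n + 1))) := by
  refine ⟨fun s n A => ⟨exists_oTestRun A, fun p tr res h => h.correct_univ⟩,
    ⟨oTest, 4000000, fun s n A => ?_⟩, ⟨oTest, 4000000, fun s n A => ?_⟩⟩
  · obtain ⟨t, p, tr, h, ht⟩ := oTest_spec A
    refine ⟨t, p, tr, h, ?_⟩
    obtain ⟨hp, hp1, -⟩ : tr.length ≤ p ∧ 1 ≤ p ∧ _ := let ⟨_, _, _, hrun, _⟩ := h; hrun.length_le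
    have hsum : (tr.map fun c => c.cols.card).sum ≤ p * n := by
      refine (List.sum_le_card_nsmul _ n ?_).trans ?_
      · intro x hx
        obtain ⟨c, -, rfl⟩ := List.mem_map.1 hx
        simpa using Finset.card_le_univ c.cols
      · rw [List.length_map, smul_eq_mul]
        exact Nat.mul_le_mul_right _ hp
    refine (oTest_time_le h ht (Nat.le_mul_of_pos_left n hp1) hsum).trans_eq ?_
    push_cast
    ring
  · obtain ⟨t, p, tr, h, ht⟩ := oTest_spec A
    refine ⟨t, p, tr, h, fun h0 => ?_⟩
    have hsum : (tr.map fun c => c.cols.card).sum ≤ n := by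
      obtain ⟨_, _, _, hrun, _⟩ := h
      simpa using (hrun.sum_card_cols_le h0).trans (Finset.card_le_univ _)
    refine (oTest_time_le h ht le_rfl hsum).trans ?_
    -- The bound `√d s n` already holds; adding the logarithm only weakens it, since it is
    -- nonnegative, also for `s = 0` where `Real.log 0 = 0`.
    have hlog : 0 ≤ Real.log s := Real.log_natCast_nonneg s
    gcongr
    linarith
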